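/- Let $(X,J,\Theta)$ be a complex Hermitian manifold, that is, $(X,J)$ is a (finite-dimensional, Hausdorff) complex manifold and $\Theta$ is a smooth real $(1,1)$-form on $X$ such that $g^{TX}(\cdot,\cdot)=\Theta(\cdot,J\cdot)$ is a Riemannian metric. Let $d^*$ be the formal adjoint of the exterior derivative $d$ on smooth complex-valued differential forms with respect to the $L^2$-product induced by $g^{TX}$, and let $\Delta=dd^*+d^*d$ be the Hodge Laplacian. Then $(X,J,\Theta)$ is Kähler, i.e. $d\Theta=0$, if and only if $\Delta$ preserves the bigrading, i.e. for all $p,q\ge 0$ it maps every smooth $(p,q)$-form to a $(p,q)$-form. -/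

import Mathlib

open scoped Manifold ContDiff

/-! Complex manifolds `X` are charted on a finite-dimensional complex vector space `E` with
holomorphic transition maps.  The complex structure `J` is multiplication by `Complex.I` on the
(complex) tangent spaces. -/

namespace HermitianGeometry

noncomputable section

/-! ### Linear algebra on one complex vector space -/

section Pointwise

variable {V : Type*} [AddCommGroup V] [Module ℂ V] [TopologicalSpace V]

/-- The space `Λ^{p,q} V*` of alternating forms of type `(p,q)`: the complex span of the wedge
products of `p` complex linear and `q` conjugate linear functionals (in any order).  The wedge
product of `k` one-forms `l₁, …, lₖ` evaluated on `v₁, …, vₖ` is the determinant of `(lᵢ (vⱼ))`. -/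
def formsOfType (k p q : ℕ) : Submodule ℂ (V [⋀^Fin k]→L[ℝ] ℂ) :=
  Submodule.span ℂ {η | ∃ (a : Fin p → (V →L[ℂ] ℂ)) (b : Fin q → (V →L⋆[ℂ] ℂ))
    (σ : Fin k ≃ Fin p ⊕ Fin q), ∀ v : Fin k → V,
      η v = Matrix.det (Matrix.of fun i j : Fin k =>
        Sum.elim (fun r => a r (v j)) (fun s => b s (v j)) (σ i))}

/-- The real bilinear form `g(u,v) = Θ(u, J v)` of a real two-form `Θ`. -/
def metric (Θ : V [⋀^Fin 2]→L[ℝ] ℂ) (u v : V) : ℝ :=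
  (Θ ![u, Complex.I • v]).re

end Pointwise

variable {E : Type*} [NormedAddCommGroup E] [NormedSpace ℂ E]

section Coordinates

variable [FiniteDimensional ℂ E]

variable (E) in
/-- A (fixed, arbitrary) system of real linear coordinates on the model space. -/
def realBasis : Module.Basis (Fin (Module.finrank ℝ E)) ℝ E := Module.finBasis ℝ E

/-- The matrix `g_{ij}` of the metric in the coordinates `realBasis E`. -/
def gram (Θ : E [⋀^Fin 2]→L[ℝ] ℂ) :
    Matrix (Fin (Module.finrank ℝ E)) (Fin (Module.finrank ℝ E)) ℝ :=
  Matrix.of fun i j => metric Θ (realBasis E i) (realBasis E j)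

/-- The Hermitian product on complex-valued `k`-forms induced by the metric `g` of `Θ`:
`⟨α,β⟩ = 1/k! ∑ g^{i₁j₁} ⋯ g^{iₖjₖ} α_{i₁…iₖ} conj β_{j₁…jₖ}`. -/
def formInner (Θ : E [⋀^Fin 2]→L[ℝ] ℂ) {k : ℕ} (α β : E [⋀^Fin k]→L[ℝ] ℂ) : ℂ :=
  (k.factorial : ℂ)⁻¹ * ∑ I : Fin k → Fin (Module.finrank ℝ E),
    ∑ J : Fin k → Fin (Module.finrank ℝ E),
      ((∏ a, (gram Θ)⁻¹ (I a) (J a) : ℝ) : ℂ) *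
        α (fun a => realBasis E (I a)) * star (β (fun a => realBasis E (J a)))

/-- The density `√(det g_{ij})` of the Riemannian volume with respect to Lebesgue measure. -/
def volumeDensity (Θ : E [⋀^Fin 2]→L[ℝ] ℂ) : ℝ := Real.sqrt (gram Θ).det

end Coordinates

/-! ### Differential forms on a complex manifold -/

variable {X : Type*} [TopologicalSpace X] [ChartedSpace E X]

variable (E X) in
/-- Complex-valued differential `k`-forms on `X` (not necessarily smooth). -/
abbrev DForm (k : ℕ) : Type _ :=
  (x : X) → TangentSpace 𝓘(ℂ, E) x [⋀^Fin k]→L[ℝ] ℂ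

/-- The expression of a form in a chart `e`, i.e. its pull-back by `e⁻¹`. -/
def inChart (e : OpenPartialHomeomorph X E) {k : ℕ} (α : DForm E X k) (z : E) :
    E [⋀^Fin k]→L[ℝ] ℂ :=
  (α (e.symm z)).compContinuousLinearMap
    ((mfderiv 𝓘(ℂ, E) 𝓘(ℂ, E) e.symm z).restrictScalars ℝ)

/-- Smooth forms: those with smooth coefficients in all charts. -/
def IsSmooth {k : ℕ} (α : DForm E X k) : Prop :=
  ∀ e ∈ atlas E X, ContDiffOn ℝ ∞ (inChart e α) e.target

/-- `(p,q)`-forms. -/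
def IsOfType (p q : ℕ) {k : ℕ} (α : DForm E X k) : Prop :=
  ∀ x, α x ∈ formsOfType k p q

/-- The exterior derivative `d`, computed at `x` in the preferred chart at `x`. -/
def extD {k : ℕ} (α : DForm E X k) : DForm E X (k + 1) := fun x =>
  (extDeriv (inChart (chartAt E x) α) (chartAt E x x)).compContinuousLinearMap
    ((mfderiv 𝓘(ℂ, E) 𝓘(ℂ, E) (chartAt E x) x).restrictScalars ℝ)

/-- `Θ` is a smooth real `(1,1)`-form such that `g = Θ(·, J ·)` is a Riemannian metric
(the symmetry of `g` follows from the type). -/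
structure IsHermitianForm (Θ : DForm E X 2) : Prop where
  smooth : IsSmooth Θ
  type_one_one : IsOfType 1 1 Θ
  real : ∀ x v, (Θ x v).im = 0
  pos : ∀ x (v : TangentSpace 𝓘(ℂ, E) x), v ≠ 0 → 0 < metric (Θ x) v v

/-- The Hermitian manifold is Kähler: `Θ` is closed. -/
def IsKahler (Θ : DForm E X 2) : Prop := ∀ x, extD Θ x = 0

section Laplacian

variable [FiniteDimensional ℂ E] [MeasurableSpace E] [BorelSpace E]

/-- The `L²` product `∫ ⟨α, β⟩ dvol_g` over the domain of the chart `e`, written in coordinates,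
of a form `α` given in coordinates, compactly supported in `e.target`, with the form `β`. -/
def l2Inner (Θ : DForm E X 2) (e : OpenPartialHomeomorph X E) {k : ℕ}
    (α : E → E [⋀^Fin k]→L[ℝ] ℂ) (β : DForm E X k) : ℂ :=
  ∫ z, formInner (inChart e Θ z) (α z) (inChart e β z) * (volumeDensity (inChart e Θ z) : ℂ)
    ∂(realBasis E).addHaar

/-- `γ = d^* β` for the formal `L²`-adjoint `d^*` of `d`: one has `(dα, β) = (α, γ)` for all smooth
forms `α` with compact support in the domain of a chart.  By a partition of unity this is the same
as testing with all smooth forms `α` with compact support (all smooth `α` if `X` is compact). -/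
def IsCodifferential (Θ : DForm E X 2) {k : ℕ} (β : DForm E X (k + 1)) (γ : DForm E X k) : Prop :=
  ∀ e ∈ atlas E X, ∀ α : E → E [⋀^Fin k]→L[ℝ] ℂ,
    ContDiff ℝ ∞ α → HasCompactSupport α → tsupport α ⊆ e.target →
      l2Inner Θ e (extDeriv α) β = l2Inner Θ e α γ

open Classical in
/-- The operator `d^*`: the smooth form `γ` with `(dα, β) = (α, γ)` for all test forms `α`, which
exists and is unique if `β` is smooth and `Θ` is a Hermitian form (and `0` if there is none). -/
def codifferential (Θ : DForm E X 2) {k : ℕ} (β : DForm E X (k + 1)) : DForm E X k :=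
  if h : ∃ γ : DForm E X k, IsSmooth γ ∧ IsCodifferential Θ β γ then h.choose else fun _ => 0

/-- The Hodge Laplacian `Δ = d d^* + d^* d`, where `d^* = 0` on functions. -/
def hodgeLaplacian (Θ : DForm E X 2) : {k : ℕ} → DForm E X k → DForm E X k
  | 0, α => codifferential Θ (extD α)
  | _ + 1, α => fun x => extD (codifferential Θ α) x + codifferential Θ (extD α) x

/-- `Δ` maps smooth `(p,q)`-forms to `(p,q)`-forms, for all `p` and `q`. -/
def LaplacianPreservesBigrading (Θ : DForm E X 2) : Prop :=
  ∀ (p q : ℕ) (α : DForm E X (p + q)),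
    IsSmooth α → IsOfType p q α → IsOfType p q (hodgeLaplacian Θ α)

end Laplacian

end

end HermitianGeometry

/-!
The bigrading is seen by a single operator. Let `𝒥` be the derivation of the exterior algebra that
extends `η ↦ η ∘ J` on one-forms (`derivAct (complexJ E)`). A form of degree `p + q` has type
`(p,q)` if and only if it is an eigenvector of `𝒥` for the eigenvalue `i(p - q)`
(`mem_formsOfType_iff`), so the theorem compares `dΘ = 0` with `Δ` respecting eigenforms of `𝒥`.

**The Laplacian in a chart.** With the Christoffel symbols `Γ` of the metric, given by the Koszul
formula, let `∇ = D - Γ` be the Levi-Civita connection on forms. Since `Γ` is symmetric, `d` is the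
antisymmetrization of `∇`. Since `∇` is metric, integration by parts shows that the formal adjoint
of `d` is `δ = -∑ g^{ij} ι_i ∇_j` (`IsHermitianOn.integral_extDeriv_eq`). Test forms separate
smooth forms (`IsHermitianOn.eq_zero_of_integral_eq_zero`) and `δ` is natural under holomorphic
coordinate changes (`IsCoordChange.localCodiff_pullback`), so the local operators `δ` glue, and
`d^*` is given by `δ` in every chart (`inChart_codifferential`).

**Kähler implies that the bigrading is preserved.** If `dΘ = 0`, the Koszul formula makes `Γ`
complex linear (`IsHermitianJet.christoffel_J`). Then `∇` commutes with `𝒥` and `Θ` is parallel, so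
that `∇` commutes with the Lefschetz operator `L = 2 Θ ∧ ·`. Composing `∇` with `J` before
antisymmetrizing or contracting defines `d^c` and `δ^c`, and the relations
`[𝒥, d] = d^c`, `[𝒥, d^c] = -d`, `[𝒥, δ] = δ^c`, `[𝒥, δ^c] = -δ` and `[δ, L] = 2 d^c` are pointwise
identities of multilinear algebra. With `δ² = 0` the last one gives `d^c δ + δ d^c = 0`. Bracketing
this with `𝒥` gives `Δ = dδ + δd = d^c δ^c + δ^c d^c`, and then `[𝒥, Δ]` equals both
`d δ^c + δ^c d` and its negative, hence vanishes (`laplacian_comm_of_relations`,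
`IsHermitianOn.derivAct_laplacian`).

**The converse.** Fix a chart and a point `z₀`, let `a` be a `(1,0)`-form with constant
coefficients, and let `f` be the affine function with `f(z₀) = 0` and gradient `w` at `z₀`. Then
`Δ(f a)` is `2 a(Γ(w, ·)) + c a` at `z₀`, with a real constant `c`
(`IsHermitianOn.contr_laplacian`). If it has type `(1,0)` for all `a` and `w`, then `Γ` is complex
linear at `z₀`, hence `D Θ = Γ · Θ`, and antisymmetrizing gives `dΘ = 0`
(`IsHermitianOn.extDeriv_eq_zero_of_laplacian`). To apply the hypothesis, `f a` is cut off near `z₀`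
and extended by zero to the manifold (`extendForm`).
-/


open scoped Manifold ContDiff
set_option maxSynthPendingDepth 3
namespace HermitianGeometry
noncomputable section
open ContinuousAlternatingMap (alternatizeUncurryFin alternatizeUncurryFinCLM
  alternatizeUncurryFin_apply alternatizeUncurryFinCLM_apply alternatizeUncurryFin_add
  alternatizeUncurryFin_smul curryLeftLI curryLeft_apply_apply fderivCompContinuousLinearMapCLM
  fderivCompContinuousLinearMap_apply fderivCompContinuousLinearMap_eq_alternatizeUncurryFin
  alternatizeUncurryFin_alternatizeUncurryFinCLM_comp_of_symmetric
  alternatizeUncurryFin_fderivCompContinuousLinearMap_eq_zero)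


/-! ### Exterior algebra: wedge product, contraction and derivations -/

section ExteriorAlgebra

variable {E : Type*} [NormedAddCommGroup E] [NormedSpace ℝ E]

/-- Complex-valued alternating real `k`-forms on `E`. -/
abbrev AltForm (E : Type*) [NormedAddCommGroup E] [NormedSpace ℝ E] (k : ℕ) : Type _ :=
  E [⋀^Fin k]→L[ℝ] ℂ

variable {k : ℕ}

/-- The contraction `ι_v` with a vector. -/
def contr (v : E) : AltForm E (k + 1) →L[ℝ] AltForm E k :=
  (curryLeftLI (𝕜 := ℝ) (E := E) (F := ℂ) (n := k)).toContinuousLinearMap.flip v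

/-- The derivation of the exterior algebra that extends the endomorphism `η ↦ η ∘ A` of the
one-forms: `(A · a)(v₁, …, vₖ) = ∑ a(v₁, …, A vⱼ, …, vₖ)`. -/
def derivAct (A : E →L[ℝ] E) : AltForm E k →L[ℝ] AltForm E k :=
  (fderivCompContinuousLinearMapCLM ℂ (.id ℝ E)).flip A

lemma contr_apply (v : E) (a : AltForm E (k + 1)) (w : Fin k → E) :
    contr v a w = a (Matrix.vecCons v w) := rfl

lemma contr_add (v w : E) (a : AltForm E (k + 1)) : contr (v + w) a = contr v a + contr w a := by
  simp [contr]

lemma contr_smul (c : ℝ) (v : E) (a : AltForm E (k + 1)) : contr (c • v) a = c • contr v a := by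
  simp [contr]

lemma contr_sum {ι : Type*} (s : Finset ι) (v : ι → E) (a : AltForm E (k + 1)) :
    contr (∑ i ∈ s, v i) a = ∑ i ∈ s, contr (v i) a := by
  simp [contr]

lemma contr_complex_smul (c : ℂ) (v : E) (a : AltForm E (k + 1)) :
    contr v (c • a) = c • contr v a := by
  ext w; simp [contr_apply]

/-- A form of positive degree is determined by its contractions. -/
lemma ext_contr {a b : AltForm E (k + 1)} (h : ∀ v, contr v a = contr v b) : a = b := by
  ext v
  have := congrArg (fun f : AltForm E k => f (Matrix.vecTail v)) (h (Matrix.vecHead v))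
  simpa [contr_apply] using this

lemma derivAct_apply (A : E →L[ℝ] E) (a : AltForm E k) (v : Fin k → E) :
    derivAct A a v = ∑ i, a (Function.update v i (A (v i))) := by
  have : derivAct A a = a.fderivCompContinuousLinearMap (.id ℝ E) A := rfl
  rw [this, fderivCompContinuousLinearMap_apply]
  refine Finset.sum_congr rfl fun i _ => congrArg _ (funext fun j => ?_)
  rcases eq_or_ne j i with rfl | h
  · simp
  · simp [h]

lemma derivAct_zero_degree (A : E →L[ℝ] E) (a : AltForm E 0) : derivAct A a = 0 := by
  ext v; simp [derivAct_apply]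

/-- The form `A · a` is the antisymmetrization of `w ↦ ι_{A w} a`. -/
lemma derivAct_eq_alternatize (A : E →L[ℝ] E) (a : AltForm E (k + 1)) :
    derivAct A a = alternatizeUncurryFin (a.curryLeft ∘L A) := by
  have : derivAct A a = a.fderivCompContinuousLinearMap (.id ℝ E) A := rfl
  rw [this, fderivCompContinuousLinearMap_eq_alternatizeUncurryFin]
  simp only [ContinuousLinearMap.comp_apply, alternatizeUncurryFinCLM_apply]
  congr 1

lemma derivAct_complex_smul (c : ℂ) (A : E →L[ℝ] E) (a : AltForm E k) :
    derivAct A (c • a) = c • derivAct A a := by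
  ext w; simp [derivAct_apply, Finset.mul_sum]

/-- Contraction is an antiderivation: for `f = ξ ⊗ a` this reads
`ι_v (ξ ∧ a) = ξ(v) a - ξ ∧ ι_v a`. -/
lemma contr_alternatize (f : E →L[ℝ] AltForm E (k + 1)) (v : E) :
    contr v (alternatizeUncurryFin f) = f v - alternatizeUncurryFin (contr v ∘L f) := by
  ext w
  rw [ContinuousAlternatingMap.sub_apply]
  simp only [contr_apply, alternatizeUncurryFin_apply, ContinuousLinearMap.comp_apply]
  rw [Fin.sum_univ_succ]
  simp only [Fin.val_zero, pow_zero, one_smul, Matrix.cons_val_zero, Matrix.cons_val_succ,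
    Fin.val_succ, sub_eq_add_neg, ← Finset.sum_neg_distrib]
  congr 1
  refine Finset.sum_congr rfl fun i _ => ?_
  rw [pow_succ, mul_neg_one, _root_.neg_smul]
  congr 3
  ext j
  refine Fin.cases ?_ (fun j => ?_) j
  · simp [Fin.removeNth]
  · simp [Fin.removeNth]

lemma contr_alternatize_zero (f : E →L[ℝ] AltForm E 0) (v : E) :
    contr v (alternatizeUncurryFin f) = f v := by
  ext w
  simp only [contr_apply, alternatizeUncurryFin_apply, Fin.sum_univ_succ]
  simp only [Fin.val_zero, pow_zero, one_smul, Matrix.cons_val_zero, Finset.univ_eq_empty,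
    Finset.sum_empty, add_zero]
  congr 1

/-- The commutator of a derivation with the contraction `ι_v` is `ι_{A v}`. -/
lemma contr_derivAct (A : E →L[ℝ] E) (a : AltForm E (k + 1)) (v : E) :
    contr v (derivAct A a) = derivAct A (contr v a) + contr (A v) a := by
  cases k with
  | zero =>
    rw [derivAct_eq_alternatize, contr_alternatize_zero, derivAct_zero_degree, zero_add]
    rfl
  | succ k =>
    rw [derivAct_eq_alternatize, contr_alternatize, derivAct_eq_alternatize]
    have : contr v ∘L (a.curryLeft ∘L A) = -((contr v a).curryLeft ∘L A) := by
      ext w u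
      simp only [ContinuousLinearMap.comp_apply, contr_apply, curryLeft_apply_apply, neg_apply,
        ContinuousAlternatingMap.neg_apply]
      have := a.map_swap (Matrix.vecCons (A w) (Matrix.vecCons v u)) (i := 0) (j := 1) (by simp)
      refine neg_eq_iff_eq_neg.mp (this.symm.trans ?_)
      change a _ = a _
      congr 1
      ext j
      refine Fin.cases ?_ (fun j => Fin.cases ?_ (fun j => ?_) j) j
      · simp
      · simp
      · have h1 : (j.succ.succ : Fin (k+1+1)) ≠ 0 := Fin.succ_ne_zero _
        have h2 : (j.succ.succ : Fin (k+1+1)) ≠ 1 := by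
          rw [← Fin.succ_zero_eq_one]; exact fun h => Fin.succ_ne_zero _ (Fin.succ_injective _ h)
        simp [Equiv.swap_apply_of_ne_of_ne h1 h2]
    rw [this, ← alternatizeUncurryFinCLM_apply ((-_ : E →L[ℝ] AltForm E k)), map_neg,
      alternatizeUncurryFinCLM_apply, sub_neg_eq_add]
    exact add_comm _ _

/-- Iterated antisymmetrization is antisymmetric in the two extra arguments. -/
lemma alternatize_alternatize_flip (f : E →L[ℝ] E →L[ℝ] AltForm E k) :
    alternatizeUncurryFin (alternatizeUncurryFinCLM ℝ E ℂ ∘L f.flip) =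
      -alternatizeUncurryFin (alternatizeUncurryFinCLM ℝ E ℂ ∘L f) := by
  have h := alternatizeUncurryFin_alternatizeUncurryFinCLM_comp_of_symmetric
    (f := f + f.flip) (fun x y => by simp [add_comm])
  rw [ContinuousLinearMap.comp_add, alternatizeUncurryFin_add] at h
  exact eq_neg_of_add_eq_zero_right h

lemma alternatize_neg (f : E →L[ℝ] AltForm E k) :
    alternatizeUncurryFin (-f) = -alternatizeUncurryFin f :=
  map_neg (alternatizeUncurryFinCLM ℝ E ℂ) f

lemma alternatize_sub (f g : E →L[ℝ] AltForm E k) :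
    alternatizeUncurryFin (f - g) = alternatizeUncurryFin f - alternatizeUncurryFin g :=
  map_sub (alternatizeUncurryFinCLM ℝ E ℂ) f g

/-- Derivations act on wedge products by the Leibniz rule: here the antisymmetrization of a
form-valued linear map `f` stands for a sum of products `ξ ∧ a`. -/
lemma derivAct_alternatize (A : E →L[ℝ] E) (f : E →L[ℝ] AltForm E k) :
    derivAct A (alternatizeUncurryFin f) =
      alternatizeUncurryFin (derivAct A ∘L f) + alternatizeUncurryFin (f ∘L A) := by
  rw [derivAct_eq_alternatize]
  cases k with
  | zero =>
    have h0 : derivAct A ∘L f = 0 := by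
      ext1 v; exact derivAct_zero_degree A _
    rw [h0, ← alternatizeUncurryFinCLM_apply 0, map_zero]
    refine Eq.trans ?_ (zero_add _).symm
    congr 1
    ext1 v
    exact contr_alternatize_zero f (A v)
  | succ k =>
    -- the bilinear map `(w, u) ↦ ι_{A w} (f u)`
    let B : E →L[ℝ] E →L[ℝ] AltForm E k :=
      ((ContinuousLinearMap.compL ℝ E (AltForm E (k+1)) (AltForm E k)).flip f) ∘L
        ((curryLeftLI (𝕜 := ℝ) (E := E) (F := ℂ) (n := k)).toContinuousLinearMap.flip ∘L A)
    have hB : ∀ w u, B w u = contr (A w) (f u) := fun w u => rfl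
    have h1 : (alternatizeUncurryFin f).curryLeft ∘L A =
        f ∘L A - alternatizeUncurryFinCLM ℝ E ℂ ∘L B := by
      ext1 w
      exact contr_alternatize f (A w)
    have h2 : derivAct A ∘L f = alternatizeUncurryFinCLM ℝ E ℂ ∘L B.flip := by
      ext1 u
      exact derivAct_eq_alternatize A (f u)
    rw [h1, h2, alternatize_sub, alternatize_alternatize_flip]
    abel

/-- Commuting endomorphisms induce commuting derivations. -/
lemma derivAct_comm {A B : E →L[ℝ] E} (h : A ∘L B = B ∘L A) (a : AltForm E k) :
    derivAct A (derivAct B a) = derivAct B (derivAct A a) := by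
  cases k with
  | zero => simp [derivAct_zero_degree]
  | succ k =>
    rw [derivAct_eq_alternatize B a, derivAct_alternatize, derivAct_eq_alternatize B,
      ← alternatizeUncurryFin_add]
    congr 1
    ext1 w
    have h' : A (B w) = B (A w) := congrArg (fun f : E →L[ℝ] E => f w) h
    change derivAct A (contr (B w) a) + contr (B (A w)) a = contr (B w) (derivAct A a)
    rw [contr_derivAct, h']

/-- For symmetric Christoffel symbols `Γ`, the correction `u ↦ Γ_u · a` is killed by
antisymmetrization. -/
lemma alternatize_derivAct_symm (Γ : E →L[ℝ] E →L[ℝ] E) (hΓ : ∀ u v, Γ u v = Γ v u)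
    (a : AltForm E k) :
    alternatizeUncurryFin (((fderivCompContinuousLinearMapCLM ℂ (.id ℝ E)) a) ∘L Γ) = 0 :=
  alternatizeUncurryFin_fderivCompContinuousLinearMap_eq_zero a _ hΓ

/-! ### The Lefschetz operator -/

/-- The bilinear map `(u, w) ↦ c(u, w) • a`. -/
def bilinSMul (c : E →L[ℝ] E →L[ℝ] ℂ) (a : AltForm E k) : E →L[ℝ] E →L[ℝ] AltForm E k :=
  (ContinuousLinearMap.compL ℝ E ℂ (AltForm E k) ((ContinuousLinearMap.lsmul ℝ ℂ).flip a)) ∘L c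

lemma bilinSMul_apply (c : E →L[ℝ] E →L[ℝ] ℂ) (a : AltForm E k) (u w : E) :
    bilinSMul c a u w = c u w • a := rfl

/-- The linear map `w ↦ ξ(w) • a`, whose antisymmetrization is `ξ ∧ a`. -/
def covecSMul (ξ : E →L[ℝ] ℂ) (a : AltForm E k) : E →L[ℝ] AltForm E k :=
  ((ContinuousLinearMap.lsmul ℝ ℂ).flip a) ∘L ξ

lemma covecSMul_apply (ξ : E →L[ℝ] ℂ) (a : AltForm E k) (w : E) :
    covecSMul ξ a w = ξ w • a := rfl

/-- The Lefschetz operator: for an antisymmetric `c` this is twice the wedge product with the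
two-form `c`. -/
def lefschetz (c : E →L[ℝ] E →L[ℝ] ℂ) (a : AltForm E k) : AltForm E (k + 2) :=
  alternatizeUncurryFin (alternatizeUncurryFinCLM ℝ E ℂ ∘L bilinSMul c a)

lemma lefschetz_add (c : E →L[ℝ] E →L[ℝ] ℂ) (a b : AltForm E k) :
    lefschetz c (a + b) = lefschetz c a + lefschetz c b := by
  have : bilinSMul c (a + b) = bilinSMul c a + bilinSMul c b := by
    ext1 u; ext1 w; simp [bilinSMul_apply]
  simp only [lefschetz, this, ContinuousLinearMap.comp_add, alternatizeUncurryFin_add]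

lemma alternatize_complex_smul (c : ℂ) (f : E →L[ℝ] AltForm E k) :
    alternatizeUncurryFin (c • f) = c • alternatizeUncurryFin f :=
  alternatizeUncurryFin_smul c f

lemma lefschetz_smul (c : E →L[ℝ] E →L[ℝ] ℂ) (z : ℂ) (a : AltForm E k) :
    lefschetz c (z • a) = z • lefschetz c a := by
  have : alternatizeUncurryFinCLM ℝ E ℂ ∘L bilinSMul c (z • a) =
      z • (alternatizeUncurryFinCLM ℝ E ℂ ∘L bilinSMul c a) := by
    ext1 u
    have : bilinSMul c (z • a) u = z • bilinSMul c a u := by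
      ext1 w; simp [bilinSMul_apply, smul_comm z]
    simp only [ContinuousLinearMap.comp_apply, this, alternatizeUncurryFinCLM_apply,
      alternatize_complex_smul, smul_apply]
  rw [lefschetz, this, alternatize_complex_smul, lefschetz]

lemma contr_covecSMul_alternatize (ξ : E →L[ℝ] ℂ) (a : AltForm E (k + 1)) (v : E) :
    contr v (alternatizeUncurryFin (covecSMul ξ a)) =
      ξ v • a - alternatizeUncurryFin (covecSMul ξ (contr v a)) := by
  rw [contr_alternatize]
  congr 2

/-- The case of degree zero of `contr_lefschetz`, in which `ι_v a` is zero. -/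
lemma contr_lefschetz_zero (c : E →L[ℝ] E →L[ℝ] ℂ) (hc : ∀ u w, c u w = -c w u)
    (a : AltForm E 0) (v : E) :
    contr v (lefschetz c a) = (2 : ℝ) • alternatizeUncurryFin (covecSMul (c v) a) := by
  rw [lefschetz, contr_alternatize]
  have h1 : (alternatizeUncurryFinCLM ℝ E ℂ ∘L bilinSMul c a) v =
      alternatizeUncurryFin (covecSMul (c v) a) := rfl
  have h2 : contr v ∘L (alternatizeUncurryFinCLM ℝ E ℂ ∘L bilinSMul c a) =
      -covecSMul (c v) a := by
    ext1 u
    change contr v (alternatizeUncurryFin (covecSMul (c u) a)) = -(c v u • a)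
    rw [contr_alternatize_zero, covecSMul_apply, hc u v, _root_.neg_smul]
  rw [h1, h2, alternatize_neg, two_smul, sub_neg_eq_add]

/-- The rule `ι_v (2 c ∧ a) = 2 c ∧ ι_v a + 2 c(v, ·) ∧ a`. -/
lemma contr_lefschetz (c : E →L[ℝ] E →L[ℝ] ℂ) (hc : ∀ u w, c u w = -c w u)
    (a : AltForm E (k + 1)) (v : E) :
    contr v (lefschetz c a) =
      lefschetz c (contr v a) + (2 : ℝ) • alternatizeUncurryFin (covecSMul (c v) a) := by
  rw [lefschetz, contr_alternatize]
  have h1 : (alternatizeUncurryFinCLM ℝ E ℂ ∘L bilinSMul c a) v =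
      alternatizeUncurryFin (covecSMul (c v) a) := rfl
  have h2 : contr v ∘L (alternatizeUncurryFinCLM ℝ E ℂ ∘L bilinSMul c a) =
      -covecSMul (c v) a - alternatizeUncurryFinCLM ℝ E ℂ ∘L bilinSMul c (contr v a) := by
    ext1 u
    change contr v (alternatizeUncurryFin (covecSMul (c u) a)) = -(c v u • a) -
      alternatizeUncurryFin (covecSMul (c u) (contr v a))
    rw [contr_covecSMul_alternatize, hc u v, _root_.neg_smul]
  rw [h1, h2, alternatize_sub, alternatize_neg, two_smul, lefschetz]
  abel

/-- Derivations act on the Lefschetz operator by the Leibniz rule. -/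
lemma derivAct_lefschetz (A : E →L[ℝ] E) (c c' : E →L[ℝ] E →L[ℝ] ℂ)
    (hc : ∀ u w, c' u w = c (A u) w + c u (A w)) (a : AltForm E k) :
    derivAct A (lefschetz c a) = lefschetz c (derivAct A a) + lefschetz c' a := by
  have h1 : derivAct A ∘L (alternatizeUncurryFinCLM ℝ E ℂ ∘L bilinSMul c a) +
      (alternatizeUncurryFinCLM ℝ E ℂ ∘L bilinSMul c a) ∘L A =
      alternatizeUncurryFinCLM ℝ E ℂ ∘L bilinSMul c (derivAct A a) +
        alternatizeUncurryFinCLM ℝ E ℂ ∘L bilinSMul c' a := by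
    ext1 u
    change derivAct A (alternatizeUncurryFin (covecSMul (c u) a)) +
      alternatizeUncurryFin (covecSMul (c (A u)) a) =
      alternatizeUncurryFin (covecSMul (c u) (derivAct A a)) +
        alternatizeUncurryFin (covecSMul (c' u) a)
    rw [derivAct_alternatize]
    simp only [← alternatizeUncurryFin_add]
    congr 1
    ext1 w
    simp only [add_apply, ContinuousLinearMap.comp_apply, covecSMul_apply,
      derivAct_complex_smul, hc, add_smul]
    abel
  rw [lefschetz, derivAct_alternatize, ← alternatizeUncurryFin_add, h1, alternatizeUncurryFin_add]
  rfl

end ExteriorAlgebra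

/-! ### The type decomposition -/

section Types

variable {E : Type*} [NormedAddCommGroup E] [NormedSpace ℂ E] {k : ℕ}

variable (E) in
/-- The complex structure `J`, i.e. multiplication by `Complex.I`, as a real linear map. -/
def complexJ : E →L[ℝ] E := (Complex.I • ContinuousLinearMap.id ℂ E).restrictScalars ℝ

lemma complexJ_apply (v : E) : complexJ E v = Complex.I • v := rfl

lemma complexJ_complexJ (v : E) : complexJ E (complexJ E v) = -v := by
  simp [complexJ_apply, smul_smul]

/-- The weight `i(p-q)` of forms of type `(p,q)` under the derivation `J`. -/
def typeWeight (p q : ℕ) : ℂ := Complex.I * ((p : ℂ) - q)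

/-- Multiplying one column at a time by the row weights `d` and summing gives the trace of `d` times
the determinant. -/
lemma sum_det_update_column {n : Type*} [Fintype n] [DecidableEq n] (M : Matrix n n ℂ)
    (d : n → ℂ) :
    ∑ i, Matrix.det (Matrix.of fun r j => if j = i then d r * M r j else M r j) =
      (∑ r, d r) * M.det := by
  simp only [Matrix.det_apply, Matrix.of_apply]
  rw [Finset.sum_comm, Finset.mul_sum]
  refine Finset.sum_congr rfl fun σ _ => ?_
  rw [← Finset.smul_sum, mul_smul_comm]
  congr 1
  have : ∀ i, (∏ x, if x = i then d (σ x) * M (σ x) x else M (σ x) x) =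
      d (σ i) * ∏ x, M (σ x) x := by
    intro i
    rw [← Finset.mul_prod_erase _ _ (Finset.mem_univ i),
      ← Finset.mul_prod_erase _ (fun x => M (σ x) x) (Finset.mem_univ i), if_pos rfl, mul_assoc]
    congr 2
    exact Finset.prod_congr rfl fun x hx => if_neg (Finset.ne_of_mem_erase hx)
  simp only [this, ← Finset.sum_mul]
  rw [Equiv.sum_comp σ d]

/-- Forms of type `(p,q)` are eigenvectors of the derivation induced by `J`. -/
lemma derivAct_of_mem_formsOfType {p q : ℕ} {η : AltForm E k} (h : η ∈ formsOfType k p q) :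
    derivAct (complexJ E) η = typeWeight p q • η := by
  induction h using Submodule.span_induction with
  | mem η h =>
    obtain ⟨a, b, σ, h⟩ := h
    ext v
    rw [derivAct_apply, ContinuousAlternatingMap.smul_apply]
    -- the weight of each row of the determinant
    let d : Fin k → ℂ := fun i => Sum.elim (fun _ => Complex.I) (fun _ => -Complex.I) (σ i)
    have hd : ∑ r, d r = typeWeight p q := by
      rw [Equiv.sum_comp σ (Sum.elim (fun _ => Complex.I) (fun _ => -Complex.I))]
      simp [typeWeight]; ring
    rw [h v, smul_eq_mul, ← hd, ← sum_det_update_column]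
    refine Finset.sum_congr rfl fun i _ => ?_
    rw [h]
    congr 1
    ext r j
    simp only [Matrix.of_apply, d]
    rcases eq_or_ne j i with rfl | hj
    · simp only [Function.update_self, if_true, complexJ_apply]
      cases σ r with
      | inl s => simp
      | inr s => simp
    · simp [hj]
  | zero => simp
  | add x y _ _ hx hy => rw [map_add, hx, hy, smul_add]
  | smul c x _ hx => rw [derivAct_complex_smul, hx, smul_comm]

/-- The complex linear part of a real functional. -/
def linearPart (l : E →L[ℝ] ℝ) : E →L[ℂ] ℂ where
  toFun v := ((l v : ℂ) - Complex.I * (l (Complex.I • v) : ℂ)) / 2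
  map_add' u v := by simp only [smul_add, map_add, Complex.ofReal_add]; ring
  map_smul' c v := by
    have h1 : ∀ w : E, c • w = c.re • w + c.im • (Complex.I • w) := fun w => by
      rw [← Complex.coe_smul, ← Complex.coe_smul, smul_smul, ← add_smul, Complex.re_add_im]
    simp only [h1, smul_add, map_add, map_smul, smul_comm Complex.I, smul_smul, Complex.I_mul_I,
      RingHom.id_apply, smul_eq_mul, neg_smul, one_smul, smul_neg, map_neg, Complex.ofReal_add,
      Complex.ofReal_mul, Complex.ofReal_neg]
    conv_rhs => rw [← Complex.re_add_im c]
    linear_combination ((c.im : ℂ) * l (Complex.I • v) / 2) * Complex.I_mul_I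
  cont := by fun_prop

/-- The conjugate linear part of a real functional. -/
def antilinearPart (l : E →L[ℝ] ℝ) : E →L⋆[ℂ] ℂ where
  toFun v := ((l v : ℂ) + Complex.I * (l (Complex.I • v) : ℂ)) / 2
  map_add' u v := by simp only [smul_add, map_add, Complex.ofReal_add]; ring
  map_smul' c v := by
    have h1 : ∀ w : E, c • w = c.re • w + c.im • (Complex.I • w) := fun w => by
      rw [← Complex.coe_smul, ← Complex.coe_smul, smul_smul, ← add_smul, Complex.re_add_im]
    have h2 : (starRingEnd ℂ) c = c.re - c.im * Complex.I := by
      apply Complex.ext <;> simp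
    simp only [h1, smul_add, map_add, map_smul, smul_comm Complex.I, smul_smul, Complex.I_mul_I,
      smul_eq_mul, neg_smul, one_smul, smul_neg, map_neg, Complex.ofReal_add,
      Complex.ofReal_mul, Complex.ofReal_neg, h2]
    linear_combination ((c.im : ℂ) * l (Complex.I • v) / 2) * Complex.I_mul_I
  cont := by fun_prop

lemma linearPart_add_antilinearPart (l : E →L[ℝ] ℝ) (v : E) :
    linearPart l v + antilinearPart l v = l v := by
  change ((l v : ℂ) - _) / 2 + ((l v : ℂ) + _) / 2 = _
  ring

/-- The wedge product of `k` real functionals. -/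
def realWedge (l : Fin k → E →L[ℝ] ℂ) : AltForm E k :=
  { toMultilinearMap :=
      (Matrix.detRowAlternating (n := Fin k) (R := ℂ)).toMultilinearMap.restrictScalars ℝ
        |>.compLinearMap (fun _ => (LinearMap.pi fun r => (l r : E →ₗ[ℝ] ℂ)))
    cont := by
      change Continuous fun v : Fin k → E => Matrix.det (fun j r => l r (v j))
      exact Continuous.matrix_det (by fun_prop)
    map_eq_zero_of_eq' := fun v i j h hij => by
      change Matrix.det (fun j r => l r (v j)) = 0
      exact Matrix.det_zero_of_row_eq hij (by ext r; simp [h]) }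

lemma realWedge_apply (l : Fin k → E →L[ℝ] ℂ) (v : Fin k → E) :
    realWedge l v = Matrix.det (Matrix.of fun r j => l r (v j)) := by
  rw [← Matrix.det_transpose]; rfl

variable [FiniteDimensional ℂ E]

/-- Every form is a combination of wedge products of real functionals. -/
lemma eq_sum_realWedge (η : AltForm E k) :
    η = (k.factorial : ℂ)⁻¹ • ∑ I : Fin k → Fin (Module.finrank ℝ E),
      η (fun r => realBasis E (I r)) • realWedge (fun r =>
        Complex.ofRealCLM ∘L LinearMap.toContinuousLinearMap ((realBasis E).coord (I r))) := by
  ext v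
  rw [ContinuousAlternatingMap.smul_apply, ContinuousAlternatingMap.sum_apply]
  simp only [ContinuousAlternatingMap.smul_apply, realWedge_apply]
  -- expand `η` at the permuted arguments
  have key : ∀ σ : Equiv.Perm (Fin k), ∑ I : Fin k → Fin (Module.finrank ℝ E),
      η (fun r => realBasis E (I r)) * ∏ j, (((realBasis E).repr (v j) (I (σ j)) : ℝ) : ℂ) =
      ((Equiv.Perm.sign σ : ℤ) : ℂ) * η v := by
    intro σ
    have h1 : η (v ∘ σ.symm) = ((Equiv.Perm.sign σ : ℤ) : ℂ) * η v := by
      have := η.toAlternatingMap.map_perm v σ.symm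
      rw [Equiv.Perm.sign_symm, Units.smul_def, zsmul_eq_mul] at this
      exact this
    rw [← h1]
    have h2 : η (v ∘ σ.symm) = η.toMultilinearMap (fun r => ∑ i,
        (realBasis E).repr (v (σ.symm r)) i • realBasis E i) := by
      simp only [Module.Basis.sum_repr]; rfl
    rw [h2, MultilinearMap.map_sum]
    refine Finset.sum_congr rfl fun I _ => ?_
    rw [MultilinearMap.map_smul_univ, Complex.real_smul, mul_comm]
    congr 1
    rw [Complex.ofReal_prod]
    exact (Fintype.prod_equiv σ _ _ (fun j => by simp))
  have h3 : ∀ I : Fin k → Fin (Module.finrank ℝ E),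
      η (fun r => realBasis E (I r)) • Matrix.det (Matrix.of fun r j =>
        (Complex.ofRealCLM ∘L LinearMap.toContinuousLinearMap ((realBasis E).coord (I r))) (v j)) =
      ∑ σ : Equiv.Perm (Fin k), ((Equiv.Perm.sign σ : ℤ) : ℂ) *
        (η (fun r => realBasis E (I r)) * ∏ j, (((realBasis E).repr (v j) (I (σ j)) : ℝ) : ℂ)) := by
    intro I
    rw [Matrix.det_apply, Finset.smul_sum]
    refine Finset.sum_congr rfl fun σ _ => ?_
    rw [Units.smul_def, zsmul_eq_mul, smul_eq_mul]
    simp only [Matrix.of_apply, ContinuousLinearMap.comp_apply, Complex.ofRealCLM_apply,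
      LinearMap.coe_toContinuousLinearMap', Module.Basis.coord_apply]
    ring
  simp only [h3]
  rw [Finset.sum_comm]
  simp only [← Finset.mul_sum, key]
  have h4 : ∀ σ : Equiv.Perm (Fin k), ((Equiv.Perm.sign σ : ℤ) : ℂ) *
      (((Equiv.Perm.sign σ : ℤ) : ℂ) * η v) = η v := by
    intro σ
    rw [← mul_assoc, ← Int.cast_mul, ← Units.val_mul, Int.units_mul_self]; simp
  simp only [h4, Finset.sum_const, Finset.card_univ, Fintype.card_perm, Fintype.card_fin,
    nsmul_eq_mul, smul_eq_mul]
  rw [inv_mul_cancel_left₀]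
  exact_mod_cast k.factorial_ne_zero

omit [FiniteDimensional ℂ E] in
/-- A complex subspace that contains all forms of pure type contains the wedge products of real
functionals: split each factor into its linear and antilinear part and expand. -/
lemma realWedge_mem_of_forall (W : Submodule ℂ (AltForm E k))
    (hW : ∀ p q, p + q = k → formsOfType k p q ≤ W) (l : Fin k → E →L[ℝ] ℝ) :
    realWedge (fun r => Complex.ofRealCLM ∘L l r) ∈ W := by
  -- the piece in which the factors indexed by `s` are linear and the others antilinear
  let L : Fin k → E →L[ℝ] ℂ := fun r => (linearPart (l r)).restrictScalars ℝ
  let A : Finset (Fin k) → Fin k → E →L[ℝ] ℂ := fun s =>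
    s.piecewise L (fun r => Complex.ofRealCLM ∘L l r - L r)
  have hanti : ∀ r v, (Complex.ofRealCLM ∘L l r - L r) v = antilinearPart (l r) v := fun r v => by
    rw [sub_apply]
    exact sub_eq_of_eq_add' (linearPart_add_antilinearPart (l r) v).symm
  have h : realWedge (fun r => Complex.ofRealCLM ∘L l r) = ∑ s, realWedge (A s) := by
    ext v
    rw [ContinuousAlternatingMap.sum_apply]
    simp only [realWedge_apply]
    have := (Matrix.detRowAlternating (n := Fin k) (R := ℂ)).toMultilinearMap.map_add_univ
      (fun r j => L r (v j)) (fun r j => (Complex.ofRealCLM ∘L l r - L r) (v j))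
    refine Eq.trans ?_ (this.trans (Finset.sum_congr rfl fun s _ => ?_))
    · change Matrix.det _ = Matrix.det _
      congr 1
      ext r j
      simp
    · change Matrix.det _ = Matrix.det _
      congr 1
      ext r j
      by_cases hr : r ∈ s <;> simp [A, hr]
  rw [h]
  refine W.sum_mem fun s _ => ?_
  have hcard : s.card + sᶜ.card = k := by simp [Finset.card_add_card_compl]
  refine hW s.card sᶜ.card hcard (Submodule.subset_span ?_)
  let e := finSumEquivOfFinset (s := s) rfl rfl
  refine ⟨fun r => linearPart (l (e (.inl r))), fun r => antilinearPart (l (e (.inr r))),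
    e.symm, fun v => ?_⟩
  rw [realWedge_apply]
  congr 1
  ext r j
  obtain ⟨t, rfl⟩ := e.surjective r
  simp only [Matrix.of_apply, Equiv.symm_apply_apply, A]
  cases t with
  | inl t =>
    have : e (.inl t) ∈ s := by simp [e]
    simp only [Finset.piecewise_eq_of_mem _ _ _ this, Sum.elim_inl]
    rfl
  | inr t =>
    have : e (.inr t) ∉ s := by rw [← Finset.mem_compl]; simp [e]
    simp only [Finset.piecewise_eq_of_notMem _ _ _ this, Sum.elim_inr]
    exact hanti _ _

/-- A form of degree `p + q` is of type `(p,q)` if and only if it is an eigenvector of the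
derivation induced by `J` for the weight of the type. Conversely to `derivAct_of_mem_formsOfType`,
the spaces of pure type span all forms, and among those of degree `p + q` different types have
different weights, so that independence of eigenspaces applies. -/
theorem mem_formsOfType_iff {p q : ℕ} (hk : p + q = k) (η : AltForm E k) :
    η ∈ formsOfType k p q ↔ derivAct (complexJ E) η = typeWeight p q • η := by
  refine ⟨derivAct_of_mem_formsOfType, fun h => ?_⟩
  let f : Module.End ℂ (AltForm E k) :=
    { toFun := derivAct (complexJ E), map_add' := map_add _,
      map_smul' := fun c a => derivAct_complex_smul c _ a }
  let S : Submodule ℂ (AltForm E k) :=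
    formsOfType k p q ⊔ ⨆ (μ : ℂ) (_ : μ ≠ typeWeight p q), f.eigenspace μ
  have hS : η ∈ S := by
    rw [eq_sum_realWedge η]
    refine S.smul_mem _ (S.sum_mem fun I _ => S.smul_mem _ (realWedge_mem_of_forall S ?_ _))
    intro p' q' h'
    rcases eq_or_ne p' p with rfl | hne
    · obtain rfl : q' = q := by omega
      exact le_sup_left
    · refine le_trans ?_ le_sup_right
      have hμ : typeWeight p' q' ≠ typeWeight p q := by
        intro h
        have h1 := mul_left_cancel₀ Complex.I_ne_zero h
        have h2 : (p' : ℂ) + q' = p + q := by exact_mod_cast h'.trans hk.symm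
        exact hne (by exact_mod_cast (by linear_combination (h1 + h2) / 2 : (p' : ℂ) = p))
      refine le_trans ?_ (le_iSup₂_of_le (typeWeight p' q') hμ le_rfl)
      intro a ha
      exact Module.End.mem_eigenspace_iff.mpr (derivAct_of_mem_formsOfType ha)
  obtain ⟨y, hy, z, hz, hyz⟩ := Submodule.mem_sup.mp hS
  have hz' : z ∈ f.eigenspace (typeWeight p q) := by
    have : z = η - y := by rw [← hyz]; abel
    rw [this]
    exact Submodule.sub_mem _ (Module.End.mem_eigenspace_iff.mpr h)
      (Module.End.mem_eigenspace_iff.mpr (derivAct_of_mem_formsOfType hy))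
  have := (Module.End.eigenspaces_iSupIndep f (typeWeight p q)).le_bot ⟨hz', hz⟩
  rw [Submodule.mem_bot] at this
  rw [← hyz, this, add_zero]
  exact hy

end Types

/-! ### The metric and the pairing of forms at a point -/

section PointwiseMetric

open scoped MatrixOrder in
/-- A positive definite real matrix is of the form `R Rᵀ` for an invertible `R`. -/
lemma exists_eq_mul_transpose {n : Type*} [Fintype n] [DecidableEq n] {S : Matrix n n ℝ}
    (hS : S.PosDef) : ∃ R : Matrix n n ℝ, S = R * R.transpose ∧ IsUnit R.det := by
  have h0 : (0 : Matrix n n ℝ) ≤ S := Matrix.nonneg_iff_posSemidef.mpr hS.posSemidef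
  have h1 := CFC.sqrt_mul_sqrt_self S h0
  have h2 : (CFC.sqrt S).transpose = CFC.sqrt S := by
    have := (Matrix.nonneg_iff_posSemidef.mp (CFC.sqrt_nonneg S)).isHermitian
    rwa [Matrix.IsHermitian, Matrix.conjTranspose_eq_transpose_of_trivial] at this
  refine ⟨CFC.sqrt S, by rw [h2, h1], ?_⟩
  have h3 : (CFC.sqrt S).det * (CFC.sqrt S).det = S.det := by rw [← Matrix.det_mul, h1]
  have h4 := hS.det_pos
  exact isUnit_iff_ne_zero.mpr fun h => by simp [h] at h3; linarith

variable {E : Type*} [NormedAddCommGroup E] [NormedSpace ℂ E] {k : ℕ}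

/-- The bilinear form `(u, w) ↦ Θ(u, w)` of a two-form. -/
def formBilin : AltForm E 2 →L[ℝ] E →L[ℝ] E →L[ℝ] ℂ :=
  (ContinuousLinearMap.compL ℝ E (AltForm E 1) (E →L[ℝ] ℂ)
    ((ContinuousLinearMap.compL ℝ E (AltForm E 0) ℂ
        (ContinuousAlternatingMap.apply ℝ E ℂ ![])) ∘L
      (curryLeftLI (𝕜 := ℝ) (E := E) (F := ℂ) (n := 0)).toContinuousLinearMap)) ∘L
    (curryLeftLI (𝕜 := ℝ) (E := E) (F := ℂ) (n := 1)).toContinuousLinearMap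

lemma formBilin_apply (Θ : AltForm E 2) (u w : E) : formBilin Θ u w = Θ ![u, w] := rfl

lemma formBilin_swap (Θ : AltForm E 2) (u w : E) : formBilin Θ u w = -formBilin Θ w u := by
  rw [formBilin_apply, formBilin_apply]
  have := Θ.map_swap ![w, u] (i := 0) (j := 1) (by simp)
  refine Eq.trans ?_ this
  change _ = Θ _
  congr 1
  ext j
  fin_cases j <;> simp

/-- The bilinear form `g(u, v) = Θ(u, J v)`, depending linearly on the two-form. -/
def metricBilin : AltForm E 2 →L[ℝ] E →L[ℝ] E →L[ℝ] ℝ :=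
  (ContinuousLinearMap.compL ℝ E (E →L[ℝ] ℂ) (E →L[ℝ] ℝ)
    ((ContinuousLinearMap.compL ℝ E ℂ ℝ Complex.reCLM) ∘L
      (ContinuousLinearMap.compL ℝ E E ℂ).flip (complexJ E))) ∘L formBilin

lemma metricBilin_apply (Θ : AltForm E 2) (u v : E) : metricBilin Θ u v = metric Θ u v := rfl

/-- The algebraic properties of the value of a Hermitian form at a point: it is real, invariant
under `J`, and the associated metric is positive definite. -/
structure IsHermitianAt (Θ : AltForm E 2) : Prop where
  invariant : derivAct (complexJ E) Θ = 0
  real : ∀ v, (Θ v).im = 0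
  pos : ∀ v, v ≠ 0 → 0 < metric Θ v v

/-- A two-form annihilated by the derivation `J` satisfies `Θ(J u, w) = -Θ(u, J w)`. -/
lemma formBilin_J_left {Θ : AltForm E 2} (h : derivAct (complexJ E) Θ = 0) (u w : E) :
    formBilin Θ (Complex.I • u) w = -formBilin Θ u (Complex.I • w) := by
  have h1 := congrArg (fun a : AltForm E 2 => a ![u, w]) h
  simp only [derivAct_apply, Fin.sum_univ_two] at h1
  rw [formBilin_apply, formBilin_apply, eq_neg_iff_add_eq_zero]
  refine Eq.trans ?_ h1
  congr 2
  · ext j; fin_cases j <;> simp [complexJ_apply]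
  · ext j; fin_cases j <;> simp [complexJ_apply]

lemma metric_symm_of_invariant {Θ : AltForm E 2} (h : derivAct (complexJ E) Θ = 0) (u v : E) :
    metric Θ u v = metric Θ v u := by
  change (formBilin Θ u (Complex.I • v)).re = (formBilin Θ v (Complex.I • u)).re
  rw [formBilin_swap, formBilin_J_left h, neg_neg]

lemma metric_J_of_invariant {Θ : AltForm E 2} (h : derivAct (complexJ E) Θ = 0) (u v : E) :
    metric Θ (Complex.I • u) (Complex.I • v) = metric Θ u v := by
  change (formBilin Θ (Complex.I • u) (Complex.I • Complex.I • v)).re =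
    (formBilin Θ u (Complex.I • v)).re
  rw [formBilin_J_left h, smul_smul, smul_smul, Complex.I_mul_I, neg_one_mul,
    _root_.neg_smul, _root_.map_neg, neg_neg]

variable [FiniteDimensional ℂ E]

lemma gram_apply (Θ : AltForm E 2) (i j) :
    gram Θ i j = metric Θ (realBasis E i) (realBasis E j) := rfl

lemma metric_eq_sum (Θ : AltForm E 2) (u v : E) :
    metric Θ u v = ∑ i, ∑ j, (realBasis E).repr u i * (realBasis E).repr v j * gram Θ i j := by
  rw [← metricBilin_apply]
  conv_lhs => rw [← (realBasis E).sum_repr u, ← (realBasis E).sum_repr v]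
  simp only [_root_.map_sum, _root_.map_smul, sum_apply, smul_apply, smul_eq_mul, gram_apply,
    metricBilin_apply, Finset.mul_sum, mul_assoc]
  rw [Finset.sum_comm]
  exact Finset.sum_congr rfl fun i _ => Finset.sum_congr rfl fun j _ => mul_left_comm _ _ _

lemma IsHermitianAt.gram_posDef {Θ : AltForm E 2} (h : IsHermitianAt Θ) : (gram Θ).PosDef := by
  rw [Matrix.posDef_iff_dotProduct_mulVec]
  refine ⟨?_, fun x hx => ?_⟩
  · ext i j
    simp [gram_apply, metric_symm_of_invariant h.invariant (realBasis E j)]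
  · have h1 : ∑ i, x i • realBasis E i ≠ 0 := fun h0 => hx <| by
      have := Fintype.linearIndependent_iff.mp (realBasis E).linearIndependent x h0
      exact funext this
    have h2 := h.pos _ h1
    rw [metric_eq_sum] at h2
    refine lt_of_lt_of_eq h2 ?_
    simp [dotProduct, Matrix.mulVec, Finset.mul_sum, Finsupp.single_apply]
    refine Finset.sum_congr rfl fun i _ => Finset.sum_congr rfl fun j _ => ?_
    ring

/-- Contraction of a bilinear map with the inverse metric `g^{ij}`. -/
def metricTrace {W : Type*} [AddCommGroup W] [Module ℝ W] (Θ : AltForm E 2) (Q : E → E → W) : W :=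
  ∑ i, ∑ j, (gram Θ)⁻¹ i j • Q (realBasis E i) (realBasis E j)

/-- The components of an endomorphism in the fixed real basis. -/
def endMatrix (A : E →L[ℝ] E) :
    Matrix (Fin (Module.finrank ℝ E)) (Fin (Module.finrank ℝ E)) ℝ :=
  Matrix.of fun i j => (realBasis E).repr (A (realBasis E j)) i

lemma endMatrix_sum (A : E →L[ℝ] E) (j) :
    ∑ i, endMatrix A i j • realBasis E i = A (realBasis E j) :=
  (realBasis E).sum_repr _

/-- The sesquilinear pairing `1/k! ∑ ∏ S_{i_r j_r} a_I conj b_J` of forms induced by a matrix `S`,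
which stands for a contravariant metric `g^{ij}`. -/
def formPairing (S : Matrix (Fin (Module.finrank ℝ E)) (Fin (Module.finrank ℝ E)) ℝ)
    (a b : AltForm E k) : ℂ :=
  (k.factorial : ℂ)⁻¹ * ∑ I : Fin k → Fin (Module.finrank ℝ E),
    ∑ J : Fin k → Fin (Module.finrank ℝ E),
      ((∏ r, S (I r) (J r) : ℝ) : ℂ) *
        a (fun r => realBasis E (I r)) * star (b (fun r => realBasis E (J r)))

lemma formInner_eq (Θ : AltForm E 2) (a b : AltForm E k) :
    formInner Θ a b = formPairing (gram Θ)⁻¹ a b := rfl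

variable (S : Matrix (Fin (Module.finrank ℝ E)) (Fin (Module.finrank ℝ E)) ℝ)

lemma formPairing_add_left (a a' b : AltForm E k) :
    formPairing S (a + a') b = formPairing S a b + formPairing S a' b := by
  simp only [formPairing, ContinuousAlternatingMap.add_apply, mul_add, add_mul,
    Finset.sum_add_distrib]

lemma formPairing_add_right (a b b' : AltForm E k) :
    formPairing S a (b + b') = formPairing S a b + formPairing S a b' := by
  simp only [formPairing, ContinuousAlternatingMap.add_apply, star_add, mul_add,
    Finset.sum_add_distrib]

lemma formPairing_smul_left (c : ℂ) (a b : AltForm E k) :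
    formPairing S (c • a) b = c * formPairing S a b := by
  simp only [formPairing, ContinuousAlternatingMap.smul_apply, smul_eq_mul, Finset.mul_sum]
  refine Finset.sum_congr rfl fun I _ => Finset.sum_congr rfl fun J _ => ?_
  ring

lemma formPairing_smul_right (c : ℝ) (a b : AltForm E k) :
    formPairing S a (c • b) = c * formPairing S a b := by
  simp only [formPairing, ContinuousAlternatingMap.smul_apply, Finset.mul_sum,
    Complex.real_smul, Complex.star_def, _root_.map_mul, Complex.conj_ofReal]
  refine Finset.sum_congr rfl fun I _ => Finset.sum_congr rfl fun J _ => ?_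
  ring

lemma formPairing_real_smul_left (c : ℝ) (a b : AltForm E k) :
    formPairing S (c • a) b = c * formPairing S a b := by
  rw [← formPairing_smul_left]; rfl

lemma formPairing_zero_left (b : AltForm E k) : formPairing S 0 b = 0 := by
  simp [formPairing]

lemma formPairing_sum_right {ι : Type*} (s : Finset ι) (a : AltForm E k) (b : ι → AltForm E k) :
    formPairing S a (∑ i ∈ s, b i) = ∑ i ∈ s, formPairing S a (b i) :=
  map_sum (AddMonoidHom.mk' (fun x => formPairing S a x) fun _ _ => formPairing_add_right S a _ _)
    b s

lemma formPairing_neg_left (a b : AltForm E k) : formPairing S (-a) b = -formPairing S a b := by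
  have := formPairing_real_smul_left S (-1) a b
  simpa using this

lemma formPairing_neg_right (a b : AltForm E k) : formPairing S a (-b) = -formPairing S a b := by
  have := formPairing_smul_right S (-1) a b
  simpa using this

/-- Expansion of a form in the components with respect to transformed basis vectors. -/
lemma sum_prod_mul_eq (R : Matrix (Fin (Module.finrank ℝ E)) (Fin (Module.finrank ℝ E)) ℝ)
    (a : AltForm E k) (C : Fin k → Fin (Module.finrank ℝ E)) :
    ∑ I : Fin k → Fin (Module.finrank ℝ E), ((∏ r, R (I r) (C r) : ℝ) : ℂ) *
      a (fun r => realBasis E (I r)) = a (fun r => ∑ i, R i (C r) • realBasis E i) := by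
  have : a (fun r => ∑ i, R i (C r) • realBasis E i) =
    a.toMultilinearMap (fun r => ∑ i, R i (C r) • realBasis E i) := rfl
  rw [this, MultilinearMap.map_sum]
  refine Finset.sum_congr rfl fun I _ => ?_
  rw [MultilinearMap.map_smul_univ, Complex.real_smul]
  rfl

/-- If `S = R Rᵀ`, the pairing of a form with itself is a sum of squares of its components in the
frame `∑ R_{ic} e_i`. -/
lemma formPairing_self (R : Matrix (Fin (Module.finrank ℝ E)) (Fin (Module.finrank ℝ E)) ℝ)
    (a : AltForm E k) :
    formPairing (R * R.transpose) a a = (k.factorial : ℂ)⁻¹ *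
      ∑ C : Fin k → Fin (Module.finrank ℝ E),
        ((‖a (fun r => ∑ i, R i (C r) • realBasis E i)‖ ^ 2 : ℝ) : ℂ) := by
  rw [formPairing]
  congr 1
  have h1 : ∀ I J : Fin k → Fin (Module.finrank ℝ E),
      ((∏ r, (R * R.transpose) (I r) (J r) : ℝ) : ℂ) =
      ∑ C : Fin k → Fin (Module.finrank ℝ E), ((∏ r, R (I r) (C r) : ℝ) : ℂ) *
        ((∏ r, R (J r) (C r) : ℝ) : ℂ) := by
    intro I J
    simp only [Matrix.mul_apply, Matrix.transpose_apply]
    rw [Fintype.prod_sum, Complex.ofReal_sum]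
    refine Finset.sum_congr rfl fun C _ => ?_
    rw [Finset.prod_mul_distrib, Complex.ofReal_mul]
  have h2 : ∀ C : Fin k → Fin (Module.finrank ℝ E),
      ((‖a (fun r => ∑ i, R i (C r) • realBasis E i)‖ ^ 2 : ℝ) : ℂ) =
      ∑ I : Fin k → Fin (Module.finrank ℝ E), ∑ J : Fin k → Fin (Module.finrank ℝ E),
        ((∏ r, R (I r) (C r) : ℝ) : ℂ) * ((∏ r, R (J r) (C r) : ℝ) : ℂ) *
          a (fun r => realBasis E (I r)) * star (a (fun r => realBasis E (J r))) := by
    intro C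
    rw [Complex.ofReal_pow, ← Complex.mul_conj', ← sum_prod_mul_eq, _root_.map_sum,
      Finset.sum_mul_sum]
    refine Finset.sum_congr rfl fun I _ => Finset.sum_congr rfl fun J _ => ?_
    rw [_root_.map_mul, Complex.conj_ofReal, Complex.star_def]
    ring
  simp only [h1, h2, Finset.sum_mul]
  conv_rhs => rw [Finset.sum_comm]
  exact Finset.sum_congr rfl fun I _ => Finset.sum_comm

/-- The pairing of a positive definite matrix is positive definite. -/
lemma formPairing_self_nonneg {S : Matrix (Fin (Module.finrank ℝ E)) (Fin (Module.finrank ℝ E)) ℝ}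
    (hS : S.PosDef) (a : AltForm E k) :
    0 ≤ (formPairing S a a).re ∧ (formPairing S a a).im = 0 ∧
      ((formPairing S a a).re = 0 → a = 0) := by
  obtain ⟨R, rfl, hR⟩ := exists_eq_mul_transpose hS
  have h1 : formPairing (R * R.transpose) a a = (((k.factorial : ℝ)⁻¹ *
      ∑ C : Fin k → Fin (Module.finrank ℝ E),
        ‖a (fun r => ∑ i, R i (C r) • realBasis E i)‖ ^ 2 : ℝ) : ℂ) := by
    rw [formPairing_self]; push_cast; rfl
  rw [h1, Complex.ofReal_re, Complex.ofReal_im]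
  refine ⟨by positivity, rfl, fun h => ?_⟩
  have h2 := (mul_eq_zero.mp h).resolve_left (by positivity)
  rw [Finset.sum_eq_zero_iff_of_nonneg (fun _ _ => by positivity)] at h2
  have h3 : ∀ C : Fin k → Fin (Module.finrank ℝ E),
      a (fun r => ∑ i, R i (C r) • realBasis E i) = 0 := fun C => by
    simpa using h2 C (Finset.mem_univ _)
  -- express the basis through the transformed basis vectors
  have h4 : ∀ j, realBasis E j = ∑ c, R⁻¹ c j • ∑ i, R i c • realBasis E i := by
    intro j
    simp only [Finset.smul_sum, smul_smul]
    rw [Finset.sum_comm]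
    simp only [← Finset.sum_smul]
    have : ∀ i, ∑ c, R⁻¹ c j * R i c = (1 : Matrix _ _ ℝ) i j := by
      intro i
      rw [← Matrix.mul_nonsing_inv R hR, Matrix.mul_apply]
      exact Finset.sum_congr rfl fun _ _ => mul_comm _ _
    simp [this, Matrix.one_apply]
  have h5 : a.toMultilinearMap = 0 := by
    refine Module.Basis.ext_multilinear (fun _ => realBasis E) fun J => ?_
    change a.toMultilinearMap (fun r => realBasis E (J r)) = 0
    have h6 : (fun r => realBasis E (J r)) =
        fun r => ∑ c, R⁻¹ c (J r) • ∑ i, R i c • realBasis E i := funext fun r => h4 (J r)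
    rw [h6, MultilinearMap.map_sum]
    refine Finset.sum_eq_zero fun C _ => ?_
    rw [MultilinearMap.map_smul_univ]
    exact (congrArg _ (h3 C)).trans (smul_zero _)
  ext v
  exact congrArg (fun m : MultilinearMap ℝ (fun _ : Fin k => E) ℂ => m v) h5

/-- The wedge product with one-forms is adjoint to the contraction with vectors. -/
lemma formPairing_alternatize (f : E →L[ℝ] AltForm E k) (b : AltForm E (k + 1)) :
    formPairing S (alternatizeUncurryFin f) b =
      ∑ i, ∑ j, (S i j : ℂ) * formPairing S (f (realBasis E i)) (contr (realBasis E j) b) := by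
  -- the contribution of the `p`-th summand of the antisymmetrization is independent of `p`
  have key : ∀ p : Fin (k + 1), ∑ I : Fin (k + 1) → Fin (Module.finrank ℝ E),
      ∑ J : Fin (k + 1) → Fin (Module.finrank ℝ E),
        ((∏ r, S (I r) (J r) : ℝ) : ℂ) * ((-1 : ℤ) ^ (p : ℕ) • f (realBasis E (I p))
          (p.removeNth fun r => realBasis E (I r))) * star (b (fun r => realBasis E (J r))) =
      ∑ i, ∑ j, (S i j : ℂ) * ∑ I : Fin k → Fin (Module.finrank ℝ E),
        ∑ J : Fin k → Fin (Module.finrank ℝ E), ((∏ r, S (I r) (J r) : ℝ) : ℂ) *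
          f (realBasis E i) (fun r => realBasis E (I r)) *
            star (contr (realBasis E j) b (fun r => realBasis E (J r))) := by
    intro p
    let e := Fin.insertNthEquiv (fun _ => Fin (Module.finrank ℝ E)) p
    rw [← Equiv.sum_comp e, Fintype.sum_prod_type]
    refine Finset.sum_congr rfl fun i _ => ?_
    have h1 : ∀ I : Fin k → Fin (Module.finrank ℝ E),
        ∑ J : Fin (k + 1) → Fin (Module.finrank ℝ E),
        ((∏ r, S (e (i, I) r) (J r) : ℝ) : ℂ) * ((-1 : ℤ) ^ (p : ℕ) • f (realBasis E (e (i, I) p))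
          (p.removeNth fun r => realBasis E (e (i, I) r))) *
            star (b (fun r => realBasis E (J r))) =
        ∑ j, ∑ J : Fin k → Fin (Module.finrank ℝ E), (S i j : ℂ) *
          (((∏ r, S (I r) (J r) : ℝ) : ℂ) *
          f (realBasis E i) (fun r => realBasis E (I r)) *
            star (contr (realBasis E j) b (fun r => realBasis E (J r)))) := by
      intro I
      rw [← Equiv.sum_comp e, Fintype.sum_prod_type]
      refine Finset.sum_congr rfl fun j _ => Finset.sum_congr rfl fun J _ => ?_
      have h2 : b (fun r => realBasis E (e (j, J) r)) =
          (-1 : ℤ) ^ (p : ℕ) • contr (realBasis E j) b (fun r => realBasis E (J r)) := by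
        rw [contr_apply, ← ContinuousAlternatingMap.map_insertNth]
        congr 1
        ext r
        refine Fin.succAboveCases p ?_ (fun r => ?_) r <;> simp [e]
      have h3 : (p.removeNth fun r => realBasis E (e (i, I) r)) =
          fun r => realBasis E (I r) := by
        ext r; simp [e, Fin.removeNth]
      have h4 : e (i, I) p = i := by simp [e]
      rw [h2, h3, h4, Fin.prod_univ_succAbove _ p]
      have h5 : ∀ r, e (i, I) (p.succAbove r) = I r := fun r => by simp [e]
      have h6 : ∀ r, e (j, J) (p.succAbove r) = J r := fun r => by simp [e]
      have h7 : e (j, J) p = j := by simp [e]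
      simp only [h4, h5, h6, h7]
      have h8 : ((-1 : ℂ) ^ (p : ℕ)) * ((-1 : ℂ) ^ (p : ℕ)) = 1 := by
        rw [← mul_pow]; simp
      simp only [zsmul_eq_mul, Int.cast_pow, Int.cast_neg, Int.cast_one, Complex.star_def,
        _root_.map_mul, map_pow, _root_.map_neg, _root_.map_one, Complex.ofReal_mul]
      linear_combination (S i j : ℂ) * ((∏ r, S (I r) (J r) : ℝ) : ℂ) *
          f (realBasis E i) (fun r => realBasis E (I r)) *
            (starRingEnd ℂ) (contr (realBasis E j) b (fun r => realBasis E (J r))) * h8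
    simp only [h1]
    rw [Finset.sum_comm]
    simp only [Finset.mul_sum]
  simp only [formPairing, alternatizeUncurryFin_apply]
  have h9 : ∀ (I J : Fin (k + 1) → Fin (Module.finrank ℝ E)),
      ((∏ r, S (I r) (J r) : ℝ) : ℂ) * (∑ p : Fin (k + 1), (-1 : ℤ) ^ (p : ℕ) •
        f (realBasis E (I p)) (p.removeNth fun r => realBasis E (I r))) *
          star (b (fun r => realBasis E (J r))) =
      ∑ p : Fin (k + 1), ((∏ r, S (I r) (J r) : ℝ) : ℂ) * ((-1 : ℤ) ^ (p : ℕ) •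
        f (realBasis E (I p)) (p.removeNth fun r => realBasis E (I r))) *
          star (b (fun r => realBasis E (J r))) := fun I J => by
    rw [Finset.mul_sum, Finset.sum_mul]
  have h10 : ∑ I : Fin (k + 1) → Fin (Module.finrank ℝ E),
      ∑ J : Fin (k + 1) → Fin (Module.finrank ℝ E), ∑ p : Fin (k + 1),
        ((∏ r, S (I r) (J r) : ℝ) : ℂ) * ((-1 : ℤ) ^ (p : ℕ) •
        f (realBasis E (I p)) (p.removeNth fun r => realBasis E (I r))) *
          star (b (fun r => realBasis E (J r))) =
      ∑ p : Fin (k + 1), ∑ I : Fin (k + 1) → Fin (Module.finrank ℝ E),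
      ∑ J : Fin (k + 1) → Fin (Module.finrank ℝ E),
        ((∏ r, S (I r) (J r) : ℝ) : ℂ) * ((-1 : ℤ) ^ (p : ℕ) •
        f (realBasis E (I p)) (p.removeNth fun r => realBasis E (I r))) *
          star (b (fun r => realBasis E (J r))) := by
    conv_rhs => rw [Finset.sum_comm]
    exact Finset.sum_congr rfl fun I _ => Finset.sum_comm
  simp only [h9, h10, key]
  rw [Finset.sum_const, Finset.card_univ, Fintype.card_fin, nsmul_eq_mul, ← mul_assoc]
  have h11 : (((k + 1).factorial : ℂ))⁻¹ * ((k + 1 : ℕ) : ℂ) = (k.factorial : ℂ)⁻¹ := by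
    rw [Nat.factorial_succ, Nat.cast_mul, mul_inv, mul_comm, ← mul_assoc, mul_inv_cancel₀, one_mul]
    exact_mod_cast k.succ_ne_zero
  rw [h11]
  simp only [Finset.mul_sum]
  refine Finset.sum_congr rfl fun i _ => Finset.sum_congr rfl fun j _ =>
    Finset.sum_congr rfl fun I _ => Finset.sum_congr rfl fun J _ => ?_
  ring

end PointwiseMetric

/-! ### Derivatives of the pairing and of the volume density -/

section PairingDerivative

/-- Jacobi's formula for the derivative of a determinant. -/
lemma hasDerivAt_det {n : Type*} [Fintype n] [DecidableEq n] {A : ℝ → Matrix n n ℝ}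
    {A' : Matrix n n ℝ} {t : ℝ} (h : ∀ i j, HasDerivAt (fun s => A s i j) (A' i j) t) :
    HasDerivAt (fun s => (A s).det) ((A t).adjugate * A').trace t := by
  have h1 : HasDerivAt (fun s => ∑ σ : Equiv.Perm n, Equiv.Perm.sign σ • ∏ i, A s (σ i) i)
      (∑ σ : Equiv.Perm n, Equiv.Perm.sign σ •
        ∑ i, (∏ j ∈ Finset.univ.erase i, A t (σ j) j) • A' (σ i) i) t :=
    HasDerivAt.fun_sum fun σ _ => by
      simp only [Units.smul_def, zsmul_eq_mul]
      exact (HasDerivAt.fun_finsetProd fun i _ => h (σ i) i).const_mul _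
  simp only [← Matrix.det_apply] at h1
  convert h1 using 1
  have h2 : ∀ i, ((A t).adjugate * A') i i = ((A t).updateCol i (fun r => A' r i)).det := by
    intro i
    rw [← Matrix.cramer_apply, Matrix.cramer_eq_adjugate_mulVec]
    rfl
  simp only [Matrix.trace, Matrix.diag_apply, h2, Matrix.det_apply, Finset.smul_sum]
  rw [Finset.sum_comm]
  refine Finset.sum_congr rfl fun σ _ => Finset.sum_congr rfl fun i _ => ?_
  rw [← Finset.mul_prod_erase _ _ (Finset.mem_univ i), smul_eq_mul, mul_comm]
  congr 2
  · refine Finset.prod_congr rfl fun j hj => ?_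
    rw [Matrix.updateCol_ne (Finset.ne_of_mem_erase hj)]
  · rw [Matrix.updateCol_self]

/-- In a double sum over a multi-index `I` and an index `c`, the `s`-th entry of `I` may be exchanged
with `c`. -/
lemma sum_update_swap {n : Type*} [Fintype n] {k : ℕ} (s : Fin k) (F : (Fin k → n) → n → ℂ) :
    ∑ I, ∑ c, F I c = ∑ I, ∑ c, F (Function.update I s c) (I s) := by
  rw [← Fintype.sum_prod_type', ← Fintype.sum_prod_type']
  let e : (Fin k → n) × n → (Fin k → n) × n := fun x => (Function.update x.1 s x.2, x.1 s)
  have he : Function.Involutive e := fun x => by simp [e]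
  exact (Fintype.sum_equiv he.toPerm _ _ fun x => by simp [e]).symm

variable {E : Type*} [NormedAddCommGroup E] [NormedSpace ℂ E] {k : ℕ} [FiniteDimensional ℂ E]

/-- The components of `A · a`. -/
lemma derivAct_basis (A : E →L[ℝ] E) (a : AltForm E k) (I : Fin k → Fin (Module.finrank ℝ E)) :
    derivAct A a (fun r => realBasis E (I r)) = ∑ s, ∑ c, (endMatrix A c (I s) : ℂ) *
      a (fun r => realBasis E (Function.update I s c r)) := by
  rw [derivAct_apply]
  refine Finset.sum_congr rfl fun s _ => ?_
  rw [← endMatrix_sum]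
  have : ∀ w, a (Function.update (fun r => realBasis E (I r)) s w) =
    a.toMultilinearMap (Function.update (fun r => realBasis E (I r)) s w) := fun _ => rfl
  rw [this, MultilinearMap.map_update_sum]
  refine Finset.sum_congr rfl fun c _ => ?_
  rw [MultilinearMap.map_update_smul, Complex.real_smul]
  congr 1
  change a _ = a _
  congr 1
  ext r
  rcases eq_or_ne r s with rfl | h
  · simp
  · simp [h]

/-- If the contravariant metric `S` varies by the action of an endomorphism, the derivative of the
pairing is obtained by differentiating both arguments covariantly. -/
lemma hasDerivAt_formPairing
    {S : ℝ → Matrix (Fin (Module.finrank ℝ E)) (Fin (Module.finrank ℝ E)) ℝ}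
    {a b : ℝ → AltForm E k} {a' b' : AltForm E k} {t : ℝ} (A : E →L[ℝ] E)
    (hS : ∀ i j, HasDerivAt (fun s => S s i j)
      (-(endMatrix A * S t + S t * (endMatrix A).transpose) i j) t)
    (ha : HasDerivAt a a' t) (hb : HasDerivAt b b' t) :
    HasDerivAt (fun s => formPairing (S s) (a s) (b s))
      (formPairing (S t) (a' - derivAct A (a t)) (b t) +
        formPairing (S t) (a t) (b' - derivAct A (b t))) t := by
  set M := endMatrix A with hM
  have hev : ∀ (v : Fin k → E), HasDerivAt (fun s => a s v) (a' v) t := fun v =>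
    (ContinuousAlternatingMap.apply ℝ E ℂ v).hasFDerivAt.comp_hasDerivAt t ha
  have hev' : ∀ (v : Fin k → E), HasDerivAt (fun s => star (b s v)) (star (b' v)) t := fun v =>
    ((ContinuousAlternatingMap.apply ℝ E ℂ v).hasFDerivAt.comp_hasDerivAt t hb).star
  have hprod : ∀ I J : Fin k → Fin (Module.finrank ℝ E),
      HasDerivAt (fun s => ((∏ r, S s (I r) (J r) : ℝ) : ℂ))
        ((∑ s, (∏ r ∈ Finset.univ.erase s, S t (I r) (J r)) •
          (-(M * S t + S t * M.transpose) (I s) (J s)) : ℝ) : ℂ) t := fun I J =>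
    (HasDerivAt.fun_finsetProd fun s _ => hS (I s) (J s)).ofReal_comp
  have hmain := (HasDerivAt.fun_sum (u := Finset.univ) fun I _ =>
    HasDerivAt.fun_sum (u := Finset.univ) fun J _ =>
      ((hprod I J).mul (hev (fun r => realBasis E (I r)))).mul
        (hev' (fun r => realBasis E (J r)))).const_mul ((k.factorial : ℂ)⁻¹)
  refine hmain.congr_deriv ?_
  -- the two contributions of the derivative of `S`
  have h1 : ∑ I : Fin k → Fin (Module.finrank ℝ E), ∑ J : Fin k → Fin (Module.finrank ℝ E),
      ((∏ r, S t (I r) (J r) : ℝ) : ℂ) * derivAct A (a t) (fun r => realBasis E (I r)) *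
        star (b t (fun r => realBasis E (J r))) =
      ∑ I : Fin k → Fin (Module.finrank ℝ E), ∑ J : Fin k → Fin (Module.finrank ℝ E),
      ∑ s, ((∏ r ∈ Finset.univ.erase s, S t (I r) (J r) : ℝ) : ℂ) *
        ((M * S t) (I s) (J s) : ℝ) * a t (fun r => realBasis E (I r)) *
        star (b t (fun r => realBasis E (J r))) := by
    rw [Finset.sum_comm]
    conv_rhs => rw [Finset.sum_comm]
    refine Finset.sum_congr rfl fun J _ => ?_
    simp only [derivAct_basis, Finset.mul_sum, Finset.sum_mul]
    rw [Finset.sum_comm]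
    conv_rhs => rw [Finset.sum_comm]
    refine Finset.sum_congr rfl fun s _ => ?_
    simp only [Matrix.mul_apply, Complex.ofReal_sum, Finset.mul_sum, Finset.sum_mul]
    conv_rhs => rw [sum_update_swap s]
    refine Finset.sum_congr rfl fun I _ => Finset.sum_congr rfl fun c _ => ?_
    rw [← Finset.mul_prod_erase _ _ (Finset.mem_univ s)]
    have h2 : ∏ r ∈ Finset.univ.erase s, S t (Function.update I s c r) (J r) =
        ∏ r ∈ Finset.univ.erase s, S t (I r) (J r) :=
      Finset.prod_congr rfl fun r hr => by
        rw [Function.update_of_ne (Finset.ne_of_mem_erase hr)]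
    rw [h2, Function.update_self]
    push_cast
    ring
  have h1' : ∑ I : Fin k → Fin (Module.finrank ℝ E), ∑ J : Fin k → Fin (Module.finrank ℝ E),
      ((∏ r, S t (I r) (J r) : ℝ) : ℂ) * a t (fun r => realBasis E (I r)) *
        star (derivAct A (b t) (fun r => realBasis E (J r))) =
      ∑ I : Fin k → Fin (Module.finrank ℝ E), ∑ J : Fin k → Fin (Module.finrank ℝ E),
      ∑ s, ((∏ r ∈ Finset.univ.erase s, S t (I r) (J r) : ℝ) : ℂ) *
        ((S t * M.transpose) (I s) (J s) : ℝ) * a t (fun r => realBasis E (I r)) *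
        star (b t (fun r => realBasis E (J r))) := by
    refine Finset.sum_congr rfl fun I _ => ?_
    simp only [derivAct_basis, star_sum, Finset.mul_sum]
    rw [Finset.sum_comm]
    conv_rhs => rw [Finset.sum_comm]
    refine Finset.sum_congr rfl fun s _ => ?_
    simp only [Matrix.mul_apply, Complex.ofReal_sum, Finset.mul_sum, Finset.sum_mul]
    conv_rhs => rw [sum_update_swap s]
    refine Finset.sum_congr rfl fun J _ => Finset.sum_congr rfl fun c _ => ?_
    rw [← Finset.mul_prod_erase _ _ (Finset.mem_univ s)]
    have h2 : ∏ r ∈ Finset.univ.erase s, S t (I r) (Function.update J s c r) =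
        ∏ r ∈ Finset.univ.erase s, S t (I r) (J r) :=
      Finset.prod_congr rfl fun r hr => by
        rw [Function.update_of_ne (Finset.ne_of_mem_erase hr)]
    rw [h2, Function.update_self, Matrix.transpose_apply]
    simp only [star_mul', Complex.star_def, Complex.conj_ofReal]
    push_cast
    ring
  simp only [sub_eq_add_neg (G := AltForm E k), formPairing_add_left, formPairing_add_right,
    formPairing_neg_left, formPairing_neg_right]
  have h3 : formPairing (S t) (derivAct A (a t)) (b t) = (k.factorial : ℂ)⁻¹ * _ :=
    congrArg (fun x : ℂ => (k.factorial : ℂ)⁻¹ * x) h1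
  have h3' : formPairing (S t) (a t) (derivAct A (b t)) = (k.factorial : ℂ)⁻¹ * _ :=
    congrArg (fun x : ℂ => (k.factorial : ℂ)⁻¹ * x) h1'
  rw [h3, h3']
  simp only [formPairing, ← mul_add, ← mul_neg, ← Finset.sum_neg_distrib,
    ← Finset.sum_add_distrib]
  congr 1
  refine Finset.sum_congr rfl fun I _ => Finset.sum_congr rfl fun J _ => ?_
  have h5 : ((∑ s, (∏ r ∈ Finset.univ.erase s, S t (I r) (J r)) •
        (-(M * S t + S t * M.transpose) (I s) (J s)) : ℝ) : ℂ) *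
          a t (fun r => realBasis E (I r)) * star (b t (fun r => realBasis E (J r))) =
      -(∑ s, ((∏ r ∈ Finset.univ.erase s, S t (I r) (J r) : ℝ) : ℂ) *
        ((M * S t) (I s) (J s) : ℝ) * a t (fun r => realBasis E (I r)) *
        star (b t (fun r => realBasis E (J r)))) -
      ∑ s, ((∏ r ∈ Finset.univ.erase s, S t (I r) (J r) : ℝ) : ℂ) *
        ((S t * M.transpose) (I s) (J s) : ℝ) * a t (fun r => realBasis E (I r)) *
        star (b t (fun r => realBasis E (J r))) := by
    simp only [Complex.ofReal_sum, Finset.sum_mul, ← Finset.sum_neg_distrib,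
      ← Finset.sum_sub_distrib]
    refine Finset.sum_congr rfl fun s _ => ?_
    rw [Matrix.add_apply, smul_eq_mul]
    push_cast
    ring
  simp only [Pi.mul_apply]
  have h6 : ∀ f : Fin k → ℂ, ∑ s, -f s = -∑ s, f s := fun f => Finset.sum_neg_distrib f
  linear_combination (norm := skip) h5
  simp only [mul_neg, h6]
  ring

end PairingDerivative

/-! ### Traces with respect to the metric -/

section MetricTrace

variable {E : Type*} [NormedAddCommGroup E] [NormedSpace ℂ E] {k : ℕ} [FiniteDimensional ℂ E]
  {W : Type*} [AddCommGroup W] [Module ℝ W]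

lemma endMatrix_eq_toMatrix (A : E →L[ℝ] E) :
    endMatrix A = LinearMap.toMatrix (realBasis E) (realBasis E) (A : E →ₗ[ℝ] E) := by
  ext i j
  rw [LinearMap.toMatrix_apply]
  rfl

lemma endMatrix_mul (A B : E →L[ℝ] E) : endMatrix (A ∘L B) = endMatrix A * endMatrix B := by
  simp only [endMatrix_eq_toMatrix]
  exact LinearMap.toMatrix_comp _ _ _ _ _

lemma endMatrix_id : endMatrix (.id ℝ E) = 1 := by
  rw [endMatrix_eq_toMatrix]
  exact LinearMap.toMatrix_id _

namespace IsHermitianAt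

variable {Θ : AltForm E 2} (h : IsHermitianAt Θ)
include h

lemma isUnit_det : IsUnit (gram Θ).det := isUnit_iff_ne_zero.mpr h.gram_posDef.det_pos.ne'

lemma gram_transpose : (gram Θ).transpose = gram Θ := by
  ext i j
  exact metric_symm_of_invariant h.invariant _ _

lemma gramInv_symm (i j) : (gram Θ)⁻¹ i j = (gram Θ)⁻¹ j i := by
  have := Matrix.transpose_nonsing_inv (gram Θ)
  rw [h.gram_transpose] at this
  exact congrFun (congrFun this j) i

lemma sum_gramInv_mul_metric (w : E) (j) :
    ∑ i, (gram Θ)⁻¹ i j * metric Θ w (realBasis E i) = (realBasis E).repr w j := by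
  have h1 : ∀ i, metric Θ w (realBasis E i) = ∑ l, (realBasis E).repr w l * gram Θ l i := by
    intro i
    rw [← metricBilin_apply]
    conv_lhs => rw [← (realBasis E).sum_repr w]
    simp only [_root_.map_sum, _root_.map_smul, sum_apply, smul_apply, smul_eq_mul]
    rfl
  simp only [h1, Finset.mul_sum]
  rw [Finset.sum_comm]
  have h2 : ∀ l, ∑ i, (gram Θ)⁻¹ i j * ((realBasis E).repr w l * gram Θ l i) =
      (realBasis E).repr w l * (1 : Matrix _ _ ℝ) l j := by
    intro l
    rw [← Matrix.mul_nonsing_inv (gram Θ) h.isUnit_det, Matrix.mul_apply, Finset.mul_sum]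
    exact Finset.sum_congr rfl fun i _ => by ring
  simp [h2, Matrix.one_apply]

/-- The inverse metric is dual to the metric. -/
lemma metricTrace_metric (w : E) (f : E →ₗ[ℝ] W) :
    metricTrace Θ (fun u v => metric Θ w u • f v) = f w := by
  rw [metricTrace, Finset.sum_comm]
  simp only [smul_smul, ← Finset.sum_smul, h.sum_gramInv_mul_metric, ← _root_.map_smul,
    ← _root_.map_sum, (realBasis E).sum_repr]

lemma metricTrace_swap (Q : E → E → W) :
    metricTrace Θ (fun u v => Q v u) = metricTrace Θ Q := by
  rw [metricTrace, Finset.sum_comm, metricTrace]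
  exact Finset.sum_congr rfl fun i _ => Finset.sum_congr rfl fun j _ => by
    rw [h.gramInv_symm]

omit [FiniteDimensional ℂ E] in
/-- A positive definite metric is nondegenerate. -/
lemma eq_of_metric_eq {u v : E} (huv : ∀ w, metric Θ u w = metric Θ v w) : u = v := by
  by_contra hne
  have h1 := h.pos (u - v) (sub_ne_zero.mpr hne)
  have h2 : ∀ w, metric Θ (u - v) w = metric Θ u w - metric Θ v w := fun w => by
    simp only [← metricBilin_apply, map_sub, sub_apply]
  rw [h2, huv, sub_self] at h1
  exact lt_irrefl _ h1

end IsHermitianAt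

/-- Traces are natural under isometries. -/
lemma metricTrace_pullback {Θ Θ' : AltForm E 2} {A B : E →L[ℝ] E}
    (hAB : A ∘L B = .id ℝ E) (hm : ∀ u v, metric Θ' u v = metric Θ (A u) (A v))
    (Q : E →ₗ[ℝ] E →ₗ[ℝ] W) :
    metricTrace Θ' (fun u v => Q (A u) (A v)) = metricTrace Θ (fun u v => Q u v) := by
  set P := endMatrix A with hP
  have hPu : IsUnit P.det := by
    have := congrArg Matrix.det (endMatrix_mul A B)
    rw [hAB, endMatrix_id, Matrix.det_one, Matrix.det_mul] at this
    exact IsUnit.of_mul_eq_one _ this.symm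
  have hG : gram Θ' = P.transpose * gram Θ * P := by
    ext i j
    rw [gram_apply, hm, metric_eq_sum, Matrix.mul_apply, Finset.sum_comm]
    refine Finset.sum_congr rfl fun l _ => ?_
    rw [Matrix.mul_apply, Finset.sum_mul]
    exact Finset.sum_congr rfl fun m _ => by
      simp only [hP, endMatrix, Matrix.transpose_apply, Matrix.of_apply]; ring
  have hS : P * (gram Θ')⁻¹ * P.transpose = (gram Θ)⁻¹ := by
    have hPt : IsUnit P.transpose.det := by rwa [Matrix.det_transpose]
    rw [hG, Matrix.mul_inv_rev, Matrix.mul_inv_rev, ← mul_assoc, Matrix.mul_nonsing_inv _ hPu,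
      one_mul, mul_assoc, Matrix.nonsing_inv_mul _ hPt, mul_one]
  have h1 : ∀ i j, Q (A (realBasis E i)) (A (realBasis E j)) =
      ∑ l, ∑ m, (P l i * P m j) • Q (realBasis E l) (realBasis E m) := by
    intro i j
    rw [← endMatrix_sum A i, ← endMatrix_sum A j]
    simp only [_root_.map_sum, _root_.map_smul, LinearMap.sum_apply, LinearMap.smul_apply,
      Finset.smul_sum, smul_smul]
    rw [Finset.sum_comm]
    exact Finset.sum_congr rfl fun l _ => Finset.sum_congr rfl fun m _ => by rw [mul_comm]
  simp only [metricTrace, h1, Finset.smul_sum, smul_smul]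
  have h2 : ∀ l m, (gram Θ)⁻¹ l m = ∑ i, ∑ j, (gram Θ')⁻¹ i j * (P l i * P m j) := by
    intro l m
    rw [← hS, Matrix.mul_apply, Finset.sum_comm]
    refine Finset.sum_congr rfl fun j _ => ?_
    rw [Matrix.mul_apply, Finset.sum_mul]
    exact Finset.sum_congr rfl fun i _ => by rw [Matrix.transpose_apply]; ring
  simp only [h2, Finset.sum_smul]
  calc _ = ∑ i, ∑ l, ∑ j, ∑ m, ((gram Θ')⁻¹ i j * (P l i * P m j)) •
          Q (realBasis E l) (realBasis E m) := Finset.sum_congr rfl fun i _ => Finset.sum_comm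
    _ = _ := Finset.sum_comm
    _ = _ := Finset.sum_congr rfl fun l _ => by
      exact (Finset.sum_congr rfl fun i _ => Finset.sum_comm).trans Finset.sum_comm

/-- The metric is Hermitian, so that its inverse is `J`-invariant. -/
lemma IsHermitianAt.metricTrace_J {Θ : AltForm E 2} (h : IsHermitianAt Θ)
    (Q : E →ₗ[ℝ] E →ₗ[ℝ] W) :
    metricTrace Θ (fun u v => Q (complexJ E u) (complexJ E v)) =
      metricTrace Θ (fun u v => Q u v) :=
  metricTrace_pullback (B := -complexJ E)
    (by ext v; simp [complexJ_complexJ])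
    (fun u v => (metric_J_of_invariant h.invariant u v).symm) Q

lemma IsHermitianAt.metricTrace_J_left {Θ : AltForm E 2} (h : IsHermitianAt Θ)
    (Q : E →ₗ[ℝ] E →ₗ[ℝ] W) :
    metricTrace Θ (fun u v => Q (complexJ E u) v) =
      -metricTrace Θ (fun u v => Q u (complexJ E v)) := by
  have h1 := h.metricTrace_J (Q.compl₂ (complexJ E : E →ₗ[ℝ] E))
  have h2 : ∀ u v, Q.compl₂ (complexJ E : E →ₗ[ℝ] E) (complexJ E u) (complexJ E v) =
      -Q (complexJ E u) v := fun u v => by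
    change Q (complexJ E u) (complexJ E (complexJ E v)) = _
    rw [complexJ_complexJ, _root_.map_neg]
  simp only [h2] at h1
  change _ = -metricTrace Θ (fun u v => Q.compl₂ (complexJ E : E →ₗ[ℝ] E) u v)
  rw [← h1]
  simp [metricTrace]

end MetricTrace

/-! ### Christoffel symbols and the covariant derivative at a point -/

section Christoffel

variable {E : Type*} [NormedAddCommGroup E] [NormedSpace ℂ E] {k : ℕ}

/-- `(Θ, D)` is the first order jet of a Hermitian form at a point: `Θ` is its value and `D` its
derivative, which is again real and `J`-invariant. -/
structure IsHermitianJet (Θ : AltForm E 2) (D : E →L[ℝ] AltForm E 2) : Prop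
    extends IsHermitianAt Θ where
  deriv_invariant : ∀ u, derivAct (complexJ E) (D u) = 0
  deriv_real : ∀ u v, (D u v).im = 0

/-- The bilinear map `(u, v) ↦ (D_u g(v, w) + D_v g(u, w) - D_w g(u, v)) / 2`. -/
def koszul (D : E →L[ℝ] AltForm E 2) (w : E) : E →L[ℝ] E →L[ℝ] ℝ :=
  (2⁻¹ : ℝ) •
    ((ContinuousLinearMap.compL ℝ E (E →L[ℝ] ℝ) ℝ (ContinuousLinearMap.apply ℝ ℝ w)) ∘L
        (metricBilin ∘L D) +
      (ContinuousLinearMap.compL ℝ E (E →L[ℝ] ℝ) ℝ (ContinuousLinearMap.apply ℝ ℝ w)) ∘L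
        (metricBilin ∘L D).flip - metricBilin (D w))

lemma koszul_apply (D : E →L[ℝ] AltForm E 2) (u v w : E) :
    koszul D w u v =
      2⁻¹ * (metric (D u) v w + metric (D v) u w - metric (D w) u v) := rfl

/-- `Γ` is the tensor of Christoffel symbols of the metric with jet `(Θ, D)`: it is symmetric and
makes the metric parallel. -/
structure IsChristoffel (Θ : AltForm E 2) (D : E →L[ℝ] AltForm E 2)
    (Γ : E →L[ℝ] E →L[ℝ] E) : Prop where
  symm : ∀ u v, Γ u v = Γ v u
  compat : ∀ u v w, metric (D u) v w = metric Θ (Γ u v) w + metric Θ v (Γ u w)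

/-- The bilinear map `(u, v) ↦ ι_u N_v`. -/
def contrBilin (N : E →L[ℝ] AltForm E (k + 1)) : E →ₗ[ℝ] E →ₗ[ℝ] AltForm E k :=
  LinearMap.mk₂ ℝ (fun u v => contr u (N v)) (fun u u' v => contr_add u u' _)
    (fun c u v => contr_smul c u _) (fun u v v' => by simp) (fun c u v => by simp)

lemma contrBilin_apply (N : E →L[ℝ] AltForm E (k + 1)) (u v : E) :
    contrBilin N u v = contr u (N v) := rfl

/-- The covariant derivative `u ↦ D_u a - Γ_u · a` of a form with jet `(a, N)`. -/
def covDeriv (Γ : E →L[ℝ] E →L[ℝ] E) (N : E →L[ℝ] AltForm E k) (a : AltForm E k) :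
    E →L[ℝ] AltForm E k :=
  N - (fderivCompContinuousLinearMapCLM ℂ (.id ℝ E) a) ∘L Γ

lemma covDeriv_apply (Γ : E →L[ℝ] E →L[ℝ] E) (N : E →L[ℝ] AltForm E k) (a : AltForm E k) (u : E) :
    covDeriv Γ N a u = N u - derivAct (Γ u) a := rfl

/-- The exterior derivative is the antisymmetrized covariant derivative. -/
lemma alternatize_covDeriv {Γ : E →L[ℝ] E →L[ℝ] E} (hΓ : ∀ u v, Γ u v = Γ v u)
    (N : E →L[ℝ] AltForm E k) (a : AltForm E k) :
    alternatizeUncurryFin (covDeriv Γ N a) = alternatizeUncurryFin N := by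
  rw [covDeriv, alternatize_sub, alternatize_derivAct_symm Γ hΓ, sub_zero]

/-- Uniqueness of the Levi-Civita connection. -/
lemma IsChristoffel.unique {Θ : AltForm E 2} {D : E →L[ℝ] AltForm E 2} [FiniteDimensional ℂ E]
    {Γ Γ' : E →L[ℝ] E →L[ℝ] E} (h : IsHermitianAt Θ) (hΓ : IsChristoffel Θ D Γ)
    (hΓ' : IsChristoffel Θ D Γ') : Γ = Γ' := by
  ext u v
  refine h.eq_of_metric_eq fun w => ?_
  have hs := metric_symm_of_invariant h.invariant
  have e1 := hΓ.compat u v w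
  have e2 := hΓ.compat v w u
  have e3 := hΓ.compat w u v
  have f1 := hΓ'.compat u v w
  have f2 := hΓ'.compat v w u
  have f3 := hΓ'.compat w u v
  rw [hs v (Γ u w)] at e1
  rw [hs w (Γ v u), hΓ.symm v w, hΓ.symm v u] at e2
  rw [hs u (Γ w v), hΓ.symm w u] at e3
  rw [hs v (Γ' u w)] at f1
  rw [hs w (Γ' v u), hΓ'.symm v w, hΓ'.symm v u] at f2
  rw [hs u (Γ' w v), hΓ'.symm w u] at f3
  linarith

variable [FiniteDimensional ℂ E]

/-- The Christoffel symbols `Γ_{uv}^j = ∑ g^{ij} koszul(u, v, e_i)`. -/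
def christoffel (Θ : AltForm E 2) (D : E →L[ℝ] AltForm E 2) : E →L[ℝ] E →L[ℝ] E :=
  ∑ i, ∑ j, (gram Θ)⁻¹ i j •
    ((ContinuousLinearMap.compL ℝ E ℝ E
      ((ContinuousLinearMap.id ℝ ℝ).smulRight (realBasis E j))) ∘L koszul D (realBasis E i))

lemma christoffel_apply (Θ : AltForm E 2) (D : E →L[ℝ] AltForm E 2) (u v : E) :
    christoffel Θ D u v =
      ∑ i, ∑ j, (gram Θ)⁻¹ i j • koszul D (realBasis E i) u v • realBasis E j := by
  simp [christoffel]

/-- The Koszul formula. -/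
lemma metric_christoffel {Θ : AltForm E 2} {D : E →L[ℝ] AltForm E 2} (h : IsHermitianAt Θ)
    (u v w : E) : metric Θ (christoffel Θ D u v) w = koszul D w u v := by
  let f : E →ₗ[ℝ] ℝ :=
    { toFun := fun w => koszul D w u v
      map_add' := fun w w' => by
        simp only [koszul_apply, ← metricBilin_apply, map_add, add_apply]; ring
      map_smul' := fun c w => by
        simp only [koszul_apply, ← metricBilin_apply, map_smul, smul_apply, smul_eq_mul,
          RingHom.id_apply]; ring }
  have h1 := h.metricTrace_metric w f
  rw [← h.metricTrace_swap] at h1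
  refine Eq.trans ?_ h1
  rw [christoffel_apply, ← metricBilin_apply, metricTrace]
  simp only [_root_.map_sum, _root_.map_smul, sum_apply, smul_apply, smul_eq_mul]
  refine Finset.sum_congr rfl fun i _ => Finset.sum_congr rfl fun j _ => ?_
  rw [metricBilin_apply, metric_symm_of_invariant h.invariant]
  change _ = _ * (_ * koszul D (realBasis E i) u v)
  ring

/-- Existence of the Levi-Civita connection. -/
lemma IsHermitianJet.isChristoffel {Θ : AltForm E 2} {D : E →L[ℝ] AltForm E 2}
    (h : IsHermitianJet Θ D) : IsChristoffel Θ D (christoffel Θ D) where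
  symm u v := h.eq_of_metric_eq fun w => by
    rw [metric_christoffel h.toIsHermitianAt, metric_christoffel h.toIsHermitianAt, koszul_apply,
      koszul_apply, metric_symm_of_invariant (h.deriv_invariant w) u v]
    ring
  compat u v w := by
    rw [metric_symm_of_invariant h.invariant v, metric_christoffel h.toIsHermitianAt,
      metric_christoffel h.toIsHermitianAt, koszul_apply, koszul_apply,
      metric_symm_of_invariant (h.deriv_invariant u) w v]
    ring

/-- The equation `∂_u g = Γ_uᵀ g + g Γ_u` of matrices. -/
lemma IsChristoffel.gram_eq {Θ : AltForm E 2} {D : E →L[ℝ] AltForm E 2}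
    {Γ : E →L[ℝ] E →L[ℝ] E} (h : IsChristoffel Θ D Γ) (u : E) :
    gram (D u) = (endMatrix (Γ u)).transpose * gram Θ + gram Θ * endMatrix (Γ u) := by
  ext i j
  rw [gram_apply, h.compat, Matrix.add_apply, Matrix.mul_apply, Matrix.mul_apply,
    ← endMatrix_sum (Γ u) i, ← endMatrix_sum (Γ u) j]
  simp only [← metricBilin_apply, _root_.map_sum, _root_.map_smul, sum_apply, smul_apply,
    smul_eq_mul, Matrix.transpose_apply, gram_apply]
  congr 1
  exact Finset.sum_congr rfl fun _ _ => mul_comm _ _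

/-- The codifferential `-∑ g^{ij} ι_{e_i} N_{e_j}` in terms of the covariant derivative `N`. -/
def codiffAt (Θ : AltForm E 2) (N : E →L[ℝ] AltForm E (k + 1)) : AltForm E k :=
  -metricTrace Θ (fun u v => contr u (N v))

end Christoffel

/-! ### Naturality of the covariant derivative and the codifferential -/

section Naturality

variable {E : Type*} [NormedAddCommGroup E] [NormedSpace ℂ E] {k : ℕ}

/-- The transformation law of the Christoffel symbols under a change of coordinates with
first derivative `A = B⁻¹` and second derivative `H`. -/
lemma IsChristoffel.pullback {Θ Θ' : AltForm E 2} {D D' : E →L[ℝ] AltForm E 2}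
    {Γ Γ' : E →L[ℝ] E →L[ℝ] E} {A B : E →L[ℝ] E} {H : E →L[ℝ] E →L[ℝ] E}
    (hAB : A ∘L B = .id ℝ E) (hH : ∀ u v, H u v = H v u)
    (hm : ∀ u v, metric Θ' u v = metric Θ (A u) (A v))
    (hD : ∀ u v w, metric (D' u) v w = metric (D (A u)) (A v) (A w) +
      metric Θ (H u v) (A w) + metric Θ (A v) (H u w))
    (hΓ : IsChristoffel Θ D Γ) (hΓ' : ∀ u v, Γ' u v = B (Γ (A u) (A v) + H u v)) :
    IsChristoffel Θ' D' Γ' where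
  symm u v := by rw [hΓ', hΓ', hΓ.symm, hH]
  compat u v w := by
    have hAB' : ∀ v, A (B v) = v := fun v => congrArg (fun f : E →L[ℝ] E => f v) hAB
    simp only [hD, hm, hΓ', hAB', hΓ.compat]
    simp only [← metricBilin_apply, map_add, add_apply]
    ring

/-- The covariant derivative is natural under changes of coordinates. -/
lemma covDeriv_pullback {Γ Γ' : E →L[ℝ] E →L[ℝ] E} {A B : E →L[ℝ] E} {H : E →L[ℝ] E →L[ℝ] E}
    (hAB : A ∘L B = .id ℝ E) (hΓ' : ∀ u v, Γ' u v = B (Γ (A u) (A v) + H u v))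
    {N N' : E →L[ℝ] AltForm E k} {a : AltForm E k}
    (hN : ∀ u, N' u = (N (A u)).compContinuousLinearMap A +
      a.fderivCompContinuousLinearMap A (H u)) (u : E) :
    covDeriv Γ' N' (a.compContinuousLinearMap A) u =
      (covDeriv Γ N a (A u)).compContinuousLinearMap A := by
  have hAB' : ∀ v, A (B v) = v := fun v => congrArg (fun f : E →L[ℝ] E => f v) hAB
  rw [covDeriv_apply, covDeriv_apply, hN]
  ext v
  simp only [ContinuousAlternatingMap.sub_apply, ContinuousAlternatingMap.add_apply,
    ContinuousAlternatingMap.compContinuousLinearMap_apply, derivAct_apply,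
    fderivCompContinuousLinearMap_apply, hΓ']
  have h1 : ∀ i, (a fun j => (Function.update (fun _ => A) i (H u) : Fin k → E →L[ℝ] E) j (v j)) =
      a (Function.update (fun j => A (v j)) i (H u (v i))) := by
    intro i
    congr 1
    ext j
    rcases eq_or_ne j i with rfl | hj
    · simp
    · simp [hj]
  have h2 : ∀ i, a (A ∘ Function.update v i (B (Γ (A u) (A (v i)) + H u (v i)))) =
      a (Function.update (A ∘ v) i (Γ (A u) ((A ∘ v) i))) +
        a (Function.update (fun j => A (v j)) i (H u (v i))) := by
    intro i
    rw [Function.comp_update, hAB', ContinuousAlternatingMap.map_update_add]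
    rfl
  simp only [h1, h2, Finset.sum_add_distrib]
  ring

variable [FiniteDimensional ℂ E]

/-- The codifferential is natural under isometries. -/
lemma codiffAt_pullback {Θ Θ' : AltForm E 2} {A B : E →L[ℝ] E}
    (hAB : A ∘L B = .id ℝ E) (hm : ∀ u v, metric Θ' u v = metric Θ (A u) (A v))
    {N N' : E →L[ℝ] AltForm E (k + 1)}
    (hN : ∀ u, N' u = (N (A u)).compContinuousLinearMap A) :
    codiffAt Θ' N' = (codiffAt Θ N).compContinuousLinearMap A := by
  let Q : E →ₗ[ℝ] E →ₗ[ℝ] AltForm E k := (contrBilin N).compr₂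
    (ContinuousAlternatingMap.compContinuousLinearMapCLM A :
      AltForm E k →L[ℝ] AltForm E k).toLinearMap
  have h1 := metricTrace_pullback hAB hm Q
  have h2 : metricTrace Θ' (fun u v => contr u (N' v)) =
      metricTrace Θ' (fun u v => Q (A u) (A v)) := by
    congr 1
    ext u v w
    rw [hN, contr_apply]
    change N (A v) _ = N (A v) _
    congr 1
    ext j
    refine Fin.cases ?_ (fun j => ?_) j <;> simp
  have h3 : metricTrace Θ (fun u v => Q u v) =
      (metricTrace Θ (fun u v => contr u (N v))).compContinuousLinearMap A := by
    change _ = (ContinuousAlternatingMap.compContinuousLinearMapCLM A :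
      AltForm E k →L[ℝ] AltForm E k) _
    simp only [metricTrace, _root_.map_sum, _root_.map_smul]
    rfl
  rw [codiffAt, codiffAt, h2, h1, h3]
  rfl

end Naturality

/-! ### Kähler identities at a point -/

section KahlerPointwise

variable {E : Type*} [NormedAddCommGroup E] [NormedSpace ℂ E] {k : ℕ}

lemma formBilin_re (Θ : AltForm E 2) (u w : E) :
    (formBilin Θ u w).re = -metric Θ u (Complex.I • w) := by
  change _ = -(formBilin Θ u (Complex.I • Complex.I • w)).re
  rw [smul_smul, Complex.I_mul_I, _root_.neg_smul, one_smul, _root_.map_neg, Complex.neg_re,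
    neg_neg]

lemma formBilin_eq_of_real {Θ : AltForm E 2} (h : ∀ v, (Θ v).im = 0) (u w : E) :
    formBilin Θ u w = ((-metric Θ u (Complex.I • w) : ℝ) : ℂ) :=
  Complex.ext (by rw [formBilin_re, Complex.ofReal_re]) (by rw [Complex.ofReal_im]; exact h _)

lemma ext_formBilin {a b : AltForm E 2} (h : ∀ u v, formBilin a u v = formBilin b u v) :
    a = b := by
  ext v
  have := h (v 0) (v 1)
  rw [formBilin_apply, formBilin_apply] at this
  convert this using 2 <;> (ext j; fin_cases j <;> rfl)

lemma formBilin_derivAct (A : E →L[ℝ] E) (a : AltForm E 2) (u v : E) :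
    formBilin (derivAct A a) u v = formBilin a (A u) v + formBilin a u (A v) := by
  simp only [formBilin_apply, derivAct_apply, Fin.sum_univ_two]
  congr 2 <;> (ext j; fin_cases j <;> simp)

lemma metric_J_left {Θ : AltForm E 2} (h : derivAct (complexJ E) Θ = 0) (u v : E) :
    metric Θ (Complex.I • u) v = -metric Θ u (Complex.I • v) := by
  rw [← metric_J_of_invariant h u, smul_smul, Complex.I_mul_I, _root_.neg_smul, one_smul]
  simp only [← metricBilin_apply, _root_.map_neg, neg_neg]

/-- If the Christoffel symbols are complex linear, the Hermitian form is parallel. -/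
lemma IsHermitianJet.deriv_eq {Θ : AltForm E 2} {D : E →L[ℝ] AltForm E 2}
    {Γ : E →L[ℝ] E →L[ℝ] E} (h : IsHermitianJet Θ D) (hΓ : IsChristoffel Θ D Γ)
    (hJ : ∀ u v, Γ u (Complex.I • v) = Complex.I • Γ u v) (u : E) :
    D u = derivAct (Γ u) Θ := by
  refine ext_formBilin fun v w => ?_
  rw [formBilin_derivAct, formBilin_eq_of_real (h.deriv_real u), formBilin_eq_of_real h.real,
    formBilin_eq_of_real h.real, ← Complex.ofReal_add, hΓ.compat, hJ]
  congr 1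
  ring

/-- If the Christoffel symbols are complex linear, the Hermitian form is closed. -/
lemma IsHermitianJet.alternatize_eq_zero {Θ : AltForm E 2} {D : E →L[ℝ] AltForm E 2}
    {Γ : E →L[ℝ] E →L[ℝ] E} (h : IsHermitianJet Θ D) (hΓ : IsChristoffel Θ D Γ)
    (hJ : ∀ u v, Γ u (Complex.I • v) = Complex.I • Γ u v) :
    alternatizeUncurryFin D = 0 := by
  have : D = ((fderivCompContinuousLinearMapCLM ℂ (.id ℝ E)) Θ) ∘L Γ := by
    ext1 u
    exact h.deriv_eq hΓ hJ u
  rw [this, alternatize_derivAct_symm Γ hΓ.symm]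

/-- If the Hermitian form is closed, the Christoffel symbols are complex linear. -/
lemma IsHermitianJet.christoffel_J {Θ : AltForm E 2} {D : E →L[ℝ] AltForm E 2}
    [FiniteDimensional ℂ E] (h : IsHermitianJet Θ D) (hD : alternatizeUncurryFin D = 0) (u v : E) :
    christoffel Θ D u (Complex.I • v) = Complex.I • christoffel Θ D u v := by
  refine h.eq_of_metric_eq fun w => ?_
  rw [metric_J_left h.invariant, metric_christoffel h.toIsHermitianAt,
    metric_christoffel h.toIsHermitianAt, koszul_apply, koszul_apply]
  -- closedness, evaluated on three vectors
  have hc : ∀ a b c, (formBilin (D a) b c).re - (formBilin (D b) a c).re +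
      (formBilin (D c) a b).re = 0 := by
    intro a b c
    have h1 := congrArg (fun f : AltForm E 3 => f ![a, b, c]) hD
    rw [alternatizeUncurryFin_apply] at h1
    replace h1 := (Fin.sum_univ_three (fun i : Fin 3 => (-1 : ℤ) ^ (i : ℕ) •
      D (![a, b, c] i) (Fin.removeNth (n := 2) i ![a, b, c]))).symm.trans h1
    have e0 : (0 : Fin 3).removeNth ![a, b, c] = ![b, c] := by
      ext j; fin_cases j <;> rfl
    have e1 : (1 : Fin 3).removeNth ![a, b, c] = ![a, c] := by
      ext j; fin_cases j <;> rfl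
    have e2 : (2 : Fin 3).removeNth ![a, b, c] = ![a, b] := by
      ext j; fin_cases j <;> rfl
    rw [e0, e1, e2] at h1
    have h2 := congrArg Complex.re h1
    simp at h2
    simp only [formBilin_apply]
    linarith
  have hJ : ∀ a b c, (formBilin (D a) (Complex.I • b) c).re =
      -(formBilin (D a) b (Complex.I • c)).re := fun a b c => by
    rw [formBilin_J_left (h.deriv_invariant a), Complex.neg_re]
  have hI : ∀ a b c, (formBilin (D a) b (Complex.I • Complex.I • c)).re =
      -(formBilin (D a) b c).re := fun a b c => by
    rw [smul_smul, Complex.I_mul_I, _root_.neg_smul, one_smul, _root_.map_neg, Complex.neg_re]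
  have hm : ∀ a b c, metric (D a) b c = (formBilin (D a) b (Complex.I • c)).re := fun _ _ _ => rfl
  have c1 := hc u v w
  have c2 := hc u (Complex.I • v) (Complex.I • w)
  simp only [hm, hJ, hI] at c2 ⊢
  linarith

/-- The covariant derivative commutes with the derivation `J` if the Christoffel symbols are
complex linear. -/
lemma covDeriv_derivAct {Γ : E →L[ℝ] E →L[ℝ] E}
    (hJ : ∀ u v, Γ u (Complex.I • v) = Complex.I • Γ u v)
    (N : E →L[ℝ] AltForm E k) (a : AltForm E k) :
    covDeriv Γ (derivAct (complexJ E) ∘L N) (derivAct (complexJ E) a) =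
      derivAct (complexJ E) ∘L covDeriv Γ N a := by
  ext1 u
  rw [covDeriv_apply, ContinuousLinearMap.comp_apply, ContinuousLinearMap.comp_apply,
    covDeriv_apply, _root_.map_sub, derivAct_comm]
  ext v
  exact hJ u v

/-- The covariant derivative commutes with the Lefschetz operator of a parallel form. -/
lemma covDeriv_lefschetz {Θ : AltForm E 2} {D : E →L[ℝ] AltForm E 2} {Γ : E →L[ℝ] E →L[ℝ] E}
    (hD : ∀ u, D u = derivAct (Γ u) Θ) (N : E →L[ℝ] AltForm E k) (a : AltForm E k) (u : E) :
    lefschetz (formBilin (D u)) a + lefschetz (formBilin Θ) (N u) -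
      derivAct (Γ u) (lefschetz (formBilin Θ) a) =
        lefschetz (formBilin Θ) (covDeriv Γ N a u) := by
  have h1 : lefschetz (formBilin Θ) (covDeriv Γ N a u) +
      lefschetz (formBilin Θ) (derivAct (Γ u) a) = lefschetz (formBilin Θ) (N u) := by
    rw [← lefschetz_add, covDeriv_apply, sub_add_cancel]
  rw [derivAct_lefschetz (Γ u) (formBilin Θ) (formBilin (D u))
    (fun v w => by rw [hD, formBilin_derivAct]), ← h1]
  abel

variable [FiniteDimensional ℂ E]

/-- The commutator of the codifferential with the derivation `J`. -/
lemma derivAct_codiffAt {Θ : AltForm E 2} (h : IsHermitianAt Θ) (N : E →L[ℝ] AltForm E (k + 1)) :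
    derivAct (complexJ E) (codiffAt Θ N) =
      codiffAt Θ (derivAct (complexJ E) ∘L N) + codiffAt Θ (N ∘L complexJ E) := by
  have h1 := h.metricTrace_J_left (contrBilin N)
  have h2 : derivAct (complexJ E) (metricTrace Θ fun u v => contr u (N v)) =
      metricTrace Θ (fun u v => contr u (derivAct (complexJ E) (N v))) -
        metricTrace Θ (fun u v => contr (complexJ E u) (N v)) := by
    simp only [metricTrace, _root_.map_sum, _root_.map_smul, ← Finset.sum_sub_distrib,
      ← smul_sub]
    refine Finset.sum_congr rfl fun i _ => Finset.sum_congr rfl fun j _ => ?_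
    rw [contr_derivAct, add_sub_cancel_right]
  simp only [contrBilin_apply] at h1
  rw [codiffAt, _root_.map_neg, h2, h1]
  simp only [codiffAt, ContinuousLinearMap.comp_apply]
  abel

lemma metricTrace_formBilin {Θ : AltForm E 2} (h : IsHermitianAt Θ) (N : E →L[ℝ] AltForm E k)
    (w : E) : metricTrace Θ (fun u v => formBilin Θ u w • N v) = -N (complexJ E w) := by
  refine Eq.trans ?_ (congrArg Neg.neg
    (h.metricTrace_metric (complexJ E w) (N : E →ₗ[ℝ] AltForm E k)))
  simp only [metricTrace, ← Finset.sum_neg_distrib, ← smul_neg]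
  refine Finset.sum_congr rfl fun i _ => Finset.sum_congr rfl fun j _ => ?_
  rw [formBilin_eq_of_real h.real, Complex.coe_smul, metric_symm_of_invariant h.invariant,
    _root_.neg_smul]
  rw [smul_neg (metric Θ _ _)]
  rfl

/-- Summing the wedge products with the one-forms `Θ(e_i, ·)`. -/
lemma metricTrace_covecSMul {Θ : AltForm E 2} (h : IsHermitianAt Θ) (N : E →L[ℝ] AltForm E k) :
    metricTrace Θ (fun u v => alternatizeUncurryFin (covecSMul (formBilin Θ u) (N v))) =
      -alternatizeUncurryFin (N ∘L complexJ E) := by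
  have h1 : metricTrace Θ (fun u v => covecSMul (formBilin Θ u) (N v)) = -(N ∘L complexJ E) := by
    ext1 w
    refine Eq.trans ?_ (metricTrace_formBilin h N w)
    simp only [metricTrace, sum_apply, smul_apply, covecSMul_apply]
  rw [← alternatize_neg, ← h1]
  simp only [metricTrace, ← alternatizeUncurryFinCLM_apply, _root_.map_sum, _root_.map_smul]

/-- The commutator of the codifferential with the Lefschetz operator, in positive degree. -/
lemma codiffAt_lefschetz {Θ : AltForm E 2} (h : IsHermitianAt Θ) (N : E →L[ℝ] AltForm E (k + 1))
    (N' : E →L[ℝ] AltForm E (k + 3)) (hN : ∀ u, N' u = lefschetz (formBilin Θ) (N u)) :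
    codiffAt Θ N' = lefschetz (formBilin Θ) (codiffAt Θ N) +
      (2 : ℝ) • alternatizeUncurryFin (N ∘L complexJ E) := by
  let L : AltForm E k →ₗ[ℝ] AltForm E (k + 2) :=
    { toFun := lefschetz (formBilin Θ)
      map_add' := lefschetz_add _
      map_smul' := fun c a => lefschetz_smul _ (c : ℂ) a }
  have h1 : metricTrace Θ (fun u v => contr u (N' v)) =
      L (metricTrace Θ (fun u v => contr u (N v))) +
      (2 : ℝ) • metricTrace Θ
        (fun u v => alternatizeUncurryFin (covecSMul (formBilin Θ u) (N v))) := by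
    simp only [metricTrace, _root_.map_sum, _root_.map_smul, Finset.smul_sum,
      ← Finset.sum_add_distrib]
    refine Finset.sum_congr rfl fun i _ => Finset.sum_congr rfl fun j _ => ?_
    rw [hN, smul_comm (2 : ℝ), ← smul_add]
    congr 1
    exact contr_lefschetz _ (formBilin_swap Θ) _ _
  rw [metricTrace_covecSMul h] at h1
  have h2 : lefschetz (formBilin Θ) (codiffAt Θ N) =
      -L (metricTrace Θ (fun u v => contr u (N v))) := by
    rw [← _root_.map_neg]; rfl
  rw [h2, codiffAt, h1, smul_neg, neg_add, neg_neg]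

/-- The commutator of the codifferential with the Lefschetz operator on functions. -/
lemma codiffAt_lefschetz_zero {Θ : AltForm E 2} (h : IsHermitianAt Θ) (N : E →L[ℝ] AltForm E 0)
    (N' : E →L[ℝ] AltForm E 2) (hN : ∀ u, N' u = lefschetz (formBilin Θ) (N u)) :
    codiffAt Θ N' = (2 : ℝ) • alternatizeUncurryFin (N ∘L complexJ E) := by
  have h1 : metricTrace Θ (fun u v => contr u (N' v)) =
      (2 : ℝ) • metricTrace Θ
        (fun u v => alternatizeUncurryFin (covecSMul (formBilin Θ u) (N v))) := by
    simp only [metricTrace, Finset.smul_sum]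
    refine Finset.sum_congr rfl fun i _ => Finset.sum_congr rfl fun j _ => ?_
    rw [hN, smul_comm (2 : ℝ)]
    congr 1
    exact contr_lefschetz_zero _ (formBilin_swap Θ) _ _
  rw [metricTrace_covecSMul h] at h1
  rw [codiffAt, h1, smul_neg, neg_neg]

end KahlerPointwise

/-! ### Hermitian forms on an open set: smoothness -/

section LocalOperators

variable {E : Type*} [NormedAddCommGroup E] [NormedSpace ℂ E] {k : ℕ}

/-- A smooth Hermitian form on an open subset of the model space. -/
structure IsHermitianOn (V : Set E) (Θ : E → AltForm E 2) : Prop where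
  isOpen : IsOpen V
  smooth : ContDiffOn ℝ ∞ Θ V
  herm : ∀ z ∈ V, IsHermitianAt (Θ z)

lemma IsHermitianOn.differentiableAt {V : Set E} {Θ : E → AltForm E 2} (h : IsHermitianOn V Θ)
    {z : E} (hz : z ∈ V) : DifferentiableAt ℝ Θ z :=
  (h.smooth.contDiffAt (h.isOpen.mem_nhds hz)).differentiableAt (by simp)

lemma IsHermitianOn.jet {V : Set E} {Θ : E → AltForm E 2} (h : IsHermitianOn V Θ)
    {z : E} (hz : z ∈ V) : IsHermitianJet (Θ z) (fderiv ℝ Θ z) where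
  toIsHermitianAt := h.herm z hz
  deriv_invariant u := by
    have h1 : (fun w => derivAct (complexJ E) (Θ w)) =ᶠ[nhds z] fun _ => 0 := by
      filter_upwards [h.isOpen.mem_nhds hz] with w hw using (h.herm w hw).invariant
    have h2 := ((derivAct (complexJ E)).hasFDerivAt.comp z
      (h.differentiableAt hz).hasFDerivAt).fderiv
    have h3 := h1.fderiv_eq (𝕜 := ℝ)
    rw [fderiv_const_apply] at h3
    exact congrArg (fun f : E →L[ℝ] AltForm E 2 => f u) (h2.symm.trans h3)
  deriv_real u v := by
    let f : AltForm E 2 →L[ℝ] ℝ := Complex.imCLM ∘L ContinuousAlternatingMap.apply ℝ E ℂ v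
    have h1 : (fun w => f (Θ w)) =ᶠ[nhds z] fun _ => 0 := by
      filter_upwards [h.isOpen.mem_nhds hz] with w hw using (h.herm w hw).real v
    have h2 := (f.hasFDerivAt.comp z (h.differentiableAt hz).hasFDerivAt).fderiv
    have h3 := h1.fderiv_eq (𝕜 := ℝ)
    rw [fderiv_const_apply] at h3
    exact congrArg (fun f : E →L[ℝ] ℝ => f u) (h2.symm.trans h3)

lemma contDiffOn_extDeriv {V : Set E} (hV : IsOpen V) {α : E → AltForm E k}
    (hα : ContDiffOn ℝ ∞ α V) : ContDiffOn ℝ ∞ (extDeriv α) V :=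
  (alternatizeUncurryFinCLM ℝ E ℂ).contDiff.comp_contDiffOn
    (hα.fderiv_of_isOpen hV (by simp))

lemma contDiffOn_det {n : Type*} [Fintype n] [DecidableEq n] {V : Set E} {A : E → Matrix n n ℝ}
    (hA : ∀ i j, ContDiffOn ℝ ∞ (fun z => A z i j) V) :
    ContDiffOn ℝ ∞ (fun z => (A z).det) V := by
  simp only [Matrix.det_apply, Units.smul_def, zsmul_eq_mul]
  exact ContDiffOn.sum fun σ _ => contDiffOn_const.mul (contDiffOn_prod fun i _ => hA _ _)

variable [FiniteDimensional ℂ E]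

/-- The Christoffel symbols of a Hermitian form on an open set. -/
def christoffelOf (Θ : E → AltForm E 2) (z : E) : E →L[ℝ] E →L[ℝ] E :=
  christoffel (Θ z) (fderiv ℝ Θ z)

/-- The Levi-Civita connection on forms, in coordinates. -/
def nabla (Θ : E → AltForm E 2) (α : E → AltForm E k) (z : E) : E →L[ℝ] AltForm E k :=
  covDeriv (christoffelOf Θ z) (fderiv ℝ α z) (α z)

/-- The codifferential in coordinates, defined through the Levi-Civita connection. -/
def localCodiff (Θ : E → AltForm E 2) (β : E → AltForm E (k + 1)) (z : E) : AltForm E k :=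
  codiffAt (Θ z) (nabla Θ β z)

lemma contDiffOn_gram {V : Set E} {Θ : E → AltForm E 2} (h : ContDiffOn ℝ ∞ Θ V) (i j) :
    ContDiffOn ℝ ∞ (fun z => gram (Θ z) i j) V := by
  have : ContDiffOn ℝ ∞ (fun z => metricBilin (Θ z) (realBasis E i) (realBasis E j)) V := by
    fun_prop
  exact this

namespace IsHermitianOn

variable {V : Set E} {Θ : E → AltForm E 2} (h : IsHermitianOn V Θ)
include h

lemma contDiffOn_gramInv (i j) : ContDiffOn ℝ ∞ (fun z => (gram (Θ z))⁻¹ i j) V := by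
  have h1 : ContDiffOn ℝ ∞ (fun z => ((gram (Θ z)).det)⁻¹ * (gram (Θ z)).adjugate i j) V := by
    refine ContDiffOn.mul ?_ ?_
    · exact (contDiffOn_det (contDiffOn_gram h.smooth)).inv
        fun z hz => (h.herm z hz).isUnit_det.ne_zero
    · simp only [Matrix.adjugate_apply]
      refine contDiffOn_det fun i' j' => ?_
      by_cases hi : i' = j
      · subst hi; simpa using contDiffOn_const
      · simpa [Matrix.updateRow_apply, hi] using contDiffOn_gram h.smooth i' j'
  refine h1.congr fun z hz => ?_
  rw [Matrix.inv_def, Matrix.smul_apply, smul_eq_mul, Ring.inverse_eq_inv']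

omit [FiniteDimensional ℂ E] in
lemma contDiffOn_fderiv : ContDiffOn ℝ ∞ (fderiv ℝ Θ) V :=
  h.smooth.fderiv_of_isOpen h.isOpen (by simp)

lemma contDiffOn_christoffelOf : ContDiffOn ℝ ∞ (christoffelOf Θ) V := by
  rw [contDiffOn_clm_apply]
  intro u
  rw [contDiffOn_clm_apply]
  intro v
  simp only [christoffelOf, christoffel_apply, koszul_apply, ← metricBilin_apply]
  have h1 := h.contDiffOn_fderiv
  refine ContDiffOn.sum fun i _ => ContDiffOn.sum fun j _ => (h.contDiffOn_gramInv i j).smul ?_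
  have : ∀ a b c : E, ContDiffOn ℝ ∞ (fun z => metricBilin (fderiv ℝ Θ z a) b c) V := by
    intro a b c
    fun_prop
  exact (contDiffOn_const.mul (((this _ _ _).add (this _ _ _)).sub (this _ _ _))).smul
    contDiffOn_const

lemma contDiffOn_nabla {α : E → AltForm E k} (hα : ContDiffOn ℝ ∞ α V) :
    ContDiffOn ℝ ∞ (nabla Θ α) V := by
  have h1 := hα.fderiv_of_isOpen h.isOpen (m := ∞) (by simp)
  have h2 := h.contDiffOn_christoffelOf
  let L : AltForm E k →L[ℝ] (E →L[ℝ] E) →L[ℝ] AltForm E k :=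
    fderivCompContinuousLinearMapCLM ℂ (ContinuousLinearMap.id ℝ E)
  have h3 : ContDiffOn ℝ ∞ (fun z => L (α z)) V := L.contDiff.comp_contDiffOn hα
  exact h1.sub (h3.clm_comp h2)

lemma contDiffOn_codiffAt {N : E → E →L[ℝ] AltForm E (k + 1)} (hN : ContDiffOn ℝ ∞ N V) :
    ContDiffOn ℝ ∞ (fun z => codiffAt (Θ z) (N z)) V := by
  simp only [codiffAt, metricTrace]
  refine (ContDiffOn.sum fun i _ => ContDiffOn.sum fun j _ =>
    (h.contDiffOn_gramInv i j).smul ?_).neg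
  fun_prop

lemma contDiffOn_localCodiff {β : E → AltForm E (k + 1)} (hβ : ContDiffOn ℝ ∞ β V) :
    ContDiffOn ℝ ∞ (localCodiff Θ β) V :=
  h.contDiffOn_codiffAt (h.contDiffOn_nabla hβ)

lemma isChristoffel {z : E} (hz : z ∈ V) :
    IsChristoffel (Θ z) (fderiv ℝ Θ z) (christoffelOf Θ z) :=
  (h.jet hz).isChristoffel

lemma alternatize_nabla (α : E → AltForm E k) {z : E} (hz : z ∈ V) :
    alternatizeUncurryFin (nabla Θ α z) = extDeriv α z :=
  alternatize_covDeriv (h.isChristoffel hz).symm _ _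

/-- The derivative of the inverse metric, `∂_u g⁻¹ = -(Γ_u g⁻¹ + g⁻¹ Γ_uᵀ)`. -/
lemma hasDerivAt_gramInv {z : E} (hz : z ∈ V) (u : E) (i j) :
    HasDerivAt (fun t : ℝ => (gram (Θ (z + t • u)))⁻¹ i j)
      (-(endMatrix (christoffelOf Θ z u) * (gram (Θ z))⁻¹ +
        (gram (Θ z))⁻¹ * (endMatrix (christoffelOf Θ z u)).transpose) i j) 0 := by
  set M := endMatrix (christoffelOf Θ z u)
  set S := (gram (Θ z))⁻¹ with hS
  have hline : HasDerivAt (fun t : ℝ => z + t • u) u 0 := by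
    simpa using ((hasDerivAt_id (0 : ℝ)).smul_const u).const_add z
  have hz0 : z + (0 : ℝ) • u = z := by simp
  have hG : ∀ i j, HasDerivAt (fun t : ℝ => gram (Θ (z + t • u)) i j)
      (gram (fderiv ℝ Θ z u) i j) 0 := by
    intro i j
    have h1 : HasFDerivAt Θ (fderiv ℝ Θ z) (z + (0 : ℝ) • u) := by
      rw [hz0]; exact (h.differentiableAt hz).hasFDerivAt
    let f : AltForm E 2 →L[ℝ] ℝ :=
      (ContinuousLinearMap.apply ℝ ℝ (realBasis E j)) ∘L
        (ContinuousLinearMap.apply ℝ (E →L[ℝ] ℝ) (realBasis E i)) ∘L metricBilin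
    exact f.hasFDerivAt.comp_hasDerivAt 0 (h1.comp_hasDerivAt 0 hline)
  have hSd : ∀ i j, HasDerivAt (fun t : ℝ => (gram (Θ (z + t • u)))⁻¹ i j)
      (fderiv ℝ (fun w => (gram (Θ w))⁻¹ i j) z u) 0 := by
    intro i j
    have h1 : HasFDerivAt (fun w => (gram (Θ w))⁻¹ i j)
        (fderiv ℝ (fun w => (gram (Θ w))⁻¹ i j) z) (z + (0 : ℝ) • u) := by
      rw [hz0]
      exact (((h.contDiffOn_gramInv i j).contDiffAt (h.isOpen.mem_nhds hz)).differentiableAt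
        (by simp)).hasFDerivAt
    exact h1.comp_hasDerivAt 0 hline
  let S' : Matrix (Fin (Module.finrank ℝ E)) (Fin (Module.finrank ℝ E)) ℝ :=
    Matrix.of fun i j => fderiv ℝ (fun w => (gram (Θ w))⁻¹ i j) z u
  -- differentiate the identity `G G⁻¹ = 1`
  have h1 : gram (fderiv ℝ Θ z u) * S + gram (Θ z) * S' = 0 := by
    ext i j
    have h2 : HasDerivAt (fun t : ℝ => ∑ l, gram (Θ (z + t • u)) i l *
        (gram (Θ (z + t • u)))⁻¹ l j)
        (∑ l, (gram (fderiv ℝ Θ z u) i l * (gram (Θ (z + (0 : ℝ) • u)))⁻¹ l j +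
          gram (Θ (z + (0 : ℝ) • u)) i l * S' l j)) 0 :=
      HasDerivAt.fun_sum fun l _ => (hG i l).mul (hSd l j)
    have h3 : (fun t : ℝ => ∑ l, gram (Θ (z + t • u)) i l * (gram (Θ (z + t • u)))⁻¹ l j)
        =ᶠ[nhds 0] fun _ => (1 : Matrix _ _ ℝ) i j := by
      have h4 : ∀ᶠ t : ℝ in nhds 0, z + t • u ∈ V := by
        refine hline.continuousAt.eventually_mem ?_
        rw [hz0]
        exact h.isOpen.mem_nhds hz
      filter_upwards [h4] with t ht
      rw [← Matrix.mul_apply, Matrix.mul_nonsing_inv _ (h.herm _ ht).isUnit_det]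
    have h5 := h2.unique ((hasDerivAt_const (0 : ℝ) _).congr_of_eventuallyEq h3)
    rw [hz0, Finset.sum_add_distrib] at h5
    exact h5
  have hSG : S * gram (Θ z) = 1 := Matrix.nonsing_inv_mul _ (h.herm z hz).isUnit_det
  have hGS : gram (Θ z) * S = 1 := Matrix.mul_nonsing_inv _ (h.herm z hz).isUnit_det
  have h6 : S' = -(M * S + S * M.transpose) := by
    have h7 : S * (gram (fderiv ℝ Θ z u) * S + gram (Θ z) * S') = 0 := by rw [h1, mul_zero]
    rw [(h.isChristoffel hz).gram_eq u, mul_add, ← mul_assoc S (gram (Θ z)) S', hSG, one_mul] at h7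
    rw [eq_neg_of_add_eq_zero_right h7]
    congr 1
    rw [add_mul, mul_add, mul_assoc _ (gram (Θ z)) S, hGS, mul_one, mul_assoc (gram (Θ z)),
      ← mul_assoc S (gram (Θ z)), hSG, one_mul, add_comm]
  have h8 : fderiv ℝ (fun w => (gram (Θ w))⁻¹ i j) z u =
      (-(M * S + S * M.transpose)) i j := by rw [← h6]; rfl
  have h9 := hSd i j
  rw [h8] at h9
  exact h9

/-- The derivative of the volume density, `∂_u √(det g) = √(det g) tr Γ_u`. -/
lemma hasDerivAt_volumeDensity {z : E} (hz : z ∈ V) (u : E) :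
    HasDerivAt (fun t : ℝ => volumeDensity (Θ (z + t • u)))
      (volumeDensity (Θ z) * (endMatrix (christoffelOf Θ z u)).trace) 0 := by
  set M := endMatrix (christoffelOf Θ z u)
  have hline : HasDerivAt (fun t : ℝ => z + t • u) u 0 := by
    simpa using ((hasDerivAt_id (0 : ℝ)).smul_const u).const_add z
  have hz0 : z + (0 : ℝ) • u = z := by simp
  have hG : ∀ i j, HasDerivAt (fun t : ℝ => gram (Θ (z + t • u)) i j)
      (gram (fderiv ℝ Θ z u) i j) 0 := by
    intro i j
    have h1 : HasFDerivAt Θ (fderiv ℝ Θ z) (z + (0 : ℝ) • u) := by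
      rw [hz0]; exact (h.differentiableAt hz).hasFDerivAt
    let f : AltForm E 2 →L[ℝ] ℝ :=
      (ContinuousLinearMap.apply ℝ ℝ (realBasis E j)) ∘L
        (ContinuousLinearMap.apply ℝ (E →L[ℝ] ℝ) (realBasis E i)) ∘L metricBilin
    exact f.hasFDerivAt.comp_hasDerivAt 0 (h1.comp_hasDerivAt 0 hline)
  have h1 := hasDerivAt_det hG
  have h2 := (h.herm z hz).gram_posDef.det_pos
  have h3 : ((gram (Θ z)).adjugate * gram (fderiv ℝ Θ z u)).trace =
      2 * (gram (Θ z)).det * M.trace := by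
    rw [(h.isChristoffel hz).gram_eq u, mul_add, Matrix.trace_add, ← mul_assoc, ← mul_assoc,
      Matrix.trace_mul_comm, ← mul_assoc, Matrix.mul_adjugate, Matrix.adjugate_mul]
    simp only [Matrix.smul_mul, one_mul, Matrix.trace_smul, Matrix.trace_transpose, smul_eq_mul]
    change _ * M.trace + _ * M.trace = _
    ring
  simp only [hz0, h3] at h1
  have h4 := h1.sqrt (by rw [hz0]; exact h2.ne')
  rw [hz0] at h4
  refine h4.congr_deriv ?_
  have h5 : 0 < √(gram (Θ z)).det := Real.sqrt_pos.mpr h2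
  rw [volumeDensity, div_eq_iff (by positivity)]
  nth_rewrite 1 [← Real.mul_self_sqrt h2.le]
  ring

end IsHermitianOn

end LocalOperators


/-! ### The codifferential is the formal adjoint of the exterior derivative -/

section IntegrationByParts

lemma minSmoothness_two_le_infty : minSmoothness ℝ 2 ≤ ∞ := by
  rw [minSmoothness_of_isRCLikeNormedField]
  exact WithTop.coe_le_coe.mpr (le_top : (2 : ℕ∞) ≤ ⊤)

/-- A function which is smooth on a neighbourhood of its support is smooth. -/
lemma contDiff_of_contDiffOn_of_tsupport_subset {F G : Type*} [NormedAddCommGroup F]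
    [NormedSpace ℝ F] [NormedAddCommGroup G] [NormedSpace ℝ G] {V : Set F} {f : F → G}
    (hV : IsOpen V) (hf : ContDiffOn ℝ ∞ f V) (ht : tsupport f ⊆ V) : ContDiff ℝ ∞ f := by
  rw [contDiff_iff_contDiffAt]
  intro x
  by_cases hx : x ∈ tsupport f
  · exact hf.contDiffAt (hV.mem_nhds (ht hx))
  · exact contDiffAt_const.congr_of_eventuallyEq (notMem_tsupport_iff_eventuallyEq.mp hx)

/-- The terms of the divergence which contain Christoffel symbols cancel. -/
lemma sum_christoffel_terms_eq_zero {n : Type*} [Fintype n] [DecidableEq n] (S : Matrix n n ℝ)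
    (M : n → Matrix n n ℝ) (hM : ∀ i c b, M i c b = M b c i) (a : n → ℂ) :
    ∑ i, ∑ j, (((-(M i * S + S * (M i).transpose) i j : ℝ) : ℂ) * a j +
      ((S i j * (M i).trace : ℝ) : ℂ) * a j +
        (S i j : ℂ) * ∑ c, (M i c j : ℂ) * a c) = 0 := by
  have h1 : ∑ i, ∑ j, (((M i * S) i j : ℝ) : ℂ) * a j =
      ∑ i, ∑ j, ((S i j * (M i).trace : ℝ) : ℂ) * a j := by
    have : ∀ i j, (((M i * S) i j : ℝ) : ℂ) * a j =
        ∑ b, (M i i b : ℂ) * (S b j : ℂ) * a j := by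
      intro i j
      rw [Matrix.mul_apply, Complex.ofReal_sum, Finset.sum_mul]
      simp only [Complex.ofReal_mul]
    simp only [this]
    rw [Finset.sum_comm]
    conv_rhs => rw [Finset.sum_comm]
    refine Finset.sum_congr rfl fun j _ => ?_
    rw [Finset.sum_comm]
    refine Finset.sum_congr rfl fun b _ => ?_
    rw [Matrix.trace, Finset.mul_sum, Complex.ofReal_sum, Finset.sum_mul]
    refine Finset.sum_congr rfl fun i _ => ?_
    rw [hM i i b, Matrix.diag_apply]
    push_cast
    ring
  have h2 : ∑ i, ∑ j, (((S * (M i).transpose) i j : ℝ) : ℂ) * a j =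
      ∑ i, ∑ j, (S i j : ℂ) * ∑ c, (M i c j : ℂ) * a c := by
    refine Finset.sum_congr rfl fun i _ => ?_
    simp only [Matrix.mul_apply, Matrix.transpose_apply, Complex.ofReal_sum, Finset.sum_mul,
      Finset.mul_sum, Complex.ofReal_mul]
    rw [Finset.sum_comm]
    simp only [mul_assoc]
  have h3 : ∀ i j, ((-(M i * S + S * (M i).transpose) i j : ℝ) : ℂ) * a j =
      -((((M i * S) i j : ℝ) : ℂ) * a j) - (((S * (M i).transpose) i j : ℝ) : ℂ) * a j := by
    intro i j
    rw [Matrix.add_apply]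
    push_cast
    ring
  simp only [h3, Finset.sum_add_distrib, Finset.sum_sub_distrib, Finset.sum_neg_distrib, h1, h2]
  ring

/-- The bookkeeping at the end of `IsHermitianOn.sum_fderiv_flux`: `X` collects the terms with
Christoffel symbols, which cancel. -/
lemma sum_mul_add_eq {n : Type*} [Fintype n] (r : ℂ) (X S c d : n → n → ℂ)
    (hX : ∑ i, ∑ j, X i j = 0) :
    ∑ i, ∑ j, r * (X i j + S i j * (c i j + d i j)) =
      (∑ i, ∑ j, S i j * c i j) * r - (-∑ i, ∑ j, S i j * d i j) * r := by
  simp only [← Finset.mul_sum, mul_add, Finset.sum_add_distrib, hX]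
  ring

variable {E : Type*} [NormedAddCommGroup E] [NormedSpace ℂ E] {k : ℕ}

lemma tsupport_extDeriv_subset (α : E → AltForm E k) : tsupport (extDeriv α) ⊆ tsupport α := by
  have h1 : Function.support (extDeriv α) ⊆ Function.support (fderiv ℝ α) := by
    intro z hz hz'
    refine hz ?_
    rw [extDeriv, hz']
    exact (alternatizeUncurryFinCLM ℝ E ℂ).map_zero
  exact (closure_mono h1).trans (tsupport_fderiv_subset ℝ)

variable [FiniteDimensional ℂ E]

lemma contDiffOn_formPairing {V : Set E}
    {S : E → Matrix (Fin (Module.finrank ℝ E)) (Fin (Module.finrank ℝ E)) ℝ}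
    (hS : ∀ i j, ContDiffOn ℝ ∞ (fun z => S z i j) V) {a b : E → AltForm E k}
    (ha : ContDiffOn ℝ ∞ a V) (hb : ContDiffOn ℝ ∞ b V) :
    ContDiffOn ℝ ∞ (fun z => formPairing (S z) (a z) (b z)) V := by
  have hev : ∀ {c : E → AltForm E k} (_ : ContDiffOn ℝ ∞ c V) (v : Fin k → E),
      ContDiffOn ℝ ∞ (fun z => c z v) V := fun hc v =>
    (ContinuousAlternatingMap.apply ℝ E ℂ v).contDiff.comp_contDiffOn hc
  refine contDiffOn_const.mul (ContDiffOn.sum fun I _ => ContDiffOn.sum fun J _ => ?_)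
  have h0 : ContDiffOn ℝ ∞ (fun z => ∏ r, S z (I r) (J r)) V := contDiffOn_prod fun r _ => hS _ _
  have h1 : ContDiffOn ℝ ∞ (fun z => ((∏ r, S z (I r) (J r) : ℝ) : ℂ)) V :=
    Complex.ofRealCLM.contDiff.comp_contDiffOn h0
  have h2 : ContDiffOn ℝ ∞ (fun z => star (b z fun r => realBasis E (J r))) V :=
    Complex.conjCLE.contDiff.comp_contDiffOn (hev hb _)
  exact (h1.mul (hev ha _)).mul h2

namespace IsHermitianOn

variable {V : Set E} {Θ : E → AltForm E 2} (h : IsHermitianOn V Θ)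
include h

lemma contDiffOn_volumeDensity : ContDiffOn ℝ ∞ (fun z => volumeDensity (Θ z)) V :=
  (contDiffOn_det (contDiffOn_gram h.smooth)).sqrt
    fun z hz => (h.herm z hz).gram_posDef.det_pos.ne'

lemma contDiffOn_formInner_mul {a b : E → AltForm E k} (ha : ContDiffOn ℝ ∞ a V)
    (hb : ContDiffOn ℝ ∞ b V) :
    ContDiffOn ℝ ∞ (fun z => formInner (Θ z) (a z) (b z) * (volumeDensity (Θ z) : ℂ)) V :=
  (contDiffOn_formPairing h.contDiffOn_gramInv ha hb).mul
    (Complex.ofRealCLM.contDiff.comp_contDiffOn h.contDiffOn_volumeDensity)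

/-- The product rule for the components `√g g^{ij} ⟨α, ι_j β⟩` of the vector field whose
divergence is integrated. -/
lemma hasDerivAt_flux {z : E} (hz : z ∈ V) {α : E → AltForm E k} {β : E → AltForm E (k + 1)}
    (hα : DifferentiableAt ℝ α z) (hβ : DifferentiableAt ℝ β z) (u w : E) (i j) :
    HasDerivAt (fun t : ℝ => ((gram (Θ (z + t • u)))⁻¹ i j : ℂ) *
        (volumeDensity (Θ (z + t • u)) : ℂ) *
        formPairing (gram (Θ (z + t • u)))⁻¹ (α (z + t • u)) (contr w (β (z + t • u))))
      ((volumeDensity (Θ z) : ℂ) *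
        ((((-(endMatrix (christoffelOf Θ z u) * (gram (Θ z))⁻¹ +
        (gram (Θ z))⁻¹ * (endMatrix (christoffelOf Θ z u)).transpose) i j : ℝ) : ℂ) *
          formPairing (gram (Θ z))⁻¹ (α z) (contr w (β z)) +
        (((gram (Θ z))⁻¹ i j * (endMatrix (christoffelOf Θ z u)).trace : ℝ) : ℂ) *
          formPairing (gram (Θ z))⁻¹ (α z) (contr w (β z)) +
        ((gram (Θ z))⁻¹ i j : ℂ) *
          formPairing (gram (Θ z))⁻¹ (α z) (contr (christoffelOf Θ z u w) (β z))) +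
        ((gram (Θ z))⁻¹ i j : ℂ) *
          (formPairing (gram (Θ z))⁻¹ (nabla Θ α z u) (contr w (β z)) +
            formPairing (gram (Θ z))⁻¹ (α z) (contr w (nabla Θ β z u))))) 0 := by
  have hz0 : z + (0 : ℝ) • u = z := by simp
  have hline : HasDerivAt (fun t : ℝ => z + t • u) u 0 := by
    simpa using ((hasDerivAt_id (0 : ℝ)).smul_const u).const_add z
  have ha : HasDerivAt (fun t : ℝ => α (z + t • u)) (fderiv ℝ α z u) 0 := by
    have : HasFDerivAt α (fderiv ℝ α z) (z + (0 : ℝ) • u) := by rw [hz0]; exact hα.hasFDerivAt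
    exact this.comp_hasDerivAt 0 hline
  have hb : HasDerivAt (fun t : ℝ => contr w (β (z + t • u))) (contr w (fderiv ℝ β z u)) 0 := by
    have : HasFDerivAt β (fderiv ℝ β z) (z + (0 : ℝ) • u) := by rw [hz0]; exact hβ.hasFDerivAt
    exact (contr w).hasFDerivAt.comp_hasDerivAt 0 (this.comp_hasDerivAt 0 hline)
  have hP := hasDerivAt_formPairing (christoffelOf Θ z u)
    (S := fun t : ℝ => (gram (Θ (z + t • u)))⁻¹) (t := 0)
    (by simpa only [hz0] using h.hasDerivAt_gramInv hz u) ha hb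
  have hF := ((h.hasDerivAt_gramInv hz u i j).ofReal_comp.mul
    (h.hasDerivAt_volumeDensity hz u).ofReal_comp).mul hP
  refine hF.congr_deriv ?_
  simp only [Pi.mul_apply, hz0]
  have h1 : contr w (fderiv ℝ β z u) - derivAct (christoffelOf Θ z u) (contr w (β z)) =
      contr w (nabla Θ β z u) + contr (christoffelOf Θ z u w) (β z) := by
    rw [nabla, covDeriv_apply, _root_.map_sub, contr_derivAct]
    abel
  have h2 : fderiv ℝ α z u - derivAct (christoffelOf Θ z u) (α z) = nabla Θ α z u := rfl
  rw [h1, h2, formPairing_add_right]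
  push_cast
  ring

/-- The divergence of the vector field with components `∑ⱼ √g g^{ij} ⟨α, ι_j β⟩` is
`√g (⟨dα, β⟩ - ⟨α, δβ⟩)`. -/
lemma sum_fderiv_flux {z : E} (hz : z ∈ V) {α : E → AltForm E k} {β : E → AltForm E (k + 1)}
    (hα : ContDiffOn ℝ ∞ α V) (hβ : ContDiffOn ℝ ∞ β V) :
    ∑ i, ∑ j, fderiv ℝ (fun z => ((gram (Θ z))⁻¹ i j : ℂ) * (volumeDensity (Θ z) : ℂ) *
        formPairing (gram (Θ z))⁻¹ (α z) (contr (realBasis E j) (β z))) z (realBasis E i) =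
      formInner (Θ z) (extDeriv α z) (β z) * (volumeDensity (Θ z) : ℂ) -
        formInner (Θ z) (α z) (localCodiff Θ β z) * (volumeDensity (Θ z) : ℂ) := by
  have hVz := h.isOpen.mem_nhds hz
  have hα' := (hα.contDiffAt hVz).differentiableAt (by simp)
  have hβ' := (hβ.contDiffAt hVz).differentiableAt (by simp)
  have hd : ∀ i j, DifferentiableAt ℝ (fun z => ((gram (Θ z))⁻¹ i j : ℂ) *
      (volumeDensity (Θ z) : ℂ) *
        formPairing (gram (Θ z))⁻¹ (α z) (contr (realBasis E j) (β z))) z := fun i j =>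
    (ContDiffOn.contDiffAt
      (((Complex.ofRealCLM.contDiff.comp_contDiffOn (h.contDiffOn_gramInv i j)).mul
        (Complex.ofRealCLM.contDiff.comp_contDiffOn h.contDiffOn_volumeDensity)).mul
        (contDiffOn_formPairing h.contDiffOn_gramInv hα
          ((contr (realBasis E j)).contDiff.comp_contDiffOn hβ))) hVz).differentiableAt (by simp)
  have h1 := fun i j => (hd i j).lineDeriv_eq_fderiv.symm.trans
    (h.hasDerivAt_flux hz hα' hβ' (realBasis E i) (realBasis E j) i j).deriv
  rw [Finset.sum_congr rfl fun i _ => Finset.sum_congr rfl fun j _ => h1 i j]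
  have h2 : ∀ i j, formPairing (gram (Θ z))⁻¹ (α z)
      (contr (christoffelOf Θ z (realBasis E i) (realBasis E j)) (β z)) =
      ∑ c, (endMatrix (christoffelOf Θ z (realBasis E i)) c j : ℂ) *
        formPairing (gram (Θ z))⁻¹ (α z) (contr (realBasis E c) (β z)) := by
    intro i j
    rw [← endMatrix_sum, contr_sum, formPairing_sum_right]
    refine Finset.sum_congr rfl fun c _ => ?_
    rw [contr_smul, formPairing_smul_right]
  have h3 := sum_christoffel_terms_eq_zero (gram (Θ z))⁻¹
    (fun i => endMatrix (christoffelOf Θ z (realBasis E i)))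
    (fun i c b => by
      simp only [endMatrix, Matrix.of_apply]
      rw [(h.isChristoffel hz).symm])
    (fun j => formPairing (gram (Θ z))⁻¹ (α z) (contr (realBasis E j) (β z)))
  have h4 : formInner (Θ z) (extDeriv α z) (β z) = ∑ i, ∑ j, ((gram (Θ z))⁻¹ i j : ℂ) *
      formPairing (gram (Θ z))⁻¹ (nabla Θ α z (realBasis E i))
        (contr (realBasis E j) (β z)) := by
    rw [← h.alternatize_nabla α hz, formInner_eq, formPairing_alternatize]
  have h5 : formInner (Θ z) (α z) (localCodiff Θ β z) =
      -∑ i, ∑ j, ((gram (Θ z))⁻¹ i j : ℂ) * formPairing (gram (Θ z))⁻¹ (α z)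
        (contr (realBasis E j) (nabla Θ β z (realBasis E i))) := by
    rw [formInner_eq, localCodiff, codiffAt, formPairing_neg_right, metricTrace,
      Finset.sum_comm]
    simp only [formPairing_sum_right, formPairing_smul_right]
    congr 1
    refine Finset.sum_congr rfl fun i _ => Finset.sum_congr rfl fun j _ => ?_
    rw [(h.herm z hz).gramInv_symm]
  rw [h4, h5]
  refine sum_mul_add_eq _ _ _ _ _ (Eq.trans ?_ h3)
  refine Finset.sum_congr rfl fun i _ => Finset.sum_congr rfl fun j _ => ?_
  rw [h2]

lemma contDiff_formInner_mul {a b : E → AltForm E k} (ha : ContDiffOn ℝ ∞ a V)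
    (hb : ContDiffOn ℝ ∞ b V) (ht : tsupport a ⊆ V) :
    ContDiff ℝ ∞ (fun z => formInner (Θ z) (a z) (b z) * (volumeDensity (Θ z) : ℂ)) ∧
      tsupport (fun z => formInner (Θ z) (a z) (b z) * (volumeDensity (Θ z) : ℂ)) ⊆
        tsupport a := by
  have h1 : tsupport (fun z => formInner (Θ z) (a z) (b z) * (volumeDensity (Θ z) : ℂ)) ⊆
      tsupport a := by
    refine closure_mono fun z hz hz' => hz ?_
    change formPairing _ (a z) _ * _ = 0
    rw [hz', formPairing_zero_left, zero_mul]
  exact ⟨contDiff_of_contDiffOn_of_tsupport_subset h.isOpen (h.contDiffOn_formInner_mul ha hb)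
    (h1.trans ht), h1⟩

variable [MeasurableSpace E] [BorelSpace E]

lemma integrable_formInner_mul {a b : E → AltForm E k} (ha : ContDiffOn ℝ ∞ a V)
    (hb : ContDiffOn ℝ ∞ b V) (hc : HasCompactSupport a) (ht : tsupport a ⊆ V) :
    MeasureTheory.Integrable
      (fun z => formInner (Θ z) (a z) (b z) * (volumeDensity (Θ z) : ℂ))
      (realBasis E).addHaar := by
  obtain ⟨h1, h2⟩ := h.contDiff_formInner_mul ha hb ht
  exact h1.continuous.integrable_of_hasCompactSupport
    (hc.isCompact.of_isClosed_subset (isClosed_tsupport _) h2)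

/-- Integration by parts: `localCodiff` is the formal adjoint of the exterior derivative. -/
theorem integral_extDeriv_eq {α : E → AltForm E k} {β : E → AltForm E (k + 1)}
    (hα : ContDiff ℝ ∞ α) (hc : HasCompactSupport α) (ht : tsupport α ⊆ V)
    (hβ : ContDiffOn ℝ ∞ β V) :
    ∫ z, formInner (Θ z) (extDeriv α z) (β z) * (volumeDensity (Θ z) : ℂ)
        ∂(realBasis E).addHaar =
      ∫ z, formInner (Θ z) (α z) (localCodiff Θ β z) * (volumeDensity (Θ z) : ℂ)
        ∂(realBasis E).addHaar := by
  have hsupp : tsupport (extDeriv α) ⊆ tsupport α := tsupport_extDeriv_subset α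
  let F : Fin (Module.finrank ℝ E) → Fin (Module.finrank ℝ E) → E → ℂ := fun i j z =>
    ((gram (Θ z))⁻¹ i j : ℂ) * (volumeDensity (Θ z) : ℂ) *
      formPairing (gram (Θ z))⁻¹ (α z) (contr (realBasis E j) (β z))
  have hFt : ∀ i j, tsupport (F i j) ⊆ tsupport α := fun i j => by
    refine closure_mono fun z hz hz' => hz ?_
    change _ * formPairing _ (α z) _ = 0
    rw [hz', formPairing_zero_left, mul_zero]
  have hFs : ∀ i j, ContDiff ℝ ∞ (F i j) := fun i j =>
    contDiff_of_contDiffOn_of_tsupport_subset h.isOpen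
      (((Complex.ofRealCLM.contDiff.comp_contDiffOn (h.contDiffOn_gramInv i j)).mul
        (Complex.ofRealCLM.contDiff.comp_contDiffOn h.contDiffOn_volumeDensity)).mul
        (contDiffOn_formPairing h.contDiffOn_gramInv hα.contDiffOn
          ((contr (realBasis E j)).contDiff.comp_contDiffOn hβ))) ((hFt i j).trans ht)
  have hFc : ∀ i j, HasCompactSupport (F i j) := fun i j =>
    hc.isCompact.of_isClosed_subset (isClosed_tsupport _) (hFt i j)
  have hFd : ∀ i j (v : E), MeasureTheory.Integrable (fun z => fderiv ℝ (F i j) z v)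
      (realBasis E).addHaar := fun i j v =>
    (((hFs i j).continuous_fderiv (by simp)).clm_apply
      continuous_const).integrable_of_hasCompactSupport ((hFc i j).fderiv_apply ℝ v)
  have hF0 : ∀ i j (v : E), ∫ z, fderiv ℝ (F i j) z v ∂(realBasis E).addHaar = 0 := by
    intro i j v
    have := integral_mul_fderiv_eq_neg_fderiv_mul_of_integrable (μ := (realBasis E).addHaar)
      (f := fun _ : E => (1 : ℂ)) (g := F i j) (v := v) (by simp) (by simpa using hFd i j v)
      (by simpa using (hFs i j).continuous.integrable_of_hasCompactSupport (hFc i j))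
      (fun _ _ => differentiableAt_const _)
      (fun z _ => (hFs i j).differentiable (by simp) z)
    simpa using this
  have h1 : ∀ z, ∑ i, ∑ j, fderiv ℝ (F i j) z (realBasis E i) =
      formInner (Θ z) (extDeriv α z) (β z) * (volumeDensity (Θ z) : ℂ) -
        formInner (Θ z) (α z) (localCodiff Θ β z) * (volumeDensity (Θ z) : ℂ) := by
    intro z
    by_cases hz : z ∈ tsupport α
    · exact h.sum_fderiv_flux (ht hz) hα.contDiffOn hβ
    · have h2 : ∀ i j, fderiv ℝ (F i j) z = 0 := fun i j =>
        image_eq_zero_of_notMem_tsupport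
          fun h3 => hz (hFt i j (tsupport_fderiv_subset ℝ h3))
      have h3 : extDeriv α z = 0 := image_eq_zero_of_notMem_tsupport fun h3 => hz (hsupp h3)
      simp only [h2, h3, image_eq_zero_of_notMem_tsupport hz, formInner_eq,
        formPairing_zero_left]
      simp
  rw [← sub_eq_zero, ← MeasureTheory.integral_sub]
  · simp only [← h1]
    rw [MeasureTheory.integral_finsetSum _
      fun i _ => MeasureTheory.integrable_finsetSum _ fun j _ => hFd i j _]
    refine Finset.sum_eq_zero fun i _ => ?_
    rw [MeasureTheory.integral_finsetSum _ fun j _ => hFd i j _]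
    exact Finset.sum_eq_zero fun j _ => hF0 i j _
  · exact h.integrable_formInner_mul (contDiffOn_extDeriv h.isOpen hα.contDiffOn) hβ
      (hc.isCompact.of_isClosed_subset (isClosed_tsupport _) hsupp) (hsupp.trans ht)
  · exact h.integrable_formInner_mul hα.contDiffOn (h.contDiffOn_localCodiff hβ) hc ht

/-- A smooth form `γ` which is `L²`-orthogonal to all test forms vanishes, as one sees by testing
with `χ γ` for a cut-off function `χ`. -/
theorem eq_zero_of_integral_eq_zero {γ : E → AltForm E k} (hγ : ContDiffOn ℝ ∞ γ V)
    (h0 : ∀ α : E → AltForm E k, ContDiff ℝ ∞ α → HasCompactSupport α → tsupport α ⊆ V →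
      ∫ z, formInner (Θ z) (α z) (γ z) * (volumeDensity (Θ z) : ℂ)
        ∂(realBasis E).addHaar = 0) {z : E} (hz : z ∈ V) : γ z = 0 := by
  obtain ⟨χ, hχt, hχc, hχs, hχ01, hχz⟩ :=
    exists_contDiff_tsupport_subset (n := ⊤) (h.isOpen.mem_nhds hz)
  let α : E → AltForm E k := fun z => χ z • γ z
  have hαt : tsupport α ⊆ tsupport χ := closure_mono fun w hw hw' => hw (by simp [α, hw'])
  have hα : ContDiffOn ℝ ∞ α V := hχs.contDiffOn.smul hγ
  have hαs := contDiff_of_contDiffOn_of_tsupport_subset h.isOpen hα (hαt.trans hχt)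
  have hαc : HasCompactSupport α := hχc.isCompact.of_isClosed_subset (isClosed_tsupport _) hαt
  obtain ⟨h1, h2⟩ := h.contDiff_formInner_mul hα hγ (hαt.trans hχt)
  let G : E → ℝ := fun w => (formInner (Θ w) (α w) (γ w) * (volumeDensity (Θ w) : ℂ)).re
  have hGv : ∀ w, formInner (Θ w) (α w) (γ w) * (volumeDensity (Θ w) : ℂ) =
      ((χ w * (formInner (Θ w) (γ w) (γ w)).re * volumeDensity (Θ w) : ℝ) : ℂ) := by
    intro w
    by_cases hw : w ∈ V
    · have h3 := formPairing_self_nonneg (h.herm w hw).gram_posDef.inv (γ w)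
      rw [formInner_eq, formInner_eq, formPairing_real_smul_left]
      have h4 : formPairing (gram (Θ w))⁻¹ (γ w) (γ w) =
          ((formPairing (gram (Θ w))⁻¹ (γ w) (γ w)).re : ℂ) :=
        Complex.ext rfl (by simpa using h3.2.1)
      rw [h4]
      push_cast
      rw [Complex.ofReal_re]
    · have h3 : χ w = 0 := image_eq_zero_of_notMem_tsupport fun h3 => hw (hχt h3)
      have h4 : α w = 0 := by simp [α, h3]
      rw [formInner_eq, h4, h3, formPairing_zero_left]
      simp
  have hG0 : 0 ≤ G := by
    intro w
    change 0 ≤ (formInner (Θ w) (α w) (γ w) * (volumeDensity (Θ w) : ℂ)).re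
    rw [hGv, Complex.ofReal_re]
    by_cases hw : w ∈ V
    · have h3 := formPairing_self_nonneg (h.herm w hw).gram_posDef.inv (γ w)
      have h4 : 0 ≤ χ w := (hχ01 ⟨w, rfl⟩).1
      rw [formInner_eq]
      exact mul_nonneg (mul_nonneg h4 h3.1) (Real.sqrt_nonneg _)
    · have h3 : χ w = 0 := image_eq_zero_of_notMem_tsupport fun h3 => hw (hχt h3)
      simp [h3]
  have hGc : Continuous G := Complex.continuous_re.comp h1.continuous
  have hGs : HasCompactSupport G :=
    HasCompactSupport.comp_left (g := Complex.re)
      (hαc.isCompact.of_isClosed_subset (isClosed_tsupport _) h2) rfl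
  have hGi : ∫ w, G w ∂(realBasis E).addHaar = 0 := by
    have h3 := integral_re (μ := (realBasis E).addHaar)
      (h.integrable_formInner_mul hα hγ hαc (hαt.trans hχt))
    rw [h0 α hαs hαc (hαt.trans hχt)] at h3
    exact h3
  have hGz : G z = 0 := by
    by_contra hne
    exact absurd hGi (hGc.integral_pos_of_hasCompactSupport_nonneg_nonzero hGs hG0 hne).ne'
  have h3 := formPairing_self_nonneg (h.herm z hz).gram_posDef.inv (γ z)
  refine h3.2.2 ?_
  have h4 : G z = χ z * (formInner (Θ z) (γ z) (γ z)).re * volumeDensity (Θ z) := by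
    change (formInner (Θ z) (α z) (γ z) * (volumeDensity (Θ z) : ℂ)).re = _
    rw [hGv, Complex.ofReal_re]
  rw [hGz, hχz, one_mul] at h4
  have h5 : 0 < volumeDensity (Θ z) := Real.sqrt_pos.mpr (h.herm z hz).gram_posDef.det_pos
  exact (mul_eq_zero.mp h4.symm).resolve_right h5.ne'

/-- The codifferential squares to zero, since the exterior derivative does. -/
theorem localCodiff_localCodiff {β : E → AltForm E (k + 2)} (hβ : ContDiffOn ℝ ∞ β V) {z : E}
    (hz : z ∈ V) : localCodiff Θ (localCodiff Θ β) z = 0 := by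
  refine h.eq_zero_of_integral_eq_zero
    (h.contDiffOn_localCodiff (h.contDiffOn_localCodiff hβ)) (fun α hα hc ht => ?_) hz
  have hsupp := tsupport_extDeriv_subset α
  have hdα : ContDiff ℝ ∞ (extDeriv α) :=
    contDiffOn_univ.mp (contDiffOn_extDeriv isOpen_univ hα.contDiffOn)
  rw [← h.integral_extDeriv_eq hα hc ht (h.contDiffOn_localCodiff hβ),
    ← h.integral_extDeriv_eq hdα (hc.isCompact.of_isClosed_subset (isClosed_tsupport _) hsupp)
      (hsupp.trans ht) hβ, extDeriv_extDeriv hα minSmoothness_two_le_infty]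
  simp [formInner_eq, formPairing_zero_left]

end IsHermitianOn

end IntegrationByParts


/-! ### The Kähler identities -/

section KahlerIdentities

/-- The formal consequence of the commutation relations between `d`, `d^c`, their adjoints, the
derivation `J` and the Lefschetz operator `L`: the Laplacian commutes with `J`. -/
lemma laplacian_comm_of_relations {M : ℕ → Type*} [∀ k, AddCommGroup (M k)] [∀ k, Module ℂ (M k)]
    (d dc : ∀ k, M k →ₗ[ℂ] M (k + 1)) (δ δc : ∀ k, M (k + 1) →ₗ[ℂ] M k)
    (J : ∀ k, M k →ₗ[ℂ] M k) (L : ∀ k, M k →ₗ[ℂ] M (k + 2))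
    (hJd : ∀ k a, J (k + 1) (d k a) = d k (J k a) + dc k a)
    (hJdc : ∀ k a, J (k + 1) (dc k a) = dc k (J k a) - d k a)
    (hJδ : ∀ k a, J k (δ k a) = δ k (J (k + 1) a) + δc k a)
    (hJδc : ∀ k a, J k (δc k a) = δc k (J (k + 1) a) - δ k a)
    (hδL : ∀ k a, δ (k + 2) (L (k + 1) a) = L k (δ k a) + (2 : ℂ) • dc (k + 1) a)
    (hδL0 : ∀ a, δ 1 (L 0 a) = (2 : ℂ) • dc 0 a)
    (hδδ : ∀ k a, δ k (δ (k + 1) a) = 0) (k : ℕ) (a : M (k + 1)) :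
    J (k + 1) (d k (δ k a) + δ (k + 1) (d (k + 1) a)) =
      d k (δ k (J (k + 1) a)) + δ (k + 1) (d (k + 1) (J (k + 1) a)) := by
  -- `d^c` and `δ` anticommute, because `δ δ = 0` and `d^c` is the commutator of `δ` and `L / 2`
  have hA : ∀ k (a : M (k + 1)), dc k (δ k a) + δ (k + 1) (dc (k + 1) a) = 0 := by
    intro k a
    have h1 := hδδ (k + 1) (L (k + 1) a)
    rw [hδL, _root_.map_add, _root_.map_smul] at h1
    have h2 : δ (k + 1) (L k (δ k a)) = (2 : ℂ) • dc k (δ k a) := by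
      cases k with
      | zero => exact hδL0 _
      | succ k => rw [hδL, hδδ, _root_.map_zero, zero_add]
    rw [h2, ← smul_add] at h1
    exact (smul_eq_zero.mp h1).resolve_left two_ne_zero
  -- the commutator of `J` with this relation
  have hΔ : d k (δ k a) + δ (k + 1) (d (k + 1) a) =
      dc k (δc k a) + δc (k + 1) (dc (k + 1) a) := by
    have h1 := congrArg (J (k + 1)) (hA k a)
    rw [_root_.map_add, hJdc, hJδ, hJδ, hJdc, _root_.map_zero, _root_.map_add, _root_.map_sub]
      at h1
    have h2 := hA k (J (k + 1) a)
    rw [← sub_eq_zero, ← neg_eq_zero]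
    calc _ = (dc k (δ k (J (k + 1) a)) + dc k (δc k a) - d k (δ k a) +
          (δ (k + 1) (dc (k + 1) (J (k + 1) a)) - δ (k + 1) (d (k + 1) a) +
            δc (k + 1) (dc (k + 1) a))) -
          (dc k (δ k (J (k + 1) a)) + δ (k + 1) (dc (k + 1) (J (k + 1) a))) := by abel
      _ = 0 := by rw [h1, h2, sub_zero]
  have hΔJ : d k (δ k (J (k + 1) a)) + δ (k + 1) (d (k + 1) (J (k + 1) a)) =
      dc k (δc k (J (k + 1) a)) + δc (k + 1) (dc (k + 1) (J (k + 1) a)) := by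
    have h1 := congrArg (J (k + 1)) (hA k (J (k + 1) a))
    rw [_root_.map_add, hJdc, hJδ, hJδ, hJdc, _root_.map_zero, _root_.map_add, _root_.map_sub]
      at h1
    have h2 := hA k (J (k + 1) (J (k + 1) a))
    rw [← sub_eq_zero, ← neg_eq_zero]
    calc _ = (dc k (δ k (J (k + 1) (J (k + 1) a))) + dc k (δc k (J (k + 1) a)) -
          d k (δ k (J (k + 1) a)) +
          (δ (k + 1) (dc (k + 1) (J (k + 1) (J (k + 1) a))) -
            δ (k + 1) (d (k + 1) (J (k + 1) a)) + δc (k + 1) (dc (k + 1) (J (k + 1) a)))) -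
          (dc k (δ k (J (k + 1) (J (k + 1) a))) +
            δ (k + 1) (dc (k + 1) (J (k + 1) (J (k + 1) a)))) := by abel
      _ = 0 := by rw [h1, h2, sub_zero]
  -- the commutator of `J` with either expression for the Laplacian is plus or minus `d δ^c + δ^c d`
  have hB1 : J (k + 1) (d k (δ k a) + δ (k + 1) (d (k + 1) a)) =
      d k (δ k (J (k + 1) a)) + δ (k + 1) (d (k + 1) (J (k + 1) a)) +
        (d k (δc k a) + δc (k + 1) (d (k + 1) a)) := by
    rw [_root_.map_add, hJd, hJδ, hJδ, hJd, _root_.map_add, _root_.map_add]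
    calc _ = d k (δ k (J (k + 1) a)) + δ (k + 1) (d (k + 1) (J (k + 1) a)) +
        (d k (δc k a) + δc (k + 1) (d (k + 1) a)) +
          (dc k (δ k a) + δ (k + 1) (dc (k + 1) a)) := by abel
      _ = _ := by rw [hA, add_zero]
  have hB2 : J (k + 1) (d k (δ k a) + δ (k + 1) (d (k + 1) a)) =
      d k (δ k (J (k + 1) a)) + δ (k + 1) (d (k + 1) (J (k + 1) a)) -
        (d k (δc k a) + δc (k + 1) (d (k + 1) a)) := by
    rw [hΔ, hΔJ, _root_.map_add, hJdc, hJδc, hJδc, hJdc, _root_.map_sub, _root_.map_sub]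
    calc _ = dc k (δc k (J (k + 1) a)) + δc (k + 1) (dc (k + 1) (J (k + 1) a)) -
        (d k (δc k a) + δc (k + 1) (d (k + 1) a)) -
          (dc k (δ k a) + δ (k + 1) (dc (k + 1) a)) := by abel
      _ = _ := by rw [hA, sub_zero]
  have h3 : (2 : ℂ) • J (k + 1) (d k (δ k a) + δ (k + 1) (d (k + 1) a)) =
      (2 : ℂ) • (d k (δ k (J (k + 1) a)) + δ (k + 1) (d (k + 1) (J (k + 1) a))) := by
    rw [two_smul, two_smul]
    nth_rewrite 1 [hB1]
    rw [hB2]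
    abel
  exact smul_right_injective _ (two_ne_zero (α := ℂ)) h3

variable {E : Type*} [NormedAddCommGroup E] [NormedSpace ℂ E] {k m : ℕ}

variable (E k) in
/-- The Lefschetz operator as a continuous bilinear map. -/
def lefschetzCLM : AltForm E k →L[ℝ] (E →L[ℝ] E →L[ℝ] ℂ) →L[ℝ] AltForm E (k + 2) :=
  (ContinuousLinearMap.compL ℝ (E →L[ℝ] E →L[ℝ] ℂ) (E →L[ℝ] E →L[ℝ] AltForm E k)
    (AltForm E (k + 2)) (alternatizeUncurryFinCLM ℝ E ℂ ∘L
      ContinuousLinearMap.compL ℝ E (E →L[ℝ] AltForm E k) (AltForm E (k + 1))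
        (alternatizeUncurryFinCLM ℝ E ℂ))) ∘L
  (ContinuousLinearMap.compL ℝ E (E →L[ℝ] ℂ) (E →L[ℝ] AltForm E k)) ∘L
  (ContinuousLinearMap.compL ℝ E ℂ (AltForm E k)) ∘L
  (ContinuousLinearMap.lsmul ℝ ℂ : ℂ →L[ℝ] AltForm E k →L[ℝ] AltForm E k).flip

/-- The smooth forms on the open set `V`, extended by zero. The values outside `V` are fixed so that
forms which agree on `V` are equal, and relations between operators become equations of linear
maps. -/
def smoothForms (V : Set E) (k : ℕ) : Submodule ℂ (E → AltForm E k) where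
  carrier := {α | ContDiffOn ℝ ∞ α V ∧ ∀ z ∉ V, α z = 0}
  add_mem' ha hb := ⟨ha.1.add hb.1, fun z hz => by
    rw [Pi.add_apply, ha.2 z hz, hb.2 z hz, add_zero]⟩
  zero_mem' := ⟨contDiffOn_const, fun _ _ => rfl⟩
  smul_mem' c _ ha := ⟨contDiffOn_const.smul ha.1, fun z hz => by
    rw [Pi.smul_apply, ha.2 z hz, smul_zero]⟩

lemma smoothForms_contDiffOn {V : Set E} (α : smoothForms V k) :
    ContDiffOn ℝ ∞ (α : E → AltForm E k) V := α.2.1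

lemma smoothForms_add_apply {V : Set E} (α β : smoothForms V k) (z : E) :
    (α + β : smoothForms V k).1 z = α.1 z + β.1 z := rfl

lemma smoothForms_smul_apply {V : Set E} (c : ℂ) (α : smoothForms V k) (z : E) :
    (c • α : smoothForms V k).1 z = c • α.1 z := rfl

lemma smoothForms_neg_apply {V : Set E} (α : smoothForms V k) (z : E) :
    (-α : smoothForms V k).1 z = -α.1 z := rfl

/-- The restriction to `V` of a form which is smooth there. -/
def restrictForm {V : Set E} {α : E → AltForm E k} (hα : ContDiffOn ℝ ∞ α V) : smoothForms V k :=
  ⟨V.indicator α, hα.congr fun _ hz => Set.indicator_of_mem hz _,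
    fun _ hz => Set.indicator_of_notMem hz _⟩

lemma restrictForm_apply {V : Set E} {α : E → AltForm E k} (hα : ContDiffOn ℝ ∞ α V) {z : E}
    (hz : z ∈ V) : (restrictForm hα : E → AltForm E k) z = α z :=
  Set.indicator_of_mem (f := α) hz

lemma smoothForms_ext {V : Set E} {a b : smoothForms V k}
    (h : ∀ z ∈ V, (a : E → AltForm E k) z = (b : E → AltForm E k) z) : a = b := by
  refine Subtype.ext (funext fun z => ?_)
  by_cases hz : z ∈ V
  · exact h z hz
  · rw [a.2.2 z hz, b.2.2 z hz]

/-- An operator of order zero on smooth forms. -/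
def zerothOrderOp (V : Set E) (P : E → AltForm E k →ₗ[ℂ] AltForm E m)
    (hP : ∀ α : E → AltForm E k, ContDiffOn ℝ ∞ α V → ContDiffOn ℝ ∞ (fun z => P z (α z)) V) :
    smoothForms V k →ₗ[ℂ] smoothForms V m where
  toFun α := ⟨fun z => P z (α.1 z), hP _ α.2.1, fun z hz => by
    change P z (α.1 z) = 0
    rw [α.2.2 z hz, _root_.map_zero]⟩
  map_add' α β := Subtype.ext (funext fun z => _root_.map_add (P z) _ _)
  map_smul' c α := Subtype.ext (funext fun z => _root_.map_smul (P z) _ _)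

lemma extDeriv_congr {α β : E → AltForm E k} {z : E} (h : α =ᶠ[nhds z] β) :
    extDeriv α z = extDeriv β z := by
  rw [extDeriv, extDeriv, h.fderiv_eq]

lemma IsHermitianOn.differentiableAt_of_mem {V : Set E} {Θ : E → AltForm E 2}
    (h : IsHermitianOn V Θ) (α : smoothForms V k) {z : E} (hz : z ∈ V) :
    DifferentiableAt ℝ (α : E → AltForm E k) z :=
  ((smoothForms_contDiffOn α).contDiffAt (h.isOpen.mem_nhds hz)).differentiableAt (by simp)

variable [FiniteDimensional ℂ E]

lemma nabla_congr (Θ : E → AltForm E 2) {α β : E → AltForm E k} {z : E} (h : α =ᶠ[nhds z] β) :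
    nabla Θ α z = nabla Θ β z := by
  rw [nabla, nabla, h.fderiv_eq, h.eq_of_nhds]

lemma localCodiff_congr (Θ : E → AltForm E 2) {α β : E → AltForm E (k + 1)} {z : E}
    (h : α =ᶠ[nhds z] β) : localCodiff Θ α z = localCodiff Θ β z := by
  rw [localCodiff, localCodiff, nabla_congr Θ h]

lemma nabla_add (Θ : E → AltForm E 2) {α β : E → AltForm E k} {z : E}
    (hα : DifferentiableAt ℝ α z) (hβ : DifferentiableAt ℝ β z) :
    nabla Θ (α + β) z = nabla Θ α z + nabla Θ β z := by
  ext1 u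
  simp only [nabla, covDeriv_apply, add_apply, fderiv_add hα hβ, Pi.add_apply, _root_.map_add]
  abel

lemma nabla_smul (Θ : E → AltForm E 2) (c : ℂ) {α : E → AltForm E k} {z : E}
    (hα : DifferentiableAt ℝ α z) : nabla Θ (c • α) z = c • nabla Θ α z := by
  ext1 u
  simp only [nabla, covDeriv_apply, smul_apply, fderiv_const_smul hα, Pi.smul_apply,
    derivAct_complex_smul, smul_sub]

namespace IsHermitianOn

variable {V : Set E} {Θ : E → AltForm E 2} (h : IsHermitianOn V Θ)
include h

/-- The first-order operator `α ↦ P(∇α)` on smooth forms. -/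
def firstOrderOp (P : E → (E →L[ℝ] AltForm E k) →ₗ[ℂ] AltForm E m)
    (hP : ∀ N : E → E →L[ℝ] AltForm E k, ContDiffOn ℝ ∞ N V →
      ContDiffOn ℝ ∞ (fun z => P z (N z)) V) : smoothForms V k →ₗ[ℂ] smoothForms V m where
  toFun α := restrictForm (hP _ (h.contDiffOn_nabla (smoothForms_contDiffOn α)))
  map_add' α β := smoothForms_ext fun z hz => by
    rw [smoothForms_add_apply, restrictForm_apply _ hz, restrictForm_apply _ hz,
      restrictForm_apply _ hz, ← _root_.map_add, ← nabla_add Θ (h.differentiableAt_of_mem α hz)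
      (h.differentiableAt_of_mem β hz)]
    rfl
  map_smul' c α := smoothForms_ext fun z hz => by
    rw [RingHom.id_apply, smoothForms_smul_apply, restrictForm_apply _ hz,
      restrictForm_apply _ hz, ← _root_.map_smul, ← nabla_smul Θ c (h.differentiableAt_of_mem α hz)]
    rfl

lemma firstOrderOp_apply (P : E → (E →L[ℝ] AltForm E k) →ₗ[ℂ] AltForm E m)
    (hP : ∀ N : E → E →L[ℝ] AltForm E k, ContDiffOn ℝ ∞ N V →
      ContDiffOn ℝ ∞ (fun z => P z (N z)) V) (α : smoothForms V k) {z : E} (hz : z ∈ V) :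
    (h.firstOrderOp P hP α : E → AltForm E m) z = P z (nabla Θ α z) :=
  restrictForm_apply (hP _ (h.contDiffOn_nabla (smoothForms_contDiffOn α))) hz

end IsHermitianOn

/-- The antisymmetrization of `N ∘ A`, as a complex linear map in `N`. -/
def alternatizeLin (A : E →L[ℝ] E) : (E →L[ℝ] AltForm E k) →ₗ[ℂ] AltForm E (k + 1) where
  toFun N := alternatizeUncurryFin (N ∘L A)
  map_add' N N' := by rw [ContinuousLinearMap.add_comp, alternatizeUncurryFin_add]
  map_smul' c N := by
    rw [ContinuousLinearMap.smul_comp, alternatize_complex_smul, RingHom.id_apply]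

/-- The contraction `codiffAt` of `N ∘ A`, as a complex linear map in `N`. -/
def codiffLin (A : E →L[ℝ] E) (Θ : AltForm E 2) :
    (E →L[ℝ] AltForm E (k + 1)) →ₗ[ℂ] AltForm E k where
  toFun N := codiffAt Θ (N ∘L A)
  map_add' N N' := by
    simp only [codiffAt, metricTrace, ContinuousLinearMap.comp_apply, add_apply, _root_.map_add,
      smul_add, Finset.sum_add_distrib, neg_add]
  map_smul' c N := by
    simp only [codiffAt, metricTrace, ContinuousLinearMap.comp_apply, smul_apply,
      contr_complex_smul, RingHom.id_apply, smul_neg, Finset.smul_sum]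
    congr 1
    exact Finset.sum_congr rfl fun i _ => Finset.sum_congr rfl fun j _ => smul_comm _ _ _

variable (E k) in
/-- The derivation `J` as a complex linear map. -/
def derivJLin : AltForm E k →ₗ[ℂ] AltForm E k where
  toFun := derivAct (complexJ E)
  map_add' := _root_.map_add _
  map_smul' c a := derivAct_complex_smul c _ a

/-- The Lefschetz operator as a complex linear map. -/
def lefschetzLin (c : E →L[ℝ] E →L[ℝ] ℂ) : AltForm E k →ₗ[ℂ] AltForm E (k + 2) where
  toFun := lefschetz c
  map_add' := lefschetz_add c
  map_smul' := lefschetz_smul c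

namespace IsHermitianOn

variable {V : Set E} {Θ : E → AltForm E 2} (h : IsHermitianOn V Θ)
include h

/-- `d` for `A = id`, and `d^c` for `A = J`. -/
def dOp (A : E →L[ℝ] E) (k : ℕ) : smoothForms V k →ₗ[ℂ] smoothForms V (k + 1) :=
  h.firstOrderOp (fun _ => alternatizeLin A) fun _ hN =>
    (alternatizeUncurryFinCLM ℝ E ℂ).contDiff.comp_contDiffOn (hN.clm_comp contDiffOn_const)

/-- `δ` for `A = id`, and `δ^c` for `A = J`. -/
def codiffOp (A : E →L[ℝ] E) (k : ℕ) : smoothForms V (k + 1) →ₗ[ℂ] smoothForms V k :=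
  h.firstOrderOp (fun z => codiffLin A (Θ z)) fun _ hN =>
    h.contDiffOn_codiffAt (hN.clm_comp contDiffOn_const)

/-- The Lefschetz operator of `Θ`. -/
def lefschetzOp (k : ℕ) : smoothForms V k →ₗ[ℂ] smoothForms V (k + 2) :=
  zerothOrderOp V (fun z => lefschetzLin (formBilin (Θ z))) fun _ hα =>
    have h1 : ContDiffOn ℝ ∞ (fun z => formBilin (Θ z)) V :=
      (formBilin (E := E)).contDiff.comp_contDiffOn h.smooth
    ((lefschetzCLM E k).contDiff.comp_contDiffOn hα).clm_apply h1

end IsHermitianOn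

variable (E) in
/-- The derivation `J` on smooth forms. -/
def derivJOp (V : Set E) (k : ℕ) : smoothForms V k →ₗ[ℂ] smoothForms V k :=
  zerothOrderOp V (fun _ => derivJLin E k) fun _ hα =>
    (derivAct (complexJ E)).contDiff.comp_contDiffOn hα

omit [FiniteDimensional ℂ E] in
lemma derivJOp_apply (V : Set E) (α : smoothForms V k) (z : E) :
    (derivJOp E V k α : E → AltForm E k) z = derivAct (complexJ E) ((α : E → AltForm E k) z) := rfl

namespace IsHermitianOn

variable {V : Set E} {Θ : E → AltForm E 2} (h : IsHermitianOn V Θ)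
include h

omit [FiniteDimensional ℂ E] in
lemma lefschetzOp_apply (α : smoothForms V k) (z : E) :
    (h.lefschetzOp k α : E → AltForm E (k + 2)) z =
      lefschetz (formBilin (Θ z)) ((α : E → AltForm E k) z) := rfl

lemma dOp_apply (A : E →L[ℝ] E) (α : smoothForms V k) {z : E} (hz : z ∈ V) :
    (h.dOp A k α : E → AltForm E (k + 1)) z =
      alternatizeUncurryFin (nabla Θ (α : E → AltForm E k) z ∘L A) :=
  h.firstOrderOp_apply _ _ α hz

lemma codiffOp_apply (A : E →L[ℝ] E) (α : smoothForms V (k + 1)) {z : E} (hz : z ∈ V) :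
    (h.codiffOp A k α : E → AltForm E k) z =
      codiffAt (Θ z) (nabla Θ (α : E → AltForm E (k + 1)) z ∘L A) :=
  h.firstOrderOp_apply _ _ α hz

lemma dOp_eq_extDeriv {α : smoothForms V k} {β : E → AltForm E k} {z : E} (hz : z ∈ V)
    (hαβ : ∀ w ∈ V, (α : E → AltForm E k) w = β w) :
    (h.dOp (.id ℝ E) k α : E → AltForm E (k + 1)) z = extDeriv β z := by
  rw [h.dOp_apply _ _ hz, ContinuousLinearMap.comp_id, h.alternatize_nabla _ hz]
  exact extDeriv_congr (Filter.eventuallyEq_of_mem (h.isOpen.mem_nhds hz) hαβ)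

lemma codiffOp_eq_localCodiff {α : smoothForms V (k + 1)} {β : E → AltForm E (k + 1)} {z : E}
    (hz : z ∈ V) (hαβ : ∀ w ∈ V, (α : E → AltForm E (k + 1)) w = β w) :
    (h.codiffOp (.id ℝ E) k α : E → AltForm E k) z = localCodiff Θ β z := by
  rw [h.codiffOp_apply _ _ hz, ContinuousLinearMap.comp_id]
  exact localCodiff_congr Θ (Filter.eventuallyEq_of_mem (h.isOpen.mem_nhds hz) hαβ)

variable (hd : ∀ z ∈ V, extDeriv Θ z = 0)
include hd

lemma christoffelOf_J {z : E} (hz : z ∈ V) (u v : E) :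
    christoffelOf Θ z u (Complex.I • v) = Complex.I • christoffelOf Θ z u v :=
  (h.jet hz).christoffel_J (hd z hz) u v

/-- On a Kähler manifold the Levi-Civita connection commutes with the derivation `J`. -/
lemma nabla_derivJOp (α : smoothForms V k) {z : E} (hz : z ∈ V) :
    nabla Θ (derivJOp E V k α : E → AltForm E k) z =
      derivAct (complexJ E) ∘L nabla Θ (α : E → AltForm E k) z := by
  have h1 : fderiv ℝ (derivJOp E V k α : E → AltForm E k) z =
      derivAct (complexJ E) ∘L fderiv ℝ (α : E → AltForm E k) z :=
    ((derivAct (complexJ E)).hasFDerivAt.comp z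
      (h.differentiableAt_of_mem α hz).hasFDerivAt).fderiv
  rw [nabla, h1, derivJOp_apply, covDeriv_derivAct (h.christoffelOf_J hd hz), nabla]

/-- On a Kähler manifold the Levi-Civita connection commutes with the Lefschetz operator. -/
lemma nabla_lefschetzOp (α : smoothForms V k) {z : E} (hz : z ∈ V) (u : E) :
    nabla Θ (h.lefschetzOp k α : E → AltForm E (k + 2)) z u =
      lefschetz (formBilin (Θ z)) (nabla Θ (α : E → AltForm E k) z u) := by
  have h1 : HasFDerivAt (fun w => formBilin (Θ w)) (formBilin ∘L fderiv ℝ Θ z) z :=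
    formBilin.hasFDerivAt.comp z (h.differentiableAt hz).hasFDerivAt
  have h2 := ((lefschetzCLM E k).hasFDerivAt_of_bilinear
    (h.differentiableAt_of_mem α hz).hasFDerivAt h1).fderiv
  have h3 : fderiv ℝ (h.lefschetzOp k α : E → AltForm E (k + 2)) z u =
      lefschetz (formBilin (fderiv ℝ Θ z u)) ((α : E → AltForm E k) z) +
        lefschetz (formBilin (Θ z)) (fderiv ℝ (α : E → AltForm E k) z u) :=
    congrArg (fun f : E →L[ℝ] AltForm E (k + 2) => f u) h2
  rw [nabla, covDeriv_apply, h3, lefschetzOp_apply]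
  exact covDeriv_lefschetz ((h.jet hz).deriv_eq (h.isChristoffel hz) (h.christoffelOf_J hd hz))
    _ _ u

/-- The relation `[J, d] = d^c` for `A = id`, and `[J, d^c] = -d` for `A = J`. -/
lemma derivJOp_dOp (A : E →L[ℝ] E) (α : smoothForms V k) :
    derivJOp E V (k + 1) (h.dOp A k α) =
      h.dOp A k (derivJOp E V k α) + h.dOp (A ∘L complexJ E) k α := by
  refine smoothForms_ext fun z hz => ?_
  rw [smoothForms_add_apply, derivJOp_apply, h.dOp_apply _ _ hz, h.dOp_apply _ _ hz,
    h.dOp_apply _ _ hz, derivAct_alternatize, h.nabla_derivJOp hd _ hz,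
    ContinuousLinearMap.comp_assoc, ContinuousLinearMap.comp_assoc]

/-- The relation `[J, δ] = δ^c` for `A = id`, and `[J, δ^c] = -δ` for `A = J`. -/
lemma derivJOp_codiffOp (A : E →L[ℝ] E) (α : smoothForms V (k + 1)) :
    derivJOp E V k (h.codiffOp A k α) =
      h.codiffOp A k (derivJOp E V (k + 1) α) + h.codiffOp (A ∘L complexJ E) k α := by
  refine smoothForms_ext fun z hz => ?_
  rw [smoothForms_add_apply, derivJOp_apply, h.codiffOp_apply _ _ hz,
    h.codiffOp_apply _ _ hz, h.codiffOp_apply _ _ hz, derivAct_codiffAt (h.herm z hz),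
    h.nabla_derivJOp hd _ hz, ContinuousLinearMap.comp_assoc, ContinuousLinearMap.comp_assoc]

variable [MeasurableSpace E] [BorelSpace E]

/-- On a Kähler manifold the Laplacian commutes with the derivation `J`. -/
theorem derivJOp_laplacian (α : smoothForms V (k + 1)) :
    derivJOp E V (k + 1) (h.dOp (.id ℝ E) k (h.codiffOp (.id ℝ E) k α) +
      h.codiffOp (.id ℝ E) (k + 1) (h.dOp (.id ℝ E) (k + 1) α)) =
    h.dOp (.id ℝ E) k (h.codiffOp (.id ℝ E) k (derivJOp E V (k + 1) α)) +
      h.codiffOp (.id ℝ E) (k + 1) (h.dOp (.id ℝ E) (k + 1) (derivJOp E V (k + 1) α)) := by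
  have hJJ : complexJ E ∘L complexJ E = -ContinuousLinearMap.id ℝ E := by
    ext v
    exact complexJ_complexJ v
  refine laplacian_comm_of_relations (M := fun k => smoothForms V k) (h.dOp (.id ℝ E))
    (h.dOp (complexJ E)) (h.codiffOp (.id ℝ E)) (h.codiffOp (complexJ E)) (derivJOp E V)
    h.lefschetzOp (fun k a => ?_) (fun k a => ?_) (fun k a => ?_) (fun k a => ?_)
    (fun k a => ?_) (fun a => ?_) (fun k a => ?_) k α
  · rw [h.derivJOp_dOp hd, ContinuousLinearMap.id_comp]
  · rw [h.derivJOp_dOp hd, hJJ, sub_eq_add_neg]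
    congr 1
    refine smoothForms_ext fun z hz => ?_
    rw [smoothForms_neg_apply, h.dOp_apply _ _ hz, h.dOp_apply _ _ hz,
      ContinuousLinearMap.comp_neg, alternatize_neg]
  · rw [h.derivJOp_codiffOp hd, ContinuousLinearMap.id_comp]
  · rw [h.derivJOp_codiffOp hd, hJJ, sub_eq_add_neg]
    congr 1
    refine smoothForms_ext fun z hz => ?_
    rw [smoothForms_neg_apply, h.codiffOp_apply _ _ hz, h.codiffOp_apply _ _ hz,
      ContinuousLinearMap.comp_neg]
    simp only [codiffAt, metricTrace, neg_apply, _root_.map_neg, smul_neg,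
      Finset.sum_neg_distrib]
  · refine smoothForms_ext fun z hz => ?_
    rw [smoothForms_add_apply, smoothForms_smul_apply, lefschetzOp_apply,
      h.codiffOp_apply _ _ hz, h.codiffOp_apply _ _ hz, h.dOp_apply _ _ hz,
      ContinuousLinearMap.comp_id, ContinuousLinearMap.comp_id,
      codiffAt_lefschetz (h.herm z hz) _ _ (h.nabla_lefschetzOp hd a hz)]
    rfl
  · refine smoothForms_ext fun z hz => ?_
    rw [smoothForms_smul_apply, h.codiffOp_apply _ _ hz, h.dOp_apply _ _ hz,
      ContinuousLinearMap.comp_id,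
      codiffAt_lefschetz_zero (h.herm z hz) _ _ (h.nabla_lefschetzOp hd a hz)]
    rfl
  · refine smoothForms_ext fun z hz => ?_
    rw [h.codiffOp_eq_localCodiff hz fun w hw => h.codiffOp_eq_localCodiff hw fun _ _ => rfl,
      h.localCodiff_localCodiff a.2.1 hz]
    rfl

/-- On a Kähler manifold the Laplacian preserves the eigenforms of the derivation `J`. -/
theorem derivAct_laplacian {α : E → AltForm E (k + 1)} (hα : ContDiffOn ℝ ∞ α V) (μ : ℂ)
    (hμ : ∀ z ∈ V, derivAct (complexJ E) (α z) = μ • α z) {z : E} (hz : z ∈ V) :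
    derivAct (complexJ E) (extDeriv (localCodiff Θ α) z + localCodiff Θ (extDeriv α) z) =
      μ • (extDeriv (localCodiff Θ α) z + localCodiff Θ (extDeriv α) z) := by
  have h1 : ∀ w ∈ V, (restrictForm hα : E → AltForm E (k + 1)) w = α w :=
    fun w hw => restrictForm_apply hα hw
  have h2 : derivJOp E V (k + 1) (restrictForm hα) = μ • restrictForm hα :=
    smoothForms_ext fun w hw => by
      rw [derivJOp_apply, smoothForms_smul_apply, h1 w hw, hμ w hw]
  have h3 := h.derivJOp_laplacian hd (restrictForm hα)
  rw [h2] at h3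
  simp only [_root_.map_smul, ← smul_add] at h3
  have h4 := congrArg (fun a : smoothForms V (k + 1) => (a : E → AltForm E (k + 1)) z) h3
  simp only [derivJOp_apply, smoothForms_smul_apply, smoothForms_add_apply] at h4
  rwa [h.dOp_eq_extDeriv hz fun w hw => h.codiffOp_eq_localCodiff hw h1,
    h.codiffOp_eq_localCodiff hz fun w hw => h.dOp_eq_extDeriv hw h1] at h4

end IsHermitianOn

end KahlerIdentities


/-! ### Naturality of the codifferential under holomorphic changes of coordinates -/

section CoordinateChange

variable {E : Type*} [NormedAddCommGroup E] [NormedSpace ℂ E] {k : ℕ}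

lemma metric_compContinuousLinearMap (Θ : AltForm E 2) {A : E →L[ℝ] E}
    (hA : ∀ v, A (Complex.I • v) = Complex.I • A v) (u v : E) :
    metric (Θ.compContinuousLinearMap A) u v = metric Θ (A u) (A v) := by
  rw [← metricBilin_apply, ← metricBilin_apply]
  change (Θ _).re = (Θ ![A u, Complex.I • A v]).re
  congr 2
  ext j
  fin_cases j
  · rfl
  · exact hA v

/-- The derivation `J` is natural under complex linear maps. -/
lemma derivAct_compContinuousLinearMap (a : AltForm E k) {A : E →L[ℝ] E}
    (hA : ∀ v, A (Complex.I • v) = Complex.I • A v) :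
    derivAct (complexJ E) (a.compContinuousLinearMap A) =
      (derivAct (complexJ E) a).compContinuousLinearMap A := by
  ext v
  rw [derivAct_apply, ContinuousAlternatingMap.compContinuousLinearMap_apply, derivAct_apply]
  refine Finset.sum_congr rfl fun i _ => ?_
  rw [ContinuousAlternatingMap.compContinuousLinearMap_apply, Function.comp_update]
  congr 2
  exact hA _

/-- Data of a holomorphic change of coordinates near a point: `φ` is smooth, its derivative is
complex linear near `z` and invertible at `z`. -/
structure IsCoordChange (φ : E → E) (z : E) : Prop where
  contDiffAt : ContDiffAt ℝ ∞ φ z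
  fderiv_J : ∀ᶠ w in nhds z, ∀ v, fderiv ℝ φ w (Complex.I • v) = Complex.I • fderiv ℝ φ w v
  exists_inverse : ∃ B : E →L[ℝ] E, fderiv ℝ φ z ∘L B = .id ℝ E

namespace IsCoordChange

variable {φ : E → E} {z : E} (hφ : IsCoordChange φ z)
include hφ

lemma hasFDerivAt_fderiv : HasFDerivAt (fderiv ℝ φ) (fderiv ℝ (fderiv ℝ φ) z) z :=
  ((hφ.contDiffAt.fderiv_right (m := ∞) (by simp)).differentiableAt (by simp)).hasFDerivAt

lemma fderiv_fderiv_symm (u v : E) :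
    fderiv ℝ (fderiv ℝ φ) z u v = fderiv ℝ (fderiv ℝ φ) z v u :=
  hφ.contDiffAt.isSymmSndFDerivAt minSmoothness_two_le_infty u v

/-- Near `z` the first derivative of `φ` is complex linear, hence so is the second
derivative at `z`. -/
lemma fderiv_fderiv_J (u v : E) : fderiv ℝ (fderiv ℝ φ) z u (Complex.I • v) =
    Complex.I • fderiv ℝ (fderiv ℝ φ) z u v := by
  have h1 := hφ.hasFDerivAt_fderiv.clm_apply (hasFDerivAt_const (Complex.I • v) z)
  have h2 := ((complexJ E).hasFDerivAt.comp z
    (hφ.hasFDerivAt_fderiv.clm_apply (hasFDerivAt_const v z))).congr_of_eventuallyEq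
      (f₁ := fun w => fderiv ℝ φ w (Complex.I • v)) (by
        filter_upwards [hφ.fderiv_J] with w hw using hw v)
  have h3 := congrArg (fun f : E →L[ℝ] E => f u) (h1.unique h2)
  simpa [complexJ_apply] using h3

/-- The derivative of a pulled back form. -/
lemma fderiv_pullback {β β' : E → AltForm E k} (hβ : DifferentiableAt ℝ β (φ z))
    (hββ' : β' =ᶠ[nhds z] fun w => (β (φ w)).compContinuousLinearMap (fderiv ℝ φ w)) (u : E) :
    fderiv ℝ β' z u =
      (fderiv ℝ β (φ z) (fderiv ℝ φ z u)).compContinuousLinearMap (fderiv ℝ φ z) +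
      (β (φ z)).fderivCompContinuousLinearMap (fderiv ℝ φ z) (fderiv ℝ (fderiv ℝ φ) z u) := by
  have h1 := (hβ.hasFDerivAt.comp z (hφ.contDiffAt.differentiableAt
    (by simp)).hasFDerivAt).continuousAlternatingMapCompContinuousLinearMap hφ.hasFDerivAt_fderiv
  rw [(h1.congr_of_eventuallyEq hββ').fderiv]
  rfl

variable [FiniteDimensional ℂ E]

/-- The codifferential commutes with pull-back by holomorphic isometries. -/
theorem localCodiff_pullback {U V : Set E} {Θ Θ' : E → AltForm E 2} (hΘ : IsHermitianOn V Θ)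
    (hΘ' : IsHermitianOn U Θ') (hz : z ∈ U) (hφz : φ z ∈ V)
    (hΘΘ' : Θ' =ᶠ[nhds z] fun w => (Θ (φ w)).compContinuousLinearMap (fderiv ℝ φ w))
    {β β' : E → AltForm E (k + 1)} (hβ : DifferentiableAt ℝ β (φ z))
    (hββ' : β' =ᶠ[nhds z] fun w => (β (φ w)).compContinuousLinearMap (fderiv ℝ φ w)) :
    localCodiff Θ' β' z =
      (localCodiff Θ β (φ z)).compContinuousLinearMap (fderiv ℝ φ z) := by
  obtain ⟨B, hB⟩ := hφ.exists_inverse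
  set A := fderiv ℝ φ z with hA
  set H := fderiv ℝ (fderiv ℝ φ) z with hH
  have hAJ : ∀ v, A (Complex.I • v) = Complex.I • A v := hφ.fderiv_J.self_of_nhds
  have hm : ∀ u v, metric (Θ' z) u v = metric (Θ (φ z)) (A u) (A v) := fun u v => by
    rw [hΘΘ'.eq_of_nhds, metric_compContinuousLinearMap _ hAJ]
  have hD : ∀ u v w, metric (fderiv ℝ Θ' z u) v w =
      metric (fderiv ℝ Θ (φ z) (A u)) (A v) (A w) +
      metric (Θ (φ z)) (H u v) (A w) + metric (Θ (φ z)) (A v) (H u w) := by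
    intro u v w
    rw [hφ.fderiv_pullback (hΘ.differentiableAt hφz) hΘΘ' u, ← metricBilin_apply,
      _root_.map_add, add_apply, add_apply, metricBilin_apply, metricBilin_apply,
      metric_compContinuousLinearMap _ hAJ, add_assoc]
    congr 1
    rw [metric, metric, metric, fderivCompContinuousLinearMap_apply, Fin.sum_univ_two,
      Complex.add_re, ← hφ.fderiv_fderiv_J, ← hAJ]
    congr 3 <;>
    · ext j
      fin_cases j <;> rfl
  let Γ' : E →L[ℝ] E →L[ℝ] E := (ContinuousLinearMap.compL ℝ E E E B) ∘L
    (((ContinuousLinearMap.compL ℝ E E E).flip A) ∘L (christoffelOf Θ (φ z) ∘L A) + H)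
  have hΓ' : ∀ u v, Γ' u v = B (christoffelOf Θ (φ z) (A u) (A v) + H u v) := fun u v => rfl
  -- the transformed Christoffel symbols are those of `Θ'`, by uniqueness
  have hΓ : christoffelOf Θ' z = Γ' := (hΘ'.isChristoffel hz).unique (hΘ'.herm z hz)
    ((hΘ.isChristoffel hφz).pullback hB hφ.fderiv_fderiv_symm hm hD hΓ')
  refine codiffAt_pullback hB hm fun u => ?_
  rw [nabla, hΓ, hββ'.eq_of_nhds]
  exact covDeriv_pullback hB hΓ' (hφ.fderiv_pullback hβ hββ') u

end IsCoordChange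

end CoordinateChange


/-! ### Forms on a complex manifold and their expressions in charts -/

section Manifold

lemma eventually_coordChange {E X : Type*} [TopologicalSpace E] [TopologicalSpace X]
    {e e' : OpenPartialHomeomorph X E} {z : E} (hz : z ∈ e.target)
    (hz' : e.symm z ∈ e'.source) : ∀ᶠ w in nhds z, w ∈ e.target ∧ e.symm w ∈ e'.source :=
  Filter.Eventually.and (e.open_target.mem_nhds hz)
    ((e.continuousAt_symm hz).eventually_mem (e'.open_source.mem_nhds hz'))

variable {E : Type*} [NormedAddCommGroup E] [NormedSpace ℂ E]
  {X : Type*} [TopologicalSpace X] [ChartedSpace E X] {k : ℕ}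

/-- The value of a form at a point, with the tangent space identified with the model space. -/
def formAt (α : DForm E X k) (x : X) : AltForm E k := α x

/-- The differential of a chart, with the tangent space identified with the model space. -/
def chartDeriv (e : OpenPartialHomeomorph X E) (x : X) : E →L[ℂ] E :=
  mfderiv 𝓘(ℂ, E) 𝓘(ℂ, E) e x

/-- The differential of the inverse of a chart. -/
def chartDerivSymm (e : OpenPartialHomeomorph X E) (z : E) : E →L[ℂ] E :=
  mfderiv 𝓘(ℂ, E) 𝓘(ℂ, E) e.symm z

lemma inChart_eq_formAt (e : OpenPartialHomeomorph X E) (α : DForm E X k) (z : E) :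
    inChart e α z = (formAt α (e.symm z)).compContinuousLinearMap
      ((chartDerivSymm e z).restrictScalars ℝ) := rfl

lemma IsSmooth.differentiableAt {α : DForm E X k} (hα : IsSmooth α)
    {e : OpenPartialHomeomorph X E} (he : e ∈ atlas E X) {z : E} (hz : z ∈ e.target) :
    DifferentiableAt ℝ (inChart e α) z :=
  ((hα e he).contDiffAt (e.open_target.mem_nhds hz)).differentiableAt (by simp)

lemma inChart_add (e : OpenPartialHomeomorph X E) (α β : DForm E X k) (z : E) :
    inChart e (fun x => α x + β x) z = inChart e α z + inChart e β z := rfl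

variable [IsManifold 𝓘(ℂ, E) ω X]

lemma hasMFDerivAt_chart {e : OpenPartialHomeomorph X E} (he : e ∈ atlas E X) {x : X}
    (hx : x ∈ e.source) :
    HasMFDerivAt 𝓘(ℂ, E) 𝓘(ℂ, E) e x (chartDeriv e x : E →L[ℂ] E) :=
  ((contMDiffAt_of_mem_maximalAtlas (n := ω) (IsManifold.subset_maximalAtlas he)
    hx).mdifferentiableAt (by simp)).hasMFDerivAt

lemma hasMFDerivAt_chart_symm {e : OpenPartialHomeomorph X E} (he : e ∈ atlas E X) {z : E}
    (hz : z ∈ e.target) :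
    HasMFDerivAt 𝓘(ℂ, E) 𝓘(ℂ, E) e.symm z (chartDerivSymm e z : E →L[ℂ] E) :=
  ((contMDiffAt_symm_of_mem_maximalAtlas (n := ω) (IsManifold.subset_maximalAtlas he)
    hz).mdifferentiableAt (by simp)).hasMFDerivAt

/-- The coordinate change between two charts is analytic. -/
lemma contDiffAt_coordChange {e e' : OpenPartialHomeomorph X E} (he : e ∈ atlas E X)
    (he' : e' ∈ atlas E X) {z : E} (hz : z ∈ e.target) (hz' : e.symm z ∈ e'.source) :
    ContDiffAt ℂ ω (e' ∘ e.symm) z := by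
  rw [← contMDiffAt_iff_contDiffAt]
  exact (contMDiffAt_of_mem_maximalAtlas (n := ω) (IsManifold.subset_maximalAtlas he')
    hz').comp z (contMDiffAt_symm_of_mem_maximalAtlas (n := ω)
      (IsManifold.subset_maximalAtlas he) hz)

lemma fderiv_coordChange {e e' : OpenPartialHomeomorph X E} (he : e ∈ atlas E X)
    (he' : e' ∈ atlas E X) {z : E} (hz : z ∈ e.target) (hz' : e.symm z ∈ e'.source) :
    fderiv ℝ (e' ∘ e.symm) z = (fderiv ℂ (e' ∘ e.symm) z).restrictScalars ℝ :=
  (((contDiffAt_coordChange he he' hz hz').differentiableAt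
    (by simp)).hasFDerivAt.restrictScalars ℝ).fderiv

lemma chartDeriv_chartDerivSymm {e e' : OpenPartialHomeomorph X E} (he : e ∈ atlas E X)
    (he' : e' ∈ atlas E X) {z : E} (hz : z ∈ e.target) (hz' : e.symm z ∈ e'.source) (v : E) :
    chartDeriv e' (e.symm z) (chartDerivSymm e z v) = fderiv ℝ (e' ∘ e.symm) z v := by
  have h1 := (hasMFDerivAt_chart he' hz').comp z (hasMFDerivAt_chart_symm he hz)
  have h2 : HasFDerivAt (e' ∘ e.symm)
      (chartDeriv e' (e.symm z) ∘L chartDerivSymm e z : E →L[ℂ] E) z :=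
    hasMFDerivAt_iff_hasFDerivAt.mp h1
  rw [fderiv_coordChange he he' hz hz', h2.fderiv]
  rfl

lemma chartDerivSymm_chartDeriv {e : OpenPartialHomeomorph X E} (he : e ∈ atlas E X) {x : X}
    (hx : x ∈ e.source) (v : E) : chartDerivSymm e (e x) (chartDeriv e x v) = v := by
  have h1 := ((hasMFDerivAt_chart_symm he (e.map_source hx)).comp x
    (hasMFDerivAt_chart he hx)).congr_of_eventuallyEq
      (f₁ := id) (Filter.eventuallyEq_of_mem (e.open_source.mem_nhds hx)
        fun y hy => (e.left_inv hy).symm)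
  exact congrArg (fun f : E →L[ℂ] E => f v) (hasMFDerivAt_unique h1 (hasMFDerivAt_id x))

lemma chartDerivSymm_ne_zero {e : OpenPartialHomeomorph X E} (he : e ∈ atlas E X) {z : E}
    (hz : z ∈ e.target) {v : E} (hv : v ≠ 0) : chartDerivSymm e z v ≠ 0 := by
  intro h0
  have h1 := ((hasMFDerivAt_chart he (e.map_target hz)).comp z
    (hasMFDerivAt_chart_symm he hz)).congr_of_eventuallyEq
      (f₁ := id) (Filter.eventuallyEq_of_mem (e.open_target.mem_nhds hz)
        fun y hy => (e.right_inv hy).symm)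
  have h2 : chartDeriv e (e.symm z) (chartDerivSymm e z v) = v :=
    congrArg (fun f : E →L[ℂ] E => f v) (hasMFDerivAt_unique h1 (hasMFDerivAt_id z))
  rw [h0, _root_.map_zero] at h2
  exact hv h2.symm

lemma isCoordChange {e e' : OpenPartialHomeomorph X E} (he : e ∈ atlas E X)
    (he' : e' ∈ atlas E X) {z : E} (hz : z ∈ e.target) (hz' : e.symm z ∈ e'.source) :
    IsCoordChange (e' ∘ e.symm) z where
  contDiffAt := ((contDiffAt_coordChange he he' hz hz').restrict_scalars ℝ).of_le (by simp)
  fderiv_J := by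
    filter_upwards [eventually_coordChange hz hz'] with w hw v
    rw [fderiv_coordChange he he' hw.1 hw.2]
    exact _root_.map_smul (fderiv ℂ (e' ∘ e.symm) w) Complex.I v
  exists_inverse := by
    have hw : e' (e.symm z) ∈ e'.target := e'.map_source hz'
    have hw' : e'.symm (e' (e.symm z)) ∈ e.source := by
      rw [e'.left_inv hz']; exact e.map_target hz
    refine ⟨fderiv ℝ (e ∘ e'.symm) (e' (e.symm z)), ?_⟩
    have hd : ∀ {f f' : OpenPartialHomeomorph X E} (_ : f ∈ atlas E X) (_ : f' ∈ atlas E X)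
        {z : E} (_ : z ∈ f.target) (_ : f.symm z ∈ f'.source),
        HasFDerivAt (f' ∘ f.symm) (fderiv ℝ (f' ∘ f.symm) z) z := fun hf hf' _ hz hz' =>
      ((((contDiffAt_coordChange hf hf' hz hz').restrict_scalars ℝ).differentiableAt
        (by simp))).hasFDerivAt
    have hpt : (e ∘ e'.symm) (e' (e.symm z)) = z := by
      simp only [Function.comp_apply]
      rw [e'.left_inv hz', e.right_inv hz]
    have h1 := hd he he' hz hz'
    have h2 := hd he' he hw hw'
    have h3 : HasFDerivAt ((e' ∘ e.symm) ∘ (e ∘ e'.symm))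
        (fderiv ℝ (e' ∘ e.symm) z ∘L fderiv ℝ (e ∘ e'.symm) (e' (e.symm z))) (e' (e.symm z)) := by
      refine HasFDerivAt.comp _ ?_ h2
      rw [hpt]
      exact h1
    refine h3.unique ((hasFDerivAt_id _).congr_of_eventuallyEq ?_)
    filter_upwards [eventually_coordChange hw hw'] with w hw
    simp only [Function.comp_apply, id]
    rw [e.left_inv hw.2, e'.right_inv hw.1]

/-- The expression in the chart `e` of a form that is given at a point through the chart `e'`. -/
lemma inChart_of_eq {e e' : OpenPartialHomeomorph X E} (he : e ∈ atlas E X)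
    (he' : e' ∈ atlas E X) {z : E} (hz : z ∈ e.target) (hz' : e.symm z ∈ e'.source)
    {γ : DForm E X k} {a : AltForm E k}
    (hγ : formAt γ (e.symm z) = a.compContinuousLinearMap
      ((chartDeriv e' (e.symm z)).restrictScalars ℝ)) :
    inChart e γ z = a.compContinuousLinearMap (fderiv ℝ (e' ∘ e.symm) z) := by
  rw [inChart_eq_formAt, hγ]
  ext v
  change a _ = a _
  congr 1
  ext j
  exact chartDeriv_chartDerivSymm he he' hz hz' (v j)

/-- A form is recovered at a point from its expression in a chart. -/
lemma formAt_eq_inChart {e : OpenPartialHomeomorph X E} (he : e ∈ atlas E X) {x : X}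
    (hx : x ∈ e.source) (α : DForm E X k) :
    formAt α x = (inChart e α (e x)).compContinuousLinearMap
      ((chartDeriv e x).restrictScalars ℝ) := by
  rw [inChart_eq_formAt, e.left_inv hx]
  ext v
  change _ = formAt α x _
  congr 1
  ext j
  exact (chartDerivSymm_chartDeriv he hx (v j)).symm

/-- The transformation law of forms under coordinate changes. -/
lemma inChart_coordChange {e e' : OpenPartialHomeomorph X E} (he : e ∈ atlas E X)
    (he' : e' ∈ atlas E X) (α : DForm E X k) {z : E} (hz : z ∈ e.target)
    (hz' : e.symm z ∈ e'.source) :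
    inChart e α z = (inChart e' α (e' (e.symm z))).compContinuousLinearMap
      (fderiv ℝ (e' ∘ e.symm) z) :=
  inChart_of_eq he he' hz hz' (formAt_eq_inChart he' hz' α)

lemma inChart_coordChange_eventuallyEq {e e' : OpenPartialHomeomorph X E} (he : e ∈ atlas E X)
    (he' : e' ∈ atlas E X) (α : DForm E X k) {z : E} (hz : z ∈ e.target)
    (hz' : e.symm z ∈ e'.source) :
    inChart e α =ᶠ[nhds z] fun w => (inChart e' α ((e' ∘ e.symm) w)).compContinuousLinearMap
      (fderiv ℝ (e' ∘ e.symm) w) := by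
  filter_upwards [eventually_coordChange hz hz'] with w hw
  exact inChart_coordChange he he' α hw.1 hw.2

/-- The exterior derivative in an arbitrary chart. -/
theorem inChart_extD {α : DForm E X k} (hα : IsSmooth α) {e : OpenPartialHomeomorph X E}
    (he : e ∈ atlas E X) {z : E} (hz : z ∈ e.target) :
    inChart e (extD α) z = extDeriv (inChart e α) z := by
  have hc := chart_mem_atlas E (e.symm z)
  have hz' := mem_chart_source E (e.symm z)
  rw [inChart_of_eq he hc hz hz' (γ := extD α) rfl,
    extDeriv_congr (inChart_coordChange_eventuallyEq he hc α hz hz')]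
  exact (extDeriv_pullback (f := chartAt E (e.symm z) ∘ e.symm)
    (hα.differentiableAt hc ((chartAt E (e.symm z)).map_source hz'))
    (isCoordChange he hc hz hz').contDiffAt minSmoothness_two_le_infty).symm

lemma IsSmooth.extD {α : DForm E X k} (hα : IsSmooth α) : IsSmooth (extD α) := fun e he =>
  (contDiffOn_extDeriv e.open_target (hα e he)).congr fun _ hz => inChart_extD hα he hz

/-- Closedness of `Θ` may be checked in all charts. -/
lemma isKahler_iff {Θ : DForm E X 2} (hΘ : IsHermitianForm Θ) :
    IsKahler Θ ↔ ∀ e ∈ atlas E X, ∀ z ∈ e.target, extDeriv (inChart e Θ) z = 0 := by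
  constructor
  · intro h e he z hz
    rw [← inChart_extD hΘ.smooth he hz, inChart, h]
    rfl
  · intro h x
    have hx := mem_chart_source E x
    rw [extD, h _ (chart_mem_atlas E x) _ ((chartAt E x).map_source hx)]
    rfl

variable [FiniteDimensional ℂ E]

/-- The type of a form is detected by the derivation `J` in charts. -/
lemma isOfType_iff {p q : ℕ} (hk : p + q = k) (α : DForm E X k) :
    IsOfType p q α ↔ ∀ e ∈ atlas E X, ∀ z ∈ e.target,
      derivAct (complexJ E) (inChart e α z) = typeWeight p q • inChart e α z := by
  constructor
  · intro h e _ z _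
    have h1 : derivAct (complexJ E) (formAt α (e.symm z)) =
        typeWeight p q • formAt α (e.symm z) :=
      (mem_formsOfType_iff hk _).mp (h (e.symm z))
    rw [inChart_eq_formAt, derivAct_compContinuousLinearMap _
      fun v => _root_.map_smul (chartDerivSymm e z) Complex.I v, h1]
    rfl
  · intro h x
    have hx := mem_chart_source E x
    have he := chart_mem_atlas E x
    refine (mem_formsOfType_iff hk (formAt α x)).mpr ?_
    rw [formAt_eq_inChart he hx, derivAct_compContinuousLinearMap _
      fun v => _root_.map_smul (chartDeriv (chartAt E x) x) Complex.I v,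
      h _ he _ ((chartAt E x).map_source hx)]
    rfl

/-- The expression of a Hermitian form in a chart is Hermitian. -/
lemma IsHermitianForm.isHermitianOn {Θ : DForm E X 2} (hΘ : IsHermitianForm Θ)
    {e : OpenPartialHomeomorph X E} (he : e ∈ atlas E X) :
    IsHermitianOn e.target (inChart e Θ) where
  isOpen := e.open_target
  smooth := hΘ.smooth e he
  herm z hz :=
    { invariant := by
        have h1 := (isOfType_iff (p := 1) (q := 1) rfl Θ).mp hΘ.type_one_one e he z hz
        rw [h1]
        simp [typeWeight]
      real := fun v => hΘ.real _ _
      pos := fun v hv => by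
        rw [inChart_eq_formAt, metric_compContinuousLinearMap _
          fun v => _root_.map_smul (chartDerivSymm e z) Complex.I v]
        exact hΘ.pos (e.symm z) _ (chartDerivSymm_ne_zero he hz hv) }

/-- The codifferential of a form, defined through the Levi-Civita connection in the preferred
chart. -/
def codiffForm (Θ : DForm E X 2) (β : DForm E X (k + 1)) : DForm E X k := fun x =>
  (localCodiff (inChart (chartAt E x) Θ) (inChart (chartAt E x) β)
    (chartAt E x x)).compContinuousLinearMap
      ((mfderiv 𝓘(ℂ, E) 𝓘(ℂ, E) (chartAt E x) x).restrictScalars ℝ)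

lemma inChart_codiffForm {Θ : DForm E X 2} (hΘ : IsHermitianForm Θ) {β : DForm E X (k + 1)}
    (hβ : IsSmooth β) {e : OpenPartialHomeomorph X E} (he : e ∈ atlas E X) {z : E}
    (hz : z ∈ e.target) :
    inChart e (codiffForm Θ β) z = localCodiff (inChart e Θ) (inChart e β) z := by
  have hc := chart_mem_atlas E (e.symm z)
  have hz' := mem_chart_source E (e.symm z)
  have hcz := (chartAt E (e.symm z)).map_source hz'
  rw [inChart_of_eq he hc hz hz' (γ := codiffForm Θ β) rfl]
  exact ((isCoordChange he hc hz hz').localCodiff_pullback (hΘ.isHermitianOn hc)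
    (hΘ.isHermitianOn he) hz hcz (inChart_coordChange_eventuallyEq he hc Θ hz hz')
    (hβ.differentiableAt hc hcz) (inChart_coordChange_eventuallyEq he hc β hz hz')).symm

lemma isSmooth_codiffForm {Θ : DForm E X 2} (hΘ : IsHermitianForm Θ) {β : DForm E X (k + 1)}
    (hβ : IsSmooth β) : IsSmooth (codiffForm Θ β) := fun e he =>
  ((hΘ.isHermitianOn he).contDiffOn_localCodiff (hβ e he)).congr
    fun _ hz => inChart_codiffForm hΘ hβ he hz

variable [MeasurableSpace E] [BorelSpace E]

omit [IsManifold 𝓘(ℂ, E) ω X] in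
/-- The product with a form `α` supported in the domain of the chart depends only on the expression
of the other form there. -/
lemma l2Inner_congr {Θ : DForm E X 2} {e : OpenPartialHomeomorph X E} {α : E → AltForm E k}
    (hα : tsupport α ⊆ e.target) {β : DForm E X k} {β' : E → AltForm E k}
    (h : ∀ z ∈ e.target, inChart e β z = β' z) :
    l2Inner Θ e α β = ∫ z, formInner (inChart e Θ z) (α z) (β' z) *
      (volumeDensity (inChart e Θ z) : ℂ) ∂(realBasis E).addHaar := by
  refine MeasureTheory.integral_congr_ae (Filter.Eventually.of_forall fun z => ?_)
  by_cases hz : z ∈ e.target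
  · simp only [h z hz]
  · have h1 : α z = 0 := image_eq_zero_of_notMem_tsupport fun h1 => hz (hα h1)
    simp only [h1, formInner_eq, formPairing_zero_left]

/-- Existence of the codifferential of a smooth form. -/
lemma isCodifferential_codiffForm {Θ : DForm E X 2} (hΘ : IsHermitianForm Θ)
    {β : DForm E X (k + 1)} (hβ : IsSmooth β) : IsCodifferential Θ β (codiffForm Θ β) := by
  intro e he α hα hc ht
  rw [l2Inner_congr ht fun z hz => inChart_codiffForm hΘ hβ he hz]
  exact (hΘ.isHermitianOn he).integral_extDeriv_eq hα hc ht (hβ e he)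

/-- Uniqueness of the codifferential: a smooth form which is adjoint to `d` on test forms is given by
`localCodiff` in each chart. -/
lemma IsCodifferential.inChart_eq {Θ : DForm E X 2} (hΘ : IsHermitianForm Θ)
    {β : DForm E X (k + 1)} (hβ : IsSmooth β) {γ : DForm E X k} (hγs : IsSmooth γ)
    (hγ : IsCodifferential Θ β γ) {e : OpenPartialHomeomorph X E} (he : e ∈ atlas E X) {z : E}
    (hz : z ∈ e.target) : inChart e γ z = localCodiff (inChart e Θ) (inChart e β) z := by
  have hH := hΘ.isHermitianOn he
  have hl := hH.contDiffOn_localCodiff (hβ e he)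
  have h1 : (fun z => inChart e γ z - localCodiff (inChart e Θ) (inChart e β) z) z = 0 := by
    refine hH.eq_zero_of_integral_eq_zero ((hγs e he).sub hl) (fun α hα hc ht => ?_) hz
    have h2 : ∀ w, formInner (inChart e Θ w) (α w)
        (inChart e γ w - localCodiff (inChart e Θ) (inChart e β) w) *
          (volumeDensity (inChart e Θ w) : ℂ) =
        formInner (inChart e Θ w) (α w) (inChart e γ w) * (volumeDensity (inChart e Θ w) : ℂ) -
        formInner (inChart e Θ w) (α w) (localCodiff (inChart e Θ) (inChart e β) w) *
          (volumeDensity (inChart e Θ w) : ℂ) := fun w => by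
      rw [sub_eq_add_neg, formInner_eq, formPairing_add_right, formPairing_neg_right,
        formInner_eq, formInner_eq]
      ring
    simp only [h2]
    rw [MeasureTheory.integral_sub (hH.integrable_formInner_mul hα.contDiffOn (hγs e he) hc ht)
      (hH.integrable_formInner_mul hα.contDiffOn hl hc ht),
      ← hH.integral_extDeriv_eq hα hc ht (hβ e he), sub_eq_zero]
    exact (hγ e he α hα hc ht).symm
  exact sub_eq_zero.mp h1

/-- For smooth `β` the codifferential is not the default value of its definition. -/
lemma codifferential_spec {Θ : DForm E X 2} (hΘ : IsHermitianForm Θ) {β : DForm E X (k + 1)}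
    (hβ : IsSmooth β) :
    IsSmooth (codifferential Θ β) ∧ IsCodifferential Θ β (codifferential Θ β) := by
  have h : ∃ γ : DForm E X k, IsSmooth γ ∧ IsCodifferential Θ β γ :=
    ⟨_, isSmooth_codiffForm hΘ hβ, isCodifferential_codiffForm hΘ hβ⟩
  rw [codifferential, dif_pos h]
  exact h.choose_spec

/-- The codifferential in a chart. -/
theorem inChart_codifferential {Θ : DForm E X 2} (hΘ : IsHermitianForm Θ)
    {β : DForm E X (k + 1)} (hβ : IsSmooth β) {e : OpenPartialHomeomorph X E}
    (he : e ∈ atlas E X) {z : E} (hz : z ∈ e.target) :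
    inChart e (codifferential Θ β) z = localCodiff (inChart e Θ) (inChart e β) z :=
  (codifferential_spec hΘ hβ).2.inChart_eq hΘ hβ (codifferential_spec hΘ hβ).1 he hz

/-- The Laplacian in a chart. -/
theorem inChart_hodgeLaplacian {Θ : DForm E X 2} (hΘ : IsHermitianForm Θ)
    {α : DForm E X (k + 1)} (hα : IsSmooth α) {e : OpenPartialHomeomorph X E}
    (he : e ∈ atlas E X) {z : E} (hz : z ∈ e.target) :
    inChart e (hodgeLaplacian Θ α) z =
      extDeriv (localCodiff (inChart e Θ) (inChart e α)) z +
        localCodiff (inChart e Θ) (extDeriv (inChart e α)) z := by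
  have h1 : inChart e (hodgeLaplacian Θ α) z =
      inChart e (extD (codifferential Θ α)) z + inChart e (codifferential Θ (extD α)) z :=
    inChart_add e _ _ z
  rw [h1, inChart_extD (codifferential_spec hΘ hα).1 he hz, inChart_codifferential hΘ hα.extD he hz]
  congr 1
  · exact extDeriv_congr (Filter.eventuallyEq_of_mem (e.open_target.mem_nhds hz)
      fun w hw => inChart_codifferential hΘ hα he hw)
  · exact localCodiff_congr _ (Filter.eventuallyEq_of_mem (e.open_target.mem_nhds hz)
      fun w hw => inChart_extD hα he hw)

/-- On a Kähler manifold the Laplacian preserves the bigrading. -/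
theorem IsKahler.laplacianPreservesBigrading {Θ : DForm E X 2} (hΘ : IsHermitianForm Θ)
    (hK : IsKahler Θ) : LaplacianPreservesBigrading Θ := by
  have key : ∀ (k p q : ℕ) (hk : p + q = k) (α : DForm E X k), IsSmooth α → IsOfType p q α →
      IsOfType p q (hodgeLaplacian Θ α) := by
    intro k p q hk α hα hαt
    rw [isOfType_iff hk] at hαt ⊢
    intro e he z hz
    cases k with
    | zero =>
      -- all functions are of type `(0,0)`
      obtain ⟨rfl, rfl⟩ := Nat.add_eq_zero_iff.mp hk
      rw [derivAct_zero_degree]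
      simp [typeWeight]
    | succ k =>
      rw [inChart_hodgeLaplacian hΘ hα he hz]
      exact (hΘ.isHermitianOn he).derivAct_laplacian ((isKahler_iff hΘ).mp hK e he) (hα e he) _
        (hαt e he) hz
  exact fun p q α => key (p + q) p q rfl α

end Manifold


/-! ### The Laplacian of a product of a function and a constant one-form -/

section Converse

variable {E : Type*} [NormedAddCommGroup E] [NormedSpace ℂ E] {k : ℕ}

lemma contr_derivAct_one (A : E →L[ℝ] E) (a : AltForm E 1) (v : E) :
    contr v (derivAct A a) = contr (A v) a := by
  rw [contr_derivAct, derivAct_zero_degree, zero_add]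

lemma contr_contr_alternatize (N : E →L[ℝ] AltForm E 1) (u v : E) :
    contr u (contr v (alternatizeUncurryFin N)) = contr u (N v) - contr v (N u) := by
  rw [contr_alternatize, _root_.map_sub, contr_alternatize_zero]
  rfl

/-- A one-form is of type `(1,0)` if and only if it is complex linear. -/
lemma derivAct_J_one_iff (a : AltForm E 1) :
    derivAct (complexJ E) a = Complex.I • a ↔
      ∀ v, contr (Complex.I • v) a = Complex.I • contr v a := by
  constructor
  · intro h v
    rw [← contr_complex_smul, ← h, contr_derivAct_one, complexJ_apply]
  · intro h
    refine ext_contr fun v => ?_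
    rw [contr_derivAct_one, contr_complex_smul, complexJ_apply, h]

lemma hasFDerivAt_affine_smul (ℓ : E →L[ℝ] ℝ) (z₀ : E) (a : AltForm E k) (z : E) :
    HasFDerivAt (fun z => ℓ (z - z₀) • a) (ℓ.smulRight a) z := by
  have h1 : HasFDerivAt (fun z => ℓ (z - z₀)) ℓ z :=
    ℓ.hasFDerivAt.comp z ((hasFDerivAt_id z).sub_const z₀)
  exact h1.smul_const a

/-- The algebraic core of the computation of the Laplacian of `f • a`: here `S` is the inverse
metric, `M i` the matrix of `Γ_{e_i}`, `ℓ` the differential of `f`, and `α i = a(e_i)`. -/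
lemma laplacian_sum {W : Type*} [AddCommGroup W] [Module ℝ W] {n : Type*} [Fintype n]
    [DecidableEq n] (S : Matrix n n ℝ) (hS : ∀ i j, S i j = S j i) (M : Matrix n n ℝ) (ℓ : n → ℝ)
    (α : n → W) :
    ∑ i, ∑ j, ((M * S + S * M.transpose) i j * ℓ j) • α i =
      ∑ i, ∑ j, (S i j * ℓ i) • ∑ c, M c j • α c +
        ∑ i, ∑ j, (S i j * ∑ c, M c j * ℓ c) • α i := by
  simp only [Matrix.add_apply, Matrix.mul_apply, Matrix.transpose_apply, add_mul, add_smul,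
    Finset.sum_add_distrib]
  congr 1
  · simp only [Finset.sum_mul, Finset.sum_smul, Finset.smul_sum, smul_smul]
    rw [Finset.sum_congr rfl fun i _ => Finset.sum_comm, Finset.sum_comm]
    conv_rhs => rw [Finset.sum_comm]
    refine Finset.sum_congr rfl fun j _ => ?_
    conv_rhs => rw [Finset.sum_comm]
    refine Finset.sum_congr rfl fun i _ => Finset.sum_congr rfl fun c _ => ?_
    rw [hS c j]
    congr 1
    ring
  · refine Finset.sum_congr rfl fun i _ => ?_
    simp only [Finset.sum_mul, Finset.mul_sum, Finset.sum_smul]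
    rw [Finset.sum_comm]
    refine Finset.sum_congr rfl fun j _ => Finset.sum_congr rfl fun c _ => ?_
    rw [mul_assoc]

variable [FiniteDimensional ℂ E]

lemma nabla_const {Θ : E → AltForm E 2} (a : AltForm E k) (z v : E) :
    nabla Θ (fun _ => a) z v = -derivAct (christoffelOf Θ z v) a := by
  rw [nabla, covDeriv_apply, fderiv_const_apply, zero_apply, zero_sub]

/-- The codifferential of a constant two-form `ℓ ∧ a`. -/
lemma contr_localCodiff_wedge {Θ : E → AltForm E 2} (ℓ : E →L[ℝ] ℝ) (a : AltForm E 1) (z u : E) :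
    contr u (localCodiff Θ (fun _ => alternatizeUncurryFin (ℓ.smulRight a)) z) =
      ∑ i, ∑ j, (gram (Θ z))⁻¹ i j •
      (ℓ (realBasis E i) • contr (christoffelOf Θ z (realBasis E j) u) a -
        ℓ u • contr (christoffelOf Θ z (realBasis E j) (realBasis E i)) a +
        (ℓ (christoffelOf Θ z (realBasis E j) (realBasis E i)) • contr u a -
        ℓ (christoffelOf Θ z (realBasis E j) u) • contr (realBasis E i) a)) := by
  rw [localCodiff, codiffAt, metricTrace, _root_.map_neg]
  simp only [_root_.map_sum, _root_.map_smul, nabla_const, _root_.map_neg, smul_neg,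
    Finset.sum_neg_distrib, neg_neg]
  refine Finset.sum_congr rfl fun i _ => Finset.sum_congr rfl fun j _ => ?_
  rw [derivAct_alternatize, _root_.map_add, _root_.map_add, contr_contr_alternatize,
    contr_contr_alternatize]
  simp only [ContinuousLinearMap.comp_apply, ContinuousLinearMap.smulRight_apply,
    _root_.map_smul, contr_derivAct_one]

/-- The codifferential of the one-form `f • a` with affine `f`. -/
lemma localCodiff_affine_smul {Θ : E → AltForm E 2} (ℓ : E →L[ℝ] ℝ) (z₀ : E) (a : AltForm E 1)
    (z : E) :
    localCodiff Θ (fun z => ℓ (z - z₀) • a) z =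
      ℓ (z - z₀) • localCodiff Θ (fun _ => a) z -
      ∑ i, ∑ j, ((gram (Θ z))⁻¹ i j * ℓ (realBasis E j)) • contr (realBasis E i) a := by
  have h3 : ∀ v, nabla Θ (fun z => ℓ (z - z₀) • a) z v =
      ℓ v • a + ℓ (z - z₀) • nabla Θ (fun _ => a) z v := fun v => by
    rw [nabla_const, nabla, covDeriv_apply, (hasFDerivAt_affine_smul ℓ z₀ a z).fderiv, smul_neg,
      ← sub_eq_add_neg, ← _root_.map_smul]
    rfl
  simp only [localCodiff, codiffAt, metricTrace, h3, _root_.map_add, _root_.map_smul,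
    smul_add, Finset.sum_add_distrib, smul_neg, Finset.smul_sum, smul_smul]
  have hc : ∀ i j, (gram (Θ z))⁻¹ i j * ℓ (z - z₀) = ℓ (z - z₀) * (gram (Θ z))⁻¹ i j :=
    fun _ _ => mul_comm _ _
  simp only [hc]
  rw [neg_add_rev]
  exact (sub_eq_add_neg _ _).symm

lemma localCodiff_const {Θ : E → AltForm E 2} (a : AltForm E 1) (z : E) :
    localCodiff Θ (fun _ => a) z =
    ∑ i, ∑ j, (gram (Θ z))⁻¹ i j •
      contr (christoffelOf Θ z (realBasis E j) (realBasis E i)) a := by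
  simp only [localCodiff, codiffAt, metricTrace, nabla_const, _root_.map_neg, smul_neg,
    Finset.sum_neg_distrib, neg_neg, contr_derivAct_one]

namespace IsHermitianOn

variable {V : Set E} {Θ : E → AltForm E 2} (h : IsHermitianOn V Θ)
include h

/-- The differential of the codifferential of `f • a` at a zero of the affine function `f`. -/
lemma contr_extDeriv_localCodiff_affine_smul {z₀ : E} (hz₀ : z₀ ∈ V) (ℓ : E →L[ℝ] ℝ)
    (a : AltForm E 1) (u : E) :
    contr u (extDeriv (localCodiff Θ fun z => ℓ (z - z₀) • a) z₀) =
      ℓ u • localCodiff Θ (fun _ => a) z₀ +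
      ∑ i, ∑ j, ((endMatrix (christoffelOf Θ z₀ u) * (gram (Θ z₀))⁻¹ +
        (gram (Θ z₀))⁻¹ * (endMatrix (christoffelOf Θ z₀ u)).transpose) i j *
        ℓ (realBasis E j)) • contr (realBasis E i) a := by
  have hz0 : z₀ + (0 : ℝ) • u = z₀ := by simp
  have hV := h.isOpen.mem_nhds hz₀
  have hline : HasDerivAt (fun t : ℝ => z₀ + t • u) u 0 := by
    simpa using ((hasDerivAt_id (0 : ℝ)).smul_const u).const_add z₀
  have hα : ContDiff ℝ ∞ fun z => ℓ (z - z₀) • a :=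
    (ℓ.contDiff.comp (contDiff_id.sub contDiff_const)).smul contDiff_const
  have hβ : DifferentiableAt ℝ (localCodiff Θ fun z => ℓ (z - z₀) • a) z₀ :=
    ((h.contDiffOn_localCodiff hα.contDiffOn).contDiffAt hV).differentiableAt (by simp)
  have hD : DifferentiableAt ℝ (localCodiff Θ fun _ => a) z₀ :=
    ((h.contDiffOn_localCodiff contDiffOn_const).contDiffAt hV).differentiableAt (by simp)
  rw [extDeriv, contr_alternatize_zero, ← hβ.lineDeriv_eq_fderiv]
  have h7 : HasDerivAt (fun t : ℝ => localCodiff Θ (fun _ => a) (z₀ + t • u))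
      (fderiv ℝ (localCodiff Θ fun _ => a) z₀ u) 0 := by
    have : HasFDerivAt (localCodiff Θ fun _ => a) (fderiv ℝ (localCodiff Θ fun _ => a) z₀)
      (z₀ + (0 : ℝ) • u) := by rw [hz0]; exact hD.hasFDerivAt
    exact this.comp_hasDerivAt 0 hline
  have h8 : HasDerivAt (fun t : ℝ => ℓ (z₀ + t • u - z₀)) (ℓ u) 0 :=
    ℓ.hasFDerivAt.comp_hasDerivAt 0 (hline.sub_const z₀)
  have h9 := (h8.smul h7).sub (HasDerivAt.fun_sum fun i (_ : i ∈ Finset.univ) =>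
    HasDerivAt.fun_sum fun j (_ : j ∈ Finset.univ) =>
      ((h.hasDerivAt_gramInv hz₀ u i j).mul_const (ℓ (realBasis E j))).smul_const
        (contr (realBasis E i) a))
  have h10 : (fun t : ℝ => localCodiff Θ (fun z => ℓ (z - z₀) • a) (z₀ + t • u)) = _ :=
    funext fun t => localCodiff_affine_smul ℓ z₀ a (z₀ + t • u)
  rw [lineDeriv, h10]
  refine h9.deriv.trans ?_
  simp only [zero_smul, add_zero, sub_self, _root_.map_zero, zero_add, neg_mul, _root_.neg_smul,
    Finset.sum_neg_distrib, sub_neg_eq_add]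

/-- The Laplacian of `f • a` at a zero of the affine function `f`, for a constant one-form `a`:
up to a multiple of `a` it is `2 a(Γ(grad f, ·))`. -/
theorem contr_laplacian {z₀ : E} (hz₀ : z₀ ∈ V) (a : AltForm E 1) (w : E) :
    ∃ c : ℝ, ∀ u, contr u
      (extDeriv (localCodiff Θ fun z => metricBilin (Θ z₀) w (z - z₀) • a) z₀ +
        localCodiff Θ (extDeriv fun z => metricBilin (Θ z₀) w (z - z₀) • a) z₀) =
      (2 : ℝ) • contr (christoffelOf Θ z₀ w u) a + c • contr u a := by
  have hH := h.herm z₀ hz₀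
  have hΓs := (h.isChristoffel hz₀).symm
  refine ⟨∑ i, ∑ j, (gram (Θ z₀))⁻¹ i j *
    metricBilin (Θ z₀) w (christoffelOf Θ z₀ (realBasis E j) (realBasis E i)), fun u => ?_⟩
  have hdα : extDeriv (fun z => metricBilin (Θ z₀) w (z - z₀) • a) =
      fun _ => alternatizeUncurryFin ((metricBilin (Θ z₀) w).smulRight a) := by
    funext z
    rw [extDeriv, (hasFDerivAt_affine_smul _ z₀ a z).fderiv]
  rw [_root_.map_add, hdα, contr_localCodiff_wedge,
    h.contr_extDeriv_localCodiff_affine_smul hz₀, laplacian_sum _ hH.gramInv_symm,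
    localCodiff_const]
  -- contraction with the gradient `w`
  have h10 : ∑ i, ∑ j, ((gram (Θ z₀))⁻¹ i j * metricBilin (Θ z₀) w (realBasis E i)) •
      contr (christoffelOf Θ z₀ (realBasis E j) u) a = contr (christoffelOf Θ z₀ w u) a := by
    let F : E →ₗ[ℝ] AltForm E 0 :=
      { toFun := fun v => contr (christoffelOf Θ z₀ v u) a
        map_add' := fun v v' => by rw [_root_.map_add, add_apply, contr_add]
        map_smul' := fun c v => by rw [_root_.map_smul, smul_apply, contr_smul]; rfl }
    refine Eq.trans ?_ (hH.metricTrace_metric w F)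
    simp only [metricTrace, smul_smul]
    rfl
  have h12 : ∀ j, ∑ c, endMatrix (christoffelOf Θ z₀ u) c j • contr (realBasis E c) a =
      contr (christoffelOf Θ z₀ (realBasis E j) u) a := fun j => by
    rw [← hΓs u (realBasis E j), ← endMatrix_sum, contr_sum]
    simp only [contr_smul]
  have h13 : ∀ j, ∑ c, endMatrix (christoffelOf Θ z₀ u) c j *
      metricBilin (Θ z₀) w (realBasis E c) =
      metricBilin (Θ z₀) w (christoffelOf Θ z₀ (realBasis E j) u) := fun j => by
    rw [← hΓs u (realBasis E j), ← endMatrix_sum, _root_.map_sum]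
    simp only [_root_.map_smul, smul_eq_mul]
  simp only [h12, h13, smul_add, smul_sub, smul_smul, Finset.sum_add_distrib,
    Finset.sum_sub_distrib, h10, Finset.sum_smul, Finset.smul_sum, two_smul]
  simp only [mul_comm (metricBilin (Θ z₀) w u)]
  abel

/-- If the Laplacian of all `f • a` is of type `(1,0)`, the Christoffel symbols are complex
linear, so that the metric is Kähler. -/
theorem extDeriv_eq_zero_of_laplacian {z₀ : E} (hz₀ : z₀ ∈ V)
    (hΔ : ∀ (a : AltForm E 1) (w : E), derivAct (complexJ E) a = Complex.I • a →
      derivAct (complexJ E)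
        (extDeriv (localCodiff Θ fun z => metricBilin (Θ z₀) w (z - z₀) • a) z₀ +
          localCodiff Θ (extDeriv fun z => metricBilin (Θ z₀) w (z - z₀) • a) z₀) =
      Complex.I • (extDeriv (localCodiff Θ fun z => metricBilin (Θ z₀) w (z - z₀) • a) z₀ +
          localCodiff Θ (extDeriv fun z => metricBilin (Θ z₀) w (z - z₀) • a) z₀)) :
    extDeriv Θ z₀ = 0 := by
  refine (h.jet hz₀).alternatize_eq_zero (h.isChristoffel hz₀) fun w u => ?_
  rw [← sub_eq_zero]
  by_contra hne
  -- a constant `(1,0)`-form `a` that detects the failure of complex linearity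
  obtain ⟨L, hL⟩ := SeparatingDual.exists_ne_zero (R := ℂ) hne
  refine hL ?_
  let a : AltForm E 1 := ContinuousAlternatingMap.ofSubsingleton ℝ E ℂ (0 : Fin 1)
    (L.restrictScalars ℝ)
  have hav : ∀ v, contr v a ![] = L v := fun v => rfl
  have ha : derivAct (complexJ E) a = Complex.I • a := by
    rw [derivAct_J_one_iff]
    intro v
    ext x
    rw [Subsingleton.elim x ![], ContinuousAlternatingMap.smul_apply, hav, hav, _root_.map_smul]
  have h1 := (derivAct_J_one_iff _).mp (hΔ a w ha) u
  obtain ⟨c, hc⟩ := h.contr_laplacian hz₀ a w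
  rw [hc, hc, (derivAct_J_one_iff a).mp ha u, smul_add, smul_comm c Complex.I,
    add_left_inj] at h1
  have h2 := congrArg (fun f : AltForm E 0 => f ![]) h1
  simp only [ContinuousAlternatingMap.smul_apply, hav] at h2
  rw [smul_comm Complex.I (2 : ℝ)] at h2
  have h3 := smul_right_injective ℂ (two_ne_zero (α := ℝ)) h2
  rw [_root_.map_sub, h3, L.map_smul, sub_self]

end IsHermitianOn

end Converse


/-! ### Extending compactly supported forms from a chart -/

section Extension

variable {E : Type*} [NormedAddCommGroup E] [NormedSpace ℂ E]
  {X : Type*} [TopologicalSpace X] [ChartedSpace E X] {k : ℕ}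

open Classical in
/-- The extension by zero of a form given in the chart `e`. -/
def extendForm (e : OpenPartialHomeomorph X E) (η : E → AltForm E k) : DForm E X k := fun x =>
  if x ∈ e.source then
    (η (e x)).compContinuousLinearMap ((chartDeriv e x : E →L[ℂ] E).restrictScalars ℝ)
  else 0

lemma formAt_extendForm {e : OpenPartialHomeomorph X E} (η : E → AltForm E k) {x : X}
    (hx : x ∈ e.source) : formAt (extendForm e η) x =
      (η (e x)).compContinuousLinearMap ((chartDeriv e x : E →L[ℂ] E).restrictScalars ℝ) :=
  if_pos hx

lemma formAt_extendForm_of_eq_zero {e : OpenPartialHomeomorph X E} (η : E → AltForm E k) {x : X}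
    (hx : x ∈ e.source → η (e x) = 0) : formAt (extendForm e η) x = 0 := by
  by_cases h : x ∈ e.source
  · rw [formAt_extendForm η h, hx h]
    rfl
  · exact if_neg h

/-- There are cut-off functions which are `1` near a point. -/
lemma exists_contDiff_eventuallyEq_one [FiniteDimensional ℂ E] {s : Set E} {z : E}
    (hs : s ∈ nhds z) : ∃ χ : E → ℝ, tsupport χ ⊆ s ∧ HasCompactSupport χ ∧ ContDiff ℝ ∞ χ ∧
      χ =ᶠ[nhds z] fun _ => 1 := by
  obtain ⟨r, hr, hrs⟩ := Metric.nhds_basis_closedBall.mem_iff.mp hs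
  let χ : ContDiffBump z := ⟨r / 2, r, half_pos hr, half_lt_self hr⟩
  exact ⟨χ, χ.tsupport_eq.subset.trans hrs, χ.hasCompactSupport, χ.contDiff, χ.eventuallyEq_one⟩

/-- On a finite-dimensional space, forms depend smoothly on a parameter if their values do. -/
lemma contDiffAt_of_apply [FiniteDimensional ℂ E] {f : E → AltForm E k} {z : E}
    (hf : ∀ v, ContDiffAt ℝ ∞ (fun w => f w v) z) : ContDiffAt ℝ ∞ f z := by
  let ev : AltForm E k →ₗ[ℝ] (Fin k → Fin (Module.finrank ℝ E)) → ℂ :=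
    { toFun := fun a I => a fun r => realBasis E (I r)
      map_add' := fun _ _ => rfl
      map_smul' := fun _ _ => rfl }
  have hker : LinearMap.ker ev = ⊥ := by
    rw [LinearMap.ker_eq_bot]
    intro a b hab
    have h1 : a.toMultilinearMap = b.toMultilinearMap :=
      Module.Basis.ext_multilinear (fun _ => realBasis E) fun I => congrFun hab I
    ext v
    exact congrArg (fun m : MultilinearMap ℝ (fun _ : Fin k => E) ℂ => m v) h1
  obtain ⟨g, hg⟩ := ev.exists_leftInverse_of_injective hker
  have h2 : ContDiffAt ℝ ∞ (fun w => ev (f w)) z := contDiffAt_pi.mpr fun I => hf _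
  have h3 := g.toContinuousLinearMap.contDiff.contDiffAt.comp z h2
  refine h3.congr_of_eventuallyEq (Filter.Eventually.of_forall fun w => ?_)
  exact (congrArg (fun m : AltForm E k →ₗ[ℝ] AltForm E k => m (f w)) hg).symm

lemma contDiffAt_compContinuousLinearMap [FiniteDimensional ℂ E] {f : E → AltForm E k}
    {A : E → E →L[ℝ] E} {z : E} (hf : ContDiffAt ℝ ∞ f z) (hA : ContDiffAt ℝ ∞ A z) :
    ContDiffAt ℝ ∞ (fun w => (f w).compContinuousLinearMap (A w)) z := by
  refine contDiffAt_of_apply fun v => ?_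
  let C := ContinuousMultilinearMap.compContinuousLinearMapContinuousMultilinear ℝ
    (fun _ : Fin k => E) (fun _ : Fin k => E) ℂ
  have h1 : ContDiffAt ℝ ∞ (fun w => C (fun _ => A w)) z :=
    C.contDiff.contDiffAt.comp z (contDiffAt_pi.mpr fun _ => hA)
  let T : AltForm E k →L[ℝ] ContinuousMultilinearMap ℝ (fun _ : Fin k => E) ℂ :=
    ContinuousAlternatingMap.toContinuousMultilinearMapCLM ℝ
  have h2 : ContDiffAt ℝ ∞ (fun w => T (f w)) z := T.contDiff.contDiffAt.comp z hf
  exact (ContinuousMultilinearMap.apply ℝ (fun _ : Fin k => E) ℂ v).contDiff.contDiffAt.comp z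
    (h1.clm_apply h2)

lemma isOfType_extendForm [FiniteDimensional ℂ E] {e : OpenPartialHomeomorph X E} {p q : ℕ}
    (hk : p + q = k) {η : E → AltForm E k}
    (hη : ∀ z, derivAct (complexJ E) (η z) = typeWeight p q • η z) :
    IsOfType p q (extendForm e η) := by
  intro x
  refine (mem_formsOfType_iff hk (formAt (extendForm e η) x)).mpr ?_
  by_cases hx : x ∈ e.source
  · rw [formAt_extendForm η hx, derivAct_compContinuousLinearMap _
      fun v => _root_.map_smul (chartDeriv e x) Complex.I v, hη]
    rfl
  · rw [formAt_extendForm_of_eq_zero η fun h => absurd h hx, _root_.map_zero, smul_zero]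

variable [IsManifold 𝓘(ℂ, E) ω X]

lemma inChart_extendForm {e e' : OpenPartialHomeomorph X E} (he : e ∈ atlas E X)
    (he' : e' ∈ atlas E X) (η : E → AltForm E k) {z : E} (hz : z ∈ e'.target)
    (hz' : e'.symm z ∈ e.source) :
    inChart e' (extendForm e η) z =
      (η (e (e'.symm z))).compContinuousLinearMap (fderiv ℝ (e ∘ e'.symm) z) :=
  inChart_of_eq he' he hz hz' (formAt_extendForm η hz')

lemma inChart_extendForm_self {e : OpenPartialHomeomorph X E} (he : e ∈ atlas E X)
    (η : E → AltForm E k) {z : E} (hz : z ∈ e.target) : inChart e (extendForm e η) z = η z := by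
  have h1 : fderiv ℝ (e ∘ e.symm) z = .id ℝ E :=
    ((hasFDerivAt_id z).congr_of_eventuallyEq (Filter.eventuallyEq_of_mem
      (e.open_target.mem_nhds hz) fun w hw => e.right_inv hw)).fderiv
  rw [inChart_extendForm he he η hz (e.map_target hz), h1, e.right_inv hz]
  rfl

/-- Extension by zero preserves smoothness: since `X` is Hausdorff, the image of the compact support
is closed in `X`. -/
lemma isSmooth_extendForm [FiniteDimensional ℂ E] [T2Space X] {e : OpenPartialHomeomorph X E}
    (he : e ∈ atlas E X) {η : E → AltForm E k} (hη : ContDiff ℝ ∞ η) (hc : HasCompactSupport η)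
    (ht : tsupport η ⊆ e.target) : IsSmooth (extendForm e η) := by
  intro e' he' z hz
  refine ContDiffAt.contDiffWithinAt ?_
  by_cases hz' : e'.symm z ∈ e.source
  · have hφ := (isCoordChange he' he hz hz').contDiffAt
    have h1 : ContDiffAt ℝ ∞ (fun w => (η ((e ∘ e'.symm) w)).compContinuousLinearMap
        (fderiv ℝ (e ∘ e'.symm) w)) z :=
      contDiffAt_compContinuousLinearMap (hη.contDiffAt.comp z hφ)
        (hφ.fderiv_right (m := ∞) (by simp))
    refine h1.congr_of_eventuallyEq ?_
    filter_upwards [eventually_coordChange hz hz'] with w hw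
    exact inChart_extendForm he he' η hw.1 hw.2
  · have hK : IsClosed (e.symm '' tsupport η) :=
      (hc.isCompact.image_of_continuousOn (e.continuousOn_symm.mono ht)).isClosed
    have h1 : e'.symm z ∉ e.symm '' tsupport η := by
      rintro ⟨w, hw, hwz⟩
      exact hz' (hwz ▸ e.map_target (ht hw))
    have h2 : ∀ᶠ w in nhds z, e'.symm w ∉ e.symm '' tsupport η :=
      (e'.continuousAt_symm hz).eventually_mem (hK.isOpen_compl.mem_nhds h1)
    refine (contDiffAt_const (c := 0)).congr_of_eventuallyEq ?_
    filter_upwards [h2] with w hw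
    rw [inChart_eq_formAt, formAt_extendForm_of_eq_zero]
    · rfl
    · intro h3
      refine image_eq_zero_of_notMem_tsupport fun h4 => hw ⟨_, h4, e.left_inv h3⟩

variable [FiniteDimensional ℂ E] [MeasurableSpace E] [BorelSpace E]

/-- If the Laplacian preserves the bigrading, the manifold is Kähler: the Laplacian is evaluated
on `(1,0)`-forms which are `f • a` near a point, with `f` affine and `a` constant in a chart. -/
theorem LaplacianPreservesBigrading.isKahler [T2Space X] {Θ : DForm E X 2}
    (hΘ : IsHermitianForm Θ) (hΔ : LaplacianPreservesBigrading Θ) : IsKahler Θ := by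
  rw [isKahler_iff hΘ]
  intro e he z₀ hz₀
  refine (hΘ.isHermitianOn he).extDeriv_eq_zero_of_laplacian hz₀ fun a w ha => ?_
  obtain ⟨χ, hχt, hχc, hχs, hχ1⟩ :=
    exists_contDiff_eventuallyEq_one (e.open_target.mem_nhds hz₀)
  set f : E → AltForm E 1 := fun z => metricBilin (inChart e Θ z₀) w (z - z₀) • a with hf
  have hfs : ContDiff ℝ ∞ f :=
    ((metricBilin (inChart e Θ z₀) w).contDiff.comp
      (contDiff_id.sub contDiff_const)).smul contDiff_const
  have hηt : tsupport (fun z => χ z • f z) ⊆ tsupport χ :=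
    closure_mono fun z hz hz' => hz (by simp [hz'])
  have hηc : HasCompactSupport fun z => χ z • f z :=
    hχc.isCompact.of_isClosed_subset (isClosed_tsupport _) hηt
  have hηs : ContDiff ℝ ∞ fun z => χ z • f z := hχs.smul hfs
  have hα := isSmooth_extendForm he hηs hηc (hηt.trans hχt)
  have ha' : ∀ z, derivAct (complexJ E) (χ z • f z) = typeWeight 1 0 • (χ z • f z) := fun z => by
    simp only [hf, _root_.map_smul, ha, typeWeight]
    simp only [Nat.cast_one, Nat.cast_zero, sub_zero, mul_one]
    rw [smul_comm Complex.I, smul_comm Complex.I]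
  have h1 := (isOfType_iff rfl _).mp
    (hΔ 1 0 _ hα (isOfType_extendForm (e := e) rfl ha')) e he z₀ hz₀
  have h2 := inChart_hodgeLaplacian hΘ hα he hz₀
  have h3 : inChart e (extendForm e fun z => χ z • f z) =ᶠ[nhds z₀] f := by
    filter_upwards [e.open_target.mem_nhds hz₀, hχ1] with z hz hz1
    rw [inChart_extendForm_self he _ hz, hz1, one_smul]
  have h4 : localCodiff (inChart e Θ) (inChart e (extendForm e fun z => χ z • f z)) =ᶠ[nhds z₀]
      localCodiff (inChart e Θ) f := by
    filter_upwards [h3.eventuallyEq_nhds] with z hz using localCodiff_congr _ hz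
  have h5 : extDeriv (inChart e (extendForm e fun z => χ z • f z)) =ᶠ[nhds z₀] extDeriv f := by
    filter_upwards [h3.eventuallyEq_nhds] with z hz using extDeriv_congr hz
  rw [extDeriv_congr h4, localCodiff_congr _ h5] at h2
  have h6 : typeWeight 1 0 = Complex.I := by simp [typeWeight]
  rw [h6] at h1
  rw [← h2]
  exact h1

end Extension

end

end HermitianGeometry

theorem theorem2p2 {E : Type*} [NormedAddCommGroup E] [NormedSpace ℂ E] [FiniteDimensional ℂ E]
    [MeasurableSpace E] [BorelSpace E]
    {X : Type*} [TopologicalSpace X] [T2Space X] [ChartedSpace E X] [IsManifold 𝓘(ℂ, E) ω X]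
    (Θ : HermitianGeometry.DForm E X 2) (hΘ : HermitianGeometry.IsHermitianForm Θ) :
    HermitianGeometry.IsKahler Θ ↔ HermitianGeometry.LaplacianPreservesBigrading Θ :=
  ⟨fun h => h.laplacianPreservesBigrading hΘ, fun h => h.isKahler hΘ⟩
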